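/- Let $n\ge 1$. For a nonnegative $C^2$ function $f$ on $\mathbb R^n$ put \[ J(f)=\sum_{i,j=1}^n\int_{\{f>0\}}\bigl[\partial_{ij}(\log f)\bigr]^2 f\,dx =\sum_{i,j=1}^n\int_{\{f>0\}}\Bigl[\frac{\partial_{ij}f}{f}-\frac{\partial_i f\,\partial_j f}{f^2}\Bigr]^2 f\,dx\in[0,\infty], \] and, for a random vector $X$ with a $C^2$ probability density $f$, put $J(X)=J(f)$. A function $f\ge 0$ is called log-concave if $f=e^{-\Phi}$ for a convex function $\Phi:\mathbb R^n\to\mathbb R\cup\{+\infty\}$. Let $X$ and $Y$ be independent random vectors in $\mathbb R^n$ with log-concave probability densities $f$ and $g$ of class $C^2$ on $\mathbb R^n$, and suppose that $J(X)<\infty$ and $J(Y)<\infty$. Then $X+Y$ has a log-concave $C^2$ density, the numbers $J(X)$, $J(Y)$, $J(X+Y)$ are positive and finite, and \[ \frac 1{\sqrt{J(X+Y)}}\ \ge\ \frac 1{\sqrt{J(X)}}+\frac 1{\sqrt{J(Y)}} . \] Moreover, equality holds if and only if $X$ and $Y$ are both Gaussian vectors with proportional covariance matrices, i.e. $\operatorname{Cov}(Y)=c\,\operatorname{Cov}(X)$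 for some $c>0$ (equivalently, $X$ and $Y$ are, up to translation and dilation, one and the same Gaussian vector). -/

import Mathlib

open MeasureTheory ProbabilityTheory

/-- The random vector `X` has the function `f ≥ 0` as a probability density with respect to
Lebesgue measure on `ℝⁿ`. -/
structure HasDensity {Ω : Type*} [MeasurableSpace Ω] {n : ℕ}
    (X : Ω → EuclideanSpace ℝ (Fin n)) (f : EuclideanSpace ℝ (Fin n) → ℝ)
    (P : Measure Ω) : Prop where
  aemeasurable : AEMeasurable X P
  nonneg : ∀ x, 0 ≤ f x
  map_eq : P.map X = volume.withDensity (fun x => ENNReal.ofReal (f x))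

/-- Log-concave functions: `f = exp (-Φ)` with `Φ` convex. The value `Φ = +∞`, that is `f = 0`, is
allowed outside the convex set `{f > 0}`. -/
structure IsLogConcave {n : ℕ} (f : EuclideanSpace ℝ (Fin n) → ℝ) : Prop where
  nonneg : ∀ x, 0 ≤ f x
  concaveOn_log : ConcaveOn ℝ {x | 0 < f x} (fun x => Real.log (f x))

/-- The partial derivative `∂ᵢ f`. -/
noncomputable def partialDeriv {n : ℕ} (i : Fin n) (f : EuclideanSpace ℝ (Fin n) → ℝ) :
    EuclideanSpace ℝ (Fin n) → ℝ :=
  fun x => fderiv ℝ f x (EuclideanSpace.single i 1)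

/-- The functional
`J(f) = ∑ᵢⱼ ∫_{f > 0} (∂ᵢⱼ f / f - ∂ᵢ f ∂ⱼ f / f²)² f dx = ∑ᵢⱼ ∫_{f > 0} (∂ᵢⱼ log f)² f dx`,
with values in `[0, ∞]`. -/
noncomputable def fisherProduction {n : ℕ} (f : EuclideanSpace ℝ (Fin n) → ℝ) : ENNReal :=
  ∑ i : Fin n, ∑ j : Fin n, ∫⁻ x in {x | 0 < f x},
    ENNReal.ofReal
      ((partialDeriv i (partialDeriv j f) x / f x
        - partialDeriv i f x * partialDeriv j f x / f x ^ 2) ^ 2 * f x)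

/-! Let `k` be the density of `Z = X + Y`, and write `u = ∇ log f (X)`, `v = ∇ log g (Y)`. In a
convolution each derivative may fall on either factor, so for `a + b = 1` the score of `k` at `z` is
the conditional mean of `a u + b v` given `Z = z`. Splitting `D²k` with the weights `a²`, `2ab`,
`b²` gives `D² log k (z) = E[a² D² log f (X) + b² D² log g (Y) | Z = z] + Cov(a u + b v | Z = z)`.
Dropping the covariance is `IsRegularDensity.weightedHess_div_le_hessLog`. By Prékopa's theorem `-D²
log k` is positive semidefinite, and the Hilbert–Schmidt norm is monotone on such matrices
(`sum_sq_le_sum_sq_of_quadratic_le`). The bound can therefore be squared; after conditional Jensen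
and integration in `z` it yields `J(k) ≤ a⁴ J(f) + 2 a² b² S + b⁴ J(g)`, with `S = ⟨E D² log f (X),
E D² log g (Y)⟩` (`IsRegularDensity.hessMass_densityConv_le`). Put `p = √J(f)`, `q = √J(g)`.
Cauchy–Schwarz gives `S ≤ pq`, and the optimal `a = q/(p+q)` gives `√J(k) ≤ pq/(p+q)`, which is the
claim.

Equality forces `S = pq`, hence `D² log f (x) / p = D² log g (y) / q` wherever both densities are
positive. Both Hessians are then constant and proportional, so the densities are Gaussian with
proportional covariances. Conversely, multiplying the covariance of a Gaussian vector by `c`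
multiplies `1/√J` by `c`, so equality reduces to `1 + c = 1 + c`.

The analytic input is that `J(f) < ∞` and log-concavity bound the Fisher information
(`lintegral_sq_fderiv_div_le`). This makes `Df` and `D²f` integrable, and since log-concave
densities are bounded, the convolution is `C²` and all these identities are legitimate. -/

open scoped ENNReal Pointwise

/-! ### The Prékopa–Leindler inequality -/

theorem volume_add_le_of_isCompact {A B S : Set ℝ} (hA : IsCompact A) (hB : IsCompact B)
    (hA0 : A.Nonempty) (hB0 : B.Nonempty) (h : ∀ a ∈ A, ∀ b ∈ B, a + b ∈ S) :
    volume A + volume B ≤ volume S := by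
  obtain ⟨a, haA, ha⟩ := hA.exists_isMaxOn hA0 continuousOn_id
  obtain ⟨b, hbB, hb⟩ := hB.exists_isMinOn hB0 continuousOn_id
  -- With `a = max A` and `b = min B`, the translates `b + A` and `a + B` lie in `S` on opposite
  -- sides of `a + b`, so they overlap in at most that point.
  have h1 : volume ((fun x => b + x) '' A) = volume A := by
    rw [Set.image_add_left]; exact measure_preimage_add _ _ _
  have h2 : volume ((fun x => a + x) '' B) = volume B := by
    rw [Set.image_add_left]; exact measure_preimage_add _ _ _
  have hd : AEDisjoint volume ((fun x => b + x) '' A) ((fun x => a + x) '' B) := by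
    refine measure_mono_null (t := {a + b}) ?_ (by simp)
    rintro _ ⟨⟨x, hx, rfl⟩, ⟨y, hy, hxy⟩⟩
    have h3 : x ≤ a := ha hx
    have h4 : b ≤ y := hb hy
    simp only at hxy
    simp only [Set.mem_singleton_iff]
    linarith
  rw [← h1, ← h2, ← measure_union₀ _ hd]
  · refine measure_mono (Set.union_subset ?_ ?_)
    · rintro _ ⟨x, hx, rfl⟩
      simpa [add_comm] using h x hx b hbB
    · rintro _ ⟨x, hx, rfl⟩
      exact h a haA x hx
  · exact ((hB.image (by fun_prop)).measurableSet).nullMeasurableSet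

/-- The one-dimensional Brunn–Minkowski inequality. -/
theorem volume_add_le_of_measurableSet {A B S : Set ℝ} (hA : MeasurableSet A)
    (hB : MeasurableSet B) (hA0 : A.Nonempty) (hB0 : B.Nonempty)
    (h : ∀ a ∈ A, ∀ b ∈ B, a + b ∈ S) :
    volume A + volume B ≤ volume S := by
  obtain ⟨a, ha⟩ := hA0
  obtain ⟨b, hb⟩ := hB0
  -- Adjoining `a` and `b` keeps the sets compact and makes them nonempty, so the suprema of inner
  -- regularity may run over all compact subsets.
  have key : ∀ K ⊆ A, IsCompact K → ∀ L ⊆ B, IsCompact L → volume K + volume L ≤ volume S := by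
    intro K hKA hK L hLB hL
    calc volume K + volume L ≤ volume (insert a K) + volume (insert b L) :=
          add_le_add (measure_mono (Set.subset_insert _ _)) (measure_mono (Set.subset_insert _ _))
      _ ≤ volume S := by
          refine volume_add_le_of_isCompact (hK.insert a) (hL.insert b) (Set.insert_nonempty _ _)
            (Set.insert_nonempty _ _) ?_
          intro x hx y hy
          exact h x (Set.insert_subset ha hKA hx) y (Set.insert_subset hb hLB hy)
  rw [hA.measure_eq_iSup_isCompact, hB.measure_eq_iSup_isCompact]
  have : Nonempty {K : Set ℝ // K ⊆ A ∧ IsCompact K} := ⟨⟨∅, by simp, isCompact_empty⟩⟩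
  have : Nonempty {K : Set ℝ // K ⊆ B ∧ IsCompact K} := ⟨⟨∅, by simp, isCompact_empty⟩⟩
  have eA : (⨆ (K : Set ℝ) (_ : K ⊆ A) (_ : IsCompact K), volume K)
      = ⨆ K : {K : Set ℝ // K ⊆ A ∧ IsCompact K}, volume K.1 := by
    rw [iSup_subtype]; simp only [iSup_and]
  have eB : (⨆ (K : Set ℝ) (_ : K ⊆ B) (_ : IsCompact K), volume K)
      = ⨆ K : {K : Set ℝ // K ⊆ B ∧ IsCompact K}, volume K.1 := by
    rw [iSup_subtype]; simp only [iSup_and]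
  rw [eA, eB]
  exact ENNReal.iSup_add_iSup_le fun K L => key _ K.2.1 K.2.2 _ L.2.1 L.2.2

theorem volume_smul_add_smul_le {A B S : Set ℝ} {s t : ℝ} (hs : 0 < s) (ht : 0 < t)
    (hA : MeasurableSet A) (hB : MeasurableSet B) (hA0 : A.Nonempty) (hB0 : B.Nonempty)
    (h : ∀ a ∈ A, ∀ b ∈ B, s * a + t * b ∈ S) :
    ENNReal.ofReal s * volume A + ENNReal.ofReal t * volume B ≤ volume S := by
  have e : ∀ (r : ℝ) (C : Set ℝ), 0 < r → volume (r • C) = ENNReal.ofReal r * volume C := by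
    intro r C hr
    rw [Measure.addHaar_smul]
    simp [abs_of_pos hr]
  rw [← e s A hs, ← e t B ht]
  refine volume_add_le_of_measurableSet (hA.const_smul_of_ne_zero hs.ne')
    (hB.const_smul_of_ne_zero ht.ne') hA0.smul_set hB0.smul_set ?_
  rintro _ ⟨a, ha, rfl⟩ _ ⟨b, hb, rfl⟩
  exact h a ha b hb

theorem ENNReal.geom_mean_le_arith_mean {s t : ℝ} (hs : 0 < s) (ht : 0 < t) (hst : s + t = 1)
    (x y : ℝ≥0∞) : x ^ s * y ^ t ≤ ENNReal.ofReal s * x + ENNReal.ofReal t * y := by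
  have hpq : (s⁻¹).HolderConjugate t⁻¹ := by
    constructor <;> simp [hs, ht, hst]
  have := ENNReal.young_inequality (x ^ s) (y ^ t) hpq
  rw [← ENNReal.rpow_mul, ← ENNReal.rpow_mul, mul_inv_cancel₀ hs.ne', mul_inv_cancel₀ ht.ne',
    ENNReal.rpow_one, ENNReal.rpow_one, ENNReal.ofReal_inv_of_pos hs,
    ENNReal.ofReal_inv_of_pos ht, ENNReal.div_eq_inv_mul, ENNReal.div_eq_inv_mul, inv_inv,
    inv_inv] at this
  exact this

theorem lintegral_eq_lintegral_meas_lt_of_le_one {f : ℝ → ℝ≥0∞} (hf : Measurable f)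
    (h1 : ∀ x, f x ≤ 1) :
    ∫⁻ x, f x = ∫⁻ c in Set.Ioo (0 : ℝ) 1, volume {x | ENNReal.ofReal c < f x} := by
  have hfin : ∀ x, f x ≠ ∞ := fun x => ne_top_of_le_ne_top ENNReal.one_ne_top (h1 x)
  have e1 : ∫⁻ x, f x = ∫⁻ x, ENNReal.ofReal (f x).toReal :=
    lintegral_congr fun x => (ENNReal.ofReal_toReal (hfin x)).symm
  rw [e1, lintegral_eq_lintegral_meas_lt _ (Filter.Eventually.of_forall fun x => by positivity)
    hf.ennreal_toReal.aemeasurable]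
  have e2 : ∀ c ∈ Set.Ioi (0 : ℝ), volume {x | c < (f x).toReal}
      = (Set.Ioo (0 : ℝ) 1).indicator (fun c => volume {x | ENNReal.ofReal c < f x}) c := by
    intro c hc
    have hc : 0 < c := hc
    by_cases hc1 : c < 1
    · have hcm : c ∈ Set.Ioo (0 : ℝ) 1 := ⟨hc, hc1⟩
      rw [Set.indicator_of_mem hcm]
      congr 1; ext x
      exact (ENNReal.ofReal_lt_iff_lt_toReal hc.le (hfin x)).symm
    · rw [Set.indicator_of_notMem (fun h => hc1 h.2)]
      suffices {x | c < (f x).toReal} = ∅ by rw [this, measure_empty]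
      ext x
      have : (f x).toReal ≤ 1 := by
        simpa using ENNReal.toReal_mono ENNReal.one_ne_top (h1 x)
      simp only [Set.mem_ofPred_eq, Set.mem_empty_iff_false, iff_false]
      linarith
  rw [setLIntegral_congr_fun measurableSet_Ioi e2, lintegral_indicator measurableSet_Ioo,
    Measure.restrict_restrict measurableSet_Ioo]
  congr 2
  exact Set.inter_eq_left.2 fun x hx => hx.1

/-- The Prékopa–Leindler inequality with weights `s`, `t` holds on `E`. -/
def PrekopaLeindler (E : Type*) [MeasureSpace E] [AddCommGroup E] [Module ℝ E] (s t : ℝ) : Prop :=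
  ∀ f g h : E → ℝ≥0∞, Measurable f → Measurable g → Measurable h →
    (∀ x y, f x ^ s * g y ^ t ≤ h (s • x + t • y)) →
      (∫⁻ x, f x) ^ s * (∫⁻ x, g x) ^ t ≤ ∫⁻ x, h x

/-- When both suprema are `1`, the superlevel sets of `f` and `g` are nonempty at every level below
`1`, so one-dimensional Brunn–Minkowski applies level by level. The normalisation yields the
arithmetic mean, which is stronger than the geometric one. -/
theorem lintegral_add_le_of_iSup_eq_one {s t : ℝ} (hs : 0 < s) (ht : 0 < t) (hst : s + t = 1)
    {f g h : ℝ → ℝ≥0∞} (hf : Measurable f) (hg : Measurable g) (hh : Measurable h)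
    (hf1 : ⨆ x, f x = 1) (hg1 : ⨆ x, g x = 1)
    (H : ∀ x y, f x ^ s * g y ^ t ≤ h (s • x + t • y)) :
    ENNReal.ofReal s * (∫⁻ x, f x) + ENNReal.ofReal t * ∫⁻ x, g x ≤ ∫⁻ x, h x := by
  -- Only levels below `1` are compared, so `h` is cut off there.
  have hle : ∫⁻ x, min (h x) 1 ≤ ∫⁻ x, h x := lintegral_mono fun x => min_le_left _ _
  refine le_trans ?_ hle
  rw [lintegral_eq_lintegral_meas_lt_of_le_one hf fun x => hf1 ▸ le_iSup f x,
    lintegral_eq_lintegral_meas_lt_of_le_one hg fun x => hg1 ▸ le_iSup g x,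
    lintegral_eq_lintegral_meas_lt_of_le_one (hh.min measurable_const) fun x => min_le_right _ _]
  have anti : ∀ k : ℝ → ℝ≥0∞, Measurable fun c : ℝ => volume {x | ENNReal.ofReal c < k x} := by
    intro k
    refine Antitone.measurable fun c d hcd => measure_mono fun x hx => ?_
    exact lt_of_le_of_lt (ENNReal.ofReal_le_ofReal hcd) hx
  rw [← lintegral_const_mul _ (anti f), ← lintegral_const_mul _ (anti g),
    ← lintegral_add_left ((anti f).const_mul _)]
  refine setLIntegral_mono (anti _) fun c hc => ?_
  have hc1 : ENNReal.ofReal c < 1 := by simpa using hc.2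
  have ne : ∀ k : ℝ → ℝ≥0∞, ⨆ x, k x = 1 → {x | ENNReal.ofReal c < k x}.Nonempty := by
    intro k hk
    rw [← hk] at hc1
    exact lt_iSup_iff.1 hc1
  refine volume_smul_add_smul_le hs ht (measurableSet_lt measurable_const hf)
    (measurableSet_lt measurable_const hg) (ne f hf1) (ne g hg1) ?_
  intro x hx y hy
  refine lt_min (lt_of_lt_of_le ?_ (H x y)) hc1
  have h0 : ENNReal.ofReal c ^ s * ENNReal.ofReal c ^ t = ENNReal.ofReal c := by
    rw [← ENNReal.rpow_add_of_nonneg _ _ hs.le ht.le, hst, ENNReal.rpow_one]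
  calc ENNReal.ofReal c = ENNReal.ofReal c ^ s * ENNReal.ofReal c ^ t := h0.symm
    _ < f x ^ s * g y ^ t :=
      ENNReal.mul_lt_mul (ENNReal.rpow_lt_rpow hx hs) (ENNReal.rpow_lt_rpow hy ht)

/-- Dividing by the suprema `a`, `b` reduces to the normalised case; after the inequality of the
means both sides carry the factor `a⁻ˢ b⁻ᵗ`, which cancels. -/
theorem prekopaLeindler_real_of_bounded {s t : ℝ} (hs : 0 < s) (ht : 0 < t) (hst : s + t = 1)
    {f g h : ℝ → ℝ≥0∞} (hf : Measurable f) (hg : Measurable g) (hh : Measurable h)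
    {N : ℝ≥0∞} (hN : N ≠ ∞) (hfN : ∀ x, f x ≤ N) (hgN : ∀ x, g x ≤ N)
    (H : ∀ x y, f x ^ s * g y ^ t ≤ h (s • x + t • y)) :
    (∫⁻ x, f x) ^ s * (∫⁻ x, g x) ^ t ≤ ∫⁻ x, h x := by
  set a := ⨆ x, f x with ha
  set b := ⨆ x, g x with hb
  have haT : a ≠ ∞ := ne_top_of_le_ne_top hN (iSup_le hfN)
  have hbT : b ≠ ∞ := ne_top_of_le_ne_top hN (iSup_le hgN)
  by_cases ha0 : a = 0
  · have : ∀ x, f x = 0 := by simpa [ha] using ha0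
    simp [this, ENNReal.zero_rpow_of_pos hs]
  by_cases hb0 : b = 0
  · have : ∀ x, g x = 0 := by simpa [hb] using hb0
    simp [this, ENNReal.zero_rpow_of_pos ht]
  have key := lintegral_add_le_of_iSup_eq_one hs ht hst (f := fun x => a⁻¹ * f x)
    (g := fun x => b⁻¹ * g x) (h := fun x => (a⁻¹ ^ s * b⁻¹ ^ t) * h x)
    (hf.const_mul _) (hg.const_mul _) (hh.const_mul _)
    (by rw [← ENNReal.mul_iSup, ENNReal.inv_mul_cancel ha0 haT])
    (by rw [← ENNReal.mul_iSup, ENNReal.inv_mul_cancel hb0 hbT])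
    (by
      intro x y
      rw [ENNReal.mul_rpow_of_nonneg _ _ hs.le, ENNReal.mul_rpow_of_nonneg _ _ ht.le,
        mul_mul_mul_comm]
      gcongr
      exact H x y)
  have key2 := (ENNReal.geom_mean_le_arith_mean hs ht hst _ _).trans key
  rw [lintegral_const_mul _ hf, lintegral_const_mul _ hg, lintegral_const_mul _ hh,
    ENNReal.mul_rpow_of_nonneg _ _ hs.le, ENNReal.mul_rpow_of_nonneg _ _ ht.le,
    mul_mul_mul_comm] at key2
  refine (ENNReal.mul_le_mul_iff_right ?_ ?_).1 key2
  · refine mul_ne_zero ?_ ?_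
    · simp [ENNReal.rpow_eq_zero_iff, haT, hs.not_gt, ha0]
    · simp [ENNReal.rpow_eq_zero_iff, hbT, ht.not_gt, hb0]
  · refine ENNReal.mul_ne_top ?_ ?_
    · exact ENNReal.rpow_ne_top_of_nonneg hs.le (ENNReal.inv_ne_top.2 ha0)
    · exact ENNReal.rpow_ne_top_of_nonneg ht.le (ENNReal.inv_ne_top.2 hb0)

theorem prekopaLeindler_real {s t : ℝ} (hs : 0 < s) (ht : 0 < t) (hst : s + t = 1) :
    PrekopaLeindler ℝ s t := by
  intro f g h hf hg hh H
  -- Vanishing integrals are set aside because multiplication on `[0, ∞]` is discontinuous at `0 ·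
  -- ∞`, and the truncations below pass to the limit in a product.
  by_cases hf0 : ∫⁻ x, f x = 0
  · simp [hf0, ENNReal.zero_rpow_of_pos hs]
  by_cases hg0 : ∫⁻ x, g x = 0
  · simp [hg0, ENNReal.zero_rpow_of_pos ht]
  have trunc : ∀ k : ℝ → ℝ≥0∞, Measurable k →
      Filter.Tendsto (fun N : ℕ => ∫⁻ x, min (k x) N) Filter.atTop (nhds (∫⁻ x, k x)) := by
    intro k hk
    refine lintegral_tendsto_of_tendsto_of_monotone
      (fun N => (hk.min measurable_const).aemeasurable) ?_ ?_
    · refine Filter.Eventually.of_forall fun x N M hNM => ?_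
      have : (N : ℝ≥0∞) ≤ M := by exact_mod_cast hNM
      exact min_le_min le_rfl this
    · refine Filter.Eventually.of_forall fun x => ?_
      have := (tendsto_const_nhds (x := k x)).min ENNReal.tendsto_nat_nhds_top
      simpa using this
  have l1 := (ENNReal.continuous_rpow_const (y := s)).continuousAt.tendsto.comp (trunc f hf)
  have l2 := (ENNReal.continuous_rpow_const (y := t)).continuousAt.tendsto.comp (trunc g hg)
  have l3 := ENNReal.Tendsto.mul l1 (Or.inl (by simp [ENNReal.rpow_eq_zero_iff, hf0, hs.not_gt]))
    l2 (Or.inl (by simp [ENNReal.rpow_eq_zero_iff, hg0, ht.not_gt]))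
  refine le_of_tendsto l3 (Filter.Eventually.of_forall fun N => ?_)
  refine prekopaLeindler_real_of_bounded hs ht hst (hf.min measurable_const)
    (hg.min measurable_const) hh (ENNReal.natCast_ne_top N) (fun x => min_le_right _ _)
    (fun x => min_le_right _ _) fun x y => le_trans ?_ (H x y)
  gcongr <;> exact min_le_left _ _

/-- The inequality on `F`, applied to slices, says that the partial integrals satisfy the hypothesis
of the inequality on `E`. -/
theorem PrekopaLeindler.prod {E F : Type*} [MeasureSpace E] [AddCommGroup E] [Module ℝ E]
    [MeasureSpace F] [AddCommGroup F] [Module ℝ F] [SFinite (volume : Measure F)] {s t : ℝ}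
    (hE : PrekopaLeindler E s t) (hF : PrekopaLeindler F s t) : PrekopaLeindler (E × F) s t := by
  intro f g h hf hg hh H
  have e : (volume : Measure (E × F)) = (volume : Measure E).prod volume := rfl
  rw [e, lintegral_prod _ hf.aemeasurable, lintegral_prod _ hg.aemeasurable,
    lintegral_prod _ hh.aemeasurable]
  refine hE _ _ _ hf.lintegral_prod_right' hg.lintegral_prod_right' hh.lintegral_prod_right' ?_
  intro x y
  exact hF (fun z => f (x, z)) (fun z => g (y, z)) (fun z => h (s • x + t • y, z))
    (by fun_prop) (by fun_prop) (by fun_prop) fun z w => H (x, z) (y, w)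

theorem PrekopaLeindler.of_measurePreserving {E F : Type*} [MeasureSpace E] [AddCommGroup E]
    [Module ℝ E] [MeasureSpace F] [AddCommGroup F] [Module ℝ F] {s t : ℝ}
    (hE : PrekopaLeindler E s t) (e : E → F) (he : MeasurePreserving e)
    (hlin : ∀ x y, e (s • x + t • y) = s • e x + t • e y) :
    PrekopaLeindler F s t := by
  intro f g h hf hg hh H
  rw [← he.lintegral_comp hf, ← he.lintegral_comp hg, ← he.lintegral_comp hh]
  refine hE _ _ _ (hf.comp he.measurable) (hg.comp he.measurable) (hh.comp he.measurable) ?_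
  intro x y
  simpa [hlin] using H (e x) (e y)

theorem prekopaLeindler_pi {s t : ℝ} (hs : 0 < s) (ht : 0 < t) (hst : s + t = 1) (n : ℕ) :
    PrekopaLeindler (Fin n → ℝ) s t := by
  induction n with
  | zero =>
    intro f g h hf hg hh H
    have e : (volume : Measure (Fin 0 → ℝ)) = Measure.dirac 0 := by
      rw [volume_pi, Measure.pi_of_empty]
      congr; subsingleton
    rw [e, lintegral_dirac, lintegral_dirac, lintegral_dirac]
    simpa using H 0 0
  | succ n ih =>
    have hp : PrekopaLeindler (ℝ × (Fin n → ℝ)) s t := (prekopaLeindler_real hs ht hst).prod ih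
    refine hp.of_measurePreserving _
      (volume_preserving_piFinSuccAbove (fun _ : Fin (n + 1) => ℝ) 0).symm ?_
    intro x y
    ext i
    refine Fin.cases ?_ (fun j => ?_) i <;>
      simp [MeasurableEquiv.piFinSuccAbove, Fin.insertNthEquiv]

/-- The Prékopa–Leindler inequality on Euclidean space. -/
theorem prekopaLeindler_euclideanSpace {s t : ℝ} (hs : 0 < s) (ht : 0 < t) (hst : s + t = 1)
    (n : ℕ) : PrekopaLeindler (EuclideanSpace ℝ (Fin n)) s t :=
  (prekopaLeindler_pi hs ht hst n).of_measurePreserving _ (PiLp.volume_preserving_toLp (Fin n))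
    fun _ _ => rfl

/-! ### The logarithmic Hessian and log-concave functions -/

/-- The second derivative of `log f` in the directions `h`, `h'`, in terms of `f`; it is zero where
`f` vanishes. -/
noncomputable def hessLog {n : ℕ} (f : EuclideanSpace ℝ (Fin n) → ℝ)
    (x h h' : EuclideanSpace ℝ (Fin n)) : ℝ :=
  fderiv ℝ (fderiv ℝ f) x h h' / f x - fderiv ℝ f x h * fderiv ℝ f x h' / f x ^ 2

section

variable {n : ℕ} {f : EuclideanSpace ℝ (Fin n) → ℝ}

/-- With positive weights the multiplicative form survives at zeros of `f`; it is the form in which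
Prékopa–Leindler consumes and returns log-concavity. -/
theorem IsLogConcave.rpow_mul_rpow_le (hf : IsLogConcave f) {s t : ℝ} (hs : 0 < s) (ht : 0 < t)
    (hst : s + t = 1) (x y : EuclideanSpace ℝ (Fin n)) :
    f x ^ s * f y ^ t ≤ f (s • x + t • y) := by
  rcases (hf.nonneg x).eq_or_lt with hx | hx
  · rw [← hx, Real.zero_rpow hs.ne', zero_mul]; exact hf.nonneg _
  rcases (hf.nonneg y).eq_or_lt with hy | hy
  · rw [← hy, Real.zero_rpow ht.ne', mul_zero]; exact hf.nonneg _
  have h1 := hf.concaveOn_log.2 hx hy hs.le ht.le hst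
  have h2 : 0 < f (s • x + t • y) := hf.concaveOn_log.1 hx hy hs.le ht.le hst
  rw [← Real.log_le_log_iff (by positivity) h2, Real.log_mul (by positivity) (by positivity),
    Real.log_rpow hx, Real.log_rpow hy]
  simpa using h1

theorem isLogConcave_of_rpow_mul_rpow_le (h0 : ∀ x, 0 ≤ f x)
    (h : ∀ s t : ℝ, 0 < s → 0 < t → s + t = 1 → ∀ x y, f x ^ s * f y ^ t ≤ f (s • x + t • y)) :
    IsLogConcave f := by
  have hpos : ∀ x y, 0 < f x → 0 < f y → ∀ s t : ℝ, 0 < s → 0 < t → s + t = 1 →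
      0 < f (s • x + t • y) := fun x y hx hy s t hs ht hst =>
    lt_of_lt_of_le (by positivity) (h s t hs ht hst x y)
  refine ⟨h0, convex_iff_forall_pos.2 fun x hx y hy s t hs ht hst => hpos x y hx hy s t hs ht hst, ?_⟩
  intro x hx y hy s t hs ht hst
  rcases hs.eq_or_lt with rfl | hs
  · obtain rfl : t = 1 := by linarith
    simp
  rcases ht.eq_or_lt with rfl | ht
  · obtain rfl : s = 1 := by linarith
    simp
  have hx : 0 < f x := hx
  have hy : 0 < f y := hy
  have h1 := h s t hs ht hst x y
  rw [← Real.log_le_log_iff (by positivity) (hpos x y hx hy s t hs ht hst),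
    Real.log_mul (by positivity) (by positivity), Real.log_rpow hx, Real.log_rpow hy] at h1
  simpa using h1

/-- A continuous integrable log-concave function is bounded. -/
theorem IsLogConcave.exists_forall_le (hf : IsLogConcave f) (hc : Continuous f)
    (hi : Integrable f) : ∃ C, 0 < C ∧ ∀ x, f x ≤ C := by
  by_cases hex : ∃ x0, 0 < f x0
  swap
  · push Not at hex
    exact ⟨1, one_pos, fun x => (hex x).trans zero_le_one⟩
  obtain ⟨x0, hx0⟩ := hex
  obtain ⟨r, hr, hball⟩ : ∃ r > 0, ∀ y ∈ Metric.ball x0 r, f x0 / 2 < f y := by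
    have : ∀ᶠ y in nhds x0, f x0 / 2 < f y :=
      hc.continuousAt.eventually_const_lt (half_lt_self hx0)
    obtain ⟨r, hr, h⟩ := Metric.eventually_nhds_iff_ball.1 this
    exact ⟨r, hr, h⟩
  set ε := f x0 / 2 with hε
  have hεpos : 0 < ε := by positivity
  set V := volume.real (Metric.ball (0 : EuclideanSpace ℝ (Fin n)) (r / 2)) with hV
  have hVpos : 0 < V := by
    rw [hV, measureReal_def]
    exact ENNReal.toReal_pos (Metric.measure_ball_pos _ _ (by positivity)).ne'
      measure_ball_lt_top.ne
  set I := ∫ x, f x with hI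
  refine ⟨(I / V) ^ 2 / ε + 1, by positivity, fun x => ?_⟩
  have hfx := hf.nonneg x
  -- Each such `w` is the midpoint of `x` and a point `y` of the ball where `f` exceeds `ε`.
  -- Integrating the bound over the half-size ball limits `f x` by the total mass.
  have key : ∀ w ∈ Metric.ball ((1 / 2 : ℝ) • x + (1 / 2 : ℝ) • x0) (r / 2),
      √(f x * ε) ≤ f w := by
    intro w hw
    set y := (2 : ℝ) • w - x with hy
    have hyb : y ∈ Metric.ball x0 r := by
      rw [Metric.mem_ball, dist_eq_norm] at hw ⊢
      have : y - x0 = (2 : ℝ) • (w - ((1 / 2 : ℝ) • x + (1 / 2 : ℝ) • x0)) := by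
        rw [hy]; module
      rw [this, norm_smul, Real.norm_ofNat]
      linarith
    have hw2 : w = (1 / 2 : ℝ) • x + (1 / 2 : ℝ) • y := by rw [hy]; module
    have h3 := hf.rpow_mul_rpow_le (s := 1 / 2) (t := 1 / 2) (by norm_num) (by norm_num)
      (by norm_num) x y
    rw [← hw2, ← Real.sqrt_eq_rpow, ← Real.sqrt_eq_rpow, ← Real.sqrt_mul hfx] at h3
    refine le_trans (Real.sqrt_le_sqrt ?_) h3
    exact mul_le_mul_of_nonneg_left (hball y hyb).le hfx
  have h4 : √(f x * ε) * V ≤ I := by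
    have e1 : volume.real (Metric.ball ((1 / 2 : ℝ) • x + (1 / 2 : ℝ) • x0) (r / 2)) = V := by
      rw [hV, measureReal_def, measureReal_def, Measure.addHaar_ball_center]
    calc √(f x * ε) * V
        = ∫ _ in Metric.ball ((1 / 2 : ℝ) • x + (1 / 2 : ℝ) • x0) (r / 2), √(f x * ε) := by
          rw [setIntegral_const, e1, smul_eq_mul, mul_comm]
      _ ≤ ∫ w in Metric.ball ((1 / 2 : ℝ) • x + (1 / 2 : ℝ) • x0) (r / 2), f w :=
          setIntegral_mono_on (integrableOn_const measure_ball_lt_top.ne) hi.integrableOn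
            measurableSet_ball key
      _ ≤ I := setIntegral_le_integral hi (Filter.Eventually.of_forall hf.nonneg)
  have h5 : √(f x * ε) ≤ I / V := by rwa [le_div_iff₀ hVpos]
  have h6 : f x * ε ≤ (I / V) ^ 2 := (Real.sqrt_le_left ((Real.sqrt_nonneg _).trans h5)).1 h5
  have h7 : f x ≤ (I / V) ^ 2 / ε := by rwa [le_div_iff₀ hεpos]
  linarith

theorem fderiv_eq_zero_of_nonneg_of_eq_zero (h0 : ∀ x, 0 ≤ f x) {x : EuclideanSpace ℝ (Fin n)}
    (hx : f x = 0) : fderiv ℝ f x = 0 :=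
  IsLocalMin.fderiv_eq_zero (Filter.Eventually.of_forall fun y => by rw [hx]; exact h0 y)

theorem hessLog_of_eq_zero {x : EuclideanSpace ℝ (Fin n)} (hx : f x = 0)
    (h h' : EuclideanSpace ℝ (Fin n)) : hessLog f x h h' = 0 := by
  simp [hessLog, hx]

theorem hessLog_mul_self {x : EuclideanSpace ℝ (Fin n)} (hx : f x ≠ 0)
    (h h' : EuclideanSpace ℝ (Fin n)) :
    hessLog f x h h' * f x
      = fderiv ℝ (fderiv ℝ f) x h h' - fderiv ℝ f x h * fderiv ℝ f x h' / f x := by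
  unfold hessLog; field_simp

theorem hasFDerivAt_fderiv_log (hf : ContDiff ℝ 2 f) {x : EuclideanSpace ℝ (Fin n)}
    (hx : f x ≠ 0) (h' : EuclideanSpace ℝ (Fin n)) :
    HasFDerivAt (fun y => fderiv ℝ f y h' / f y)
      ((f x)⁻¹ • ((fderiv ℝ (fderiv ℝ f) x).flip h')
        - (fderiv ℝ f x h' / f x ^ 2) • fderiv ℝ f x) x := by
  have h1 : HasFDerivAt (fderiv ℝ f) (fderiv ℝ (fderiv ℝ f) x) x :=
    ((hf.fderiv_right (m := 1) (by norm_num)).differentiable (by norm_num) x).hasFDerivAt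
  have h2 : HasFDerivAt (fun y => fderiv ℝ f y h') ((fderiv ℝ (fderiv ℝ f) x).flip h') x := by
    exact (ContinuousLinearMap.apply ℝ ℝ h').hasFDerivAt.comp x h1
  have h3 : HasFDerivAt f (fderiv ℝ f x) x := (hf.differentiable (by norm_num) x).hasFDerivAt
  have h4 := h2.mul ((hasDerivAt_inv hx).comp_hasFDerivAt x h3)
  refine h4.congr_fderiv ?_
  ext v
  simp
  field_simp
  ring

theorem fderiv_fderiv_log_apply {x : EuclideanSpace ℝ (Fin n)}
    (hx : f x ≠ 0) (h h' : EuclideanSpace ℝ (Fin n)) :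
    ((f x)⁻¹ • ((fderiv ℝ (fderiv ℝ f) x).flip h')
        - (fderiv ℝ f x h' / f x ^ 2) • fderiv ℝ f x) h = hessLog f x h h' := by
  simp [hessLog]
  field_simp

/-- By concavity the derivative of `log f` along the line `x + t h` is antitone, and `hessLog` is
the slope of that derivative at `t = 0`. -/
theorem IsLogConcave.hessLog_nonpos (hf : IsLogConcave f) (hs : ContDiff ℝ 2 f)
    (x h : EuclideanSpace ℝ (Fin n)) : hessLog f x h h ≤ 0 := by
  by_cases hx : f x = 0
  · rw [hessLog_of_eq_zero hx]
  have hx : 0 < f x := (hf.nonneg x).lt_of_ne' hx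
  set l : ℝ → EuclideanSpace ℝ (Fin n) := fun t => x + t • h with hl
  have hlc : Continuous l := by fun_prop
  set S : Set ℝ := {t | 0 < f (l t)} with hS
  have hSo : IsOpen S := isOpen_lt continuous_const (hs.continuous.comp hlc)
  have h0 : (0 : ℝ) ∈ S := by simpa [hS, hl] using hx
  have hld : ∀ t, HasDerivAt l h t := by
    intro t
    have := ((hasDerivAt_id t).smul_const h).const_add x
    rw [one_smul] at this
    exact this
  have hφ : ConcaveOn ℝ S (fun t => Real.log (f (l t))) := by
    refine ⟨fun t ht u hu a b ha hb hab => ?_, fun t ht u hu a b ha hb hab => ?_⟩ <;>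
    have e : l (a • t + b • u) = a • l t + b • l u := by
      obtain rfl : a = 1 - b := by linarith
      simp only [hl, smul_eq_mul]; module
    · change 0 < f (l (a • t + b • u))
      rw [e]; exact hf.concaveOn_log.1 ht hu ha hb hab
    · change _ ≤ Real.log (f (l (a • t + b • u)))
      rw [e]; exact hf.concaveOn_log.2 ht hu ha hb hab
  have hd : ∀ t ∈ S, HasDerivAt (fun t => Real.log (f (l t))) (fderiv ℝ f (l t) h / f (l t)) t := by
    intro t ht
    have := (hs.differentiable (by norm_num) (l t)).hasFDerivAt.comp_hasDerivAt t (hld t)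
    exact this.log (ne_of_gt ht)
  have hanti : AntitoneOn (fun t => fderiv ℝ f (l t) h / f (l t)) S := by
    have := hφ.antitoneOn_deriv fun t ht => (hd t ht).differentiableAt
    intro t ht u hu htu
    have h1 := this ht hu htu
    rwa [(hd t ht).deriv, (hd u hu).deriv] at h1
  have hx' : f (l 0) ≠ 0 := ne_of_gt h0
  have hdd : HasDerivAt (fun t => fderiv ℝ f (l t) h / f (l t)) (hessLog f x h h) 0 := by
    have h1 := (hasFDerivAt_fderiv_log hs hx' h).comp_hasDerivAt (0 : ℝ) (hld 0)
    rw [fderiv_fderiv_log_apply hx'] at h1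
    simpa [hl] using! h1
  have hW := hdd.hasDerivWithinAt (s := S)
  rw [← hW.derivWithin (hSo.uniqueDiffWithinAt h0)]
  exact hanti.derivWithin_nonpos

/-- The second derivative of a log-concave function vanishes almost everywhere on `{f = 0}`. -/
theorem IsLogConcave.ae_fderiv_fderiv_eq_zero (hf : IsLogConcave f) :
    ∀ᵐ x, f x = 0 → fderiv ℝ (fderiv ℝ f) x = 0 := by
  -- A convex set has null frontier; off it, `f` vanishes in a neighbourhood of each of its zeros.
  have hnull : volume (frontier {x | 0 < f x}) = 0 := hf.concaveOn_log.1.addHaar_frontier volume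
  filter_upwards [compl_mem_ae_iff.2 hnull] with x hx hfx
  have h1 : x ∉ closure {x | 0 < f x} := by
    intro hcl
    refine hx ⟨hcl, fun hint => ?_⟩
    have : x ∈ {x | 0 < f x} := interior_subset hint
    exact (show 0 < f x from this).ne' hfx
  have h2 : f =ᶠ[nhds x] fun _ => 0 := by
    filter_upwards [isClosed_closure.isOpen_compl.mem_nhds h1] with y hy
    by_contra hne
    exact hy (subset_closure ((hf.nonneg y).lt_of_ne' hne))
  have h3 : fderiv ℝ f =ᶠ[nhds x] fun _ => 0 := by
    have := h2.fderiv (𝕜 := ℝ)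
    simpa using! this
  rw [h3.fderiv_eq]
  simp

/-- Where `f` vanishes the right side is zero by the convention `x / 0 = 0`, so the identity can be
integrated over the whole space. -/
theorem IsLogConcave.ae_fderiv_fderiv_eq (hf : IsLogConcave f) :
    ∀ᵐ x, ∀ h h', fderiv ℝ (fderiv ℝ f) x h h'
      = hessLog f x h h' * f x + fderiv ℝ f x h * fderiv ℝ f x h' / f x := by
  filter_upwards [hf.ae_fderiv_fderiv_eq_zero] with x hx h h'
  by_cases h0 : f x = 0
  · simp [hx h0, h0]
  · rw [hessLog_mul_self h0]; ring

end

/-! ### Integration by parts and finite Fisher information -/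

/-- A log-concave probability density of class `C²` with finite `fisherProduction`. -/
structure IsRegularDensity {n : ℕ} (f : EuclideanSpace ℝ (Fin n) → ℝ) : Prop where
  contDiff : ContDiff ℝ 2 f
  logConcave : IsLogConcave f
  integrable : Integrable f
  integral_eq_one : ∫ x, f x = 1
  fisherProduction_lt_top : fisherProduction f < ⊤

theorem exists_contDiff_cutoff (E : Type*) [NormedAddCommGroup E] [NormedSpace ℝ E]
    [FiniteDimensional ℝ E] : ∃ χ : E → ℝ, ContDiff ℝ 2 χ ∧ HasCompactSupport χ ∧ χ 0 = 1 ∧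
    (∀ x, 0 ≤ χ x) ∧ ∀ x, χ x ≤ 1 := by
  let χ : ContDiffBump (0 : E) := ⟨1, 2, one_pos, one_lt_two⟩
  exact ⟨χ, χ.contDiff, χ.hasCompactSupport, χ.one_of_mem_closedBall (by simp [χ.rIn_pos.le]),
    fun x => χ.nonneg, fun x => χ.le_one⟩

section

variable {E : Type*} [NormedAddCommGroup E] [NormedSpace ℝ E]

theorem ContDiff.continuous_fderiv_two {f : E → ℝ} (hf : ContDiff ℝ 2 f) :
    Continuous (fderiv ℝ f) :=
  hf.continuous_fderiv (by norm_num)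

theorem ContDiff.contDiff_fderiv_two {f : E → ℝ} (hf : ContDiff ℝ 2 f) :
    ContDiff ℝ 1 (fderiv ℝ f) :=
  hf.fderiv_right (by norm_num)

theorem ContDiff.continuous_fderiv_fderiv {f : E → ℝ} (hf : ContDiff ℝ 2 f) :
    Continuous (fderiv ℝ (fderiv ℝ f)) :=
  hf.contDiff_fderiv_two.continuous_fderiv (by norm_num)

set_option maxSynthPendingDepth 4 in
theorem ContDiff.exists_norm_fderiv_fderiv_le {f : E → ℝ} (hf : ContDiff ℝ 2 f)
    (hcs : HasCompactSupport f) : ∃ C, ∀ x, ‖fderiv ℝ (fderiv ℝ f) x‖ ≤ C := by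
  have h1 : HasCompactSupport (fderiv ℝ f) := hcs.fderiv (𝕜 := ℝ)
  have h2 : HasCompactSupport (fderiv ℝ (fderiv ℝ f)) := h1.fderiv (𝕜 := ℝ)
  exact h2.exists_bound_of_continuous hf.continuous_fderiv_fderiv

theorem ContDiff.hasLineDerivAt {f : E → ℝ} (hf : ContDiff ℝ 2 f) (x h : E) :
    HasLineDerivAt ℝ f (fderiv ℝ f x h) x h :=
  (hf.differentiable (by norm_num) x).hasFDerivAt.hasLineDerivAt h

theorem ContDiff.hasLineDerivAt_fderiv {f : E → ℝ} (hf : ContDiff ℝ 2 f) (x h h' : E) :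
    HasLineDerivAt ℝ (fun x => fderiv ℝ f x h') (fderiv ℝ (fderiv ℝ f) x h h') x h := by
  have h1 := (hf.contDiff_fderiv_two.differentiable (by norm_num) x).hasFDerivAt
  exact ((ContinuousLinearMap.apply ℝ ℝ h').hasFDerivAt.comp x h1).hasLineDerivAt h

theorem HasLineDerivAt.comp_const_smul {f : E → ℝ} {a : ℝ} {x h : E} (c : ℝ)
    (hf : HasLineDerivAt ℝ f a (c • x) h) :
    HasLineDerivAt ℝ (fun x => f (c • x)) (c * a) x h := by
  unfold HasLineDerivAt at hf ⊢
  have h1 : HasDerivAt (fun t : ℝ => c * t) c 0 := by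
    simpa using (hasDerivAt_id (0 : ℝ)).const_mul c
  have h2 : HasDerivAt (fun t : ℝ => f (c • x + t • h)) a (c * 0) := by rwa [mul_zero]
  have h3 := h2.comp (0 : ℝ) h1
  rw [mul_comm a c] at h3
  refine h3.congr_of_eventuallyEq (Filter.Eventually.of_forall fun t => ?_)
  simp only [Function.comp_apply, smul_add, smul_smul]

variable [FiniteDimensional ℝ E] [MeasurableSpace E] [BorelSpace E] {μ : Measure E}
  [μ.IsAddHaarMeasure]

/-- Integrating by parts twice against a rescaled cutoff function. -/
theorem integral_bump_mul_fderiv_fderiv_le {f χ : E → ℝ} (hf : ContDiff ℝ 2 f)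
    (h0 : ∀ x, 0 ≤ f x) (hfi : Integrable f μ) (hχ : ContDiff ℝ 2 χ) (hcs : HasCompactSupport χ)
    {C : ℝ} (hC : ∀ x, ‖fderiv ℝ (fderiv ℝ χ) x‖ ≤ C) (h : E) {c : ℝ} (hc : 0 < c) :
    Integrable (fun x => χ (c • x) * fderiv ℝ (fderiv ℝ f) x h h) μ ∧
      ∫ x, χ (c • x) * fderiv ℝ (fderiv ℝ f) x h h ∂μ
        ≤ c ^ 2 * (C * ‖h‖ * ‖h‖) * ∫ x, f x ∂μ := by
  have hf1 := hf.continuous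
  have hf2 : Continuous fun x => fderiv ℝ f x h := by
    have := hf.continuous_fderiv_two
    fun_prop
  have hf3 : Continuous fun x => fderiv ℝ (fderiv ℝ f) x h h := by
    have := hf.continuous_fderiv_fderiv
    fun_prop
  have hsm : Continuous fun x : E => c • x := by fun_prop
  -- `u1` and `u2` are the successive derivatives of `u0` along `h`; each differentiation brings out
  -- a factor `c`, whence the `c ^ 2` in the bound.
  set u0 : E → ℝ := fun x => χ (c • x) with hu0
  set u1 : E → ℝ := fun x => c * fderiv ℝ χ (c • x) h with hu1
  set u2 : E → ℝ := fun x => c ^ 2 * fderiv ℝ (fderiv ℝ χ) (c • x) h h with hu2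
  have c0 : Continuous u0 := hχ.continuous.comp hsm
  have c1 : Continuous u1 := by
    have := hχ.continuous_fderiv_two
    fun_prop
  have c2 : Continuous u2 := by
    have := hχ.continuous_fderiv_fderiv
    fun_prop
  have d0 : ∀ x, HasLineDerivAt ℝ u0 (u1 x) x h := fun x =>
    (hχ.hasLineDerivAt (c • x) h).comp_const_smul c
  have d1 : ∀ x, HasLineDerivAt ℝ u1 (u2 x) x h := by
    intro x
    have h1 : HasDerivAt (fun t : ℝ => c * fderiv ℝ χ (c • (x + t • h)) h)
        (c * (c * fderiv ℝ (fderiv ℝ χ) (c • x) h h)) 0 :=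
      HasDerivAt.const_mul c ((hχ.hasLineDerivAt_fderiv (c • x) h h).comp_const_smul c)
    rw [← mul_assoc, ← sq] at h1
    exact h1
  have hcs1 : HasCompactSupport fun x => fderiv ℝ χ x h :=
    (hcs.fderiv (𝕜 := ℝ)).comp_left (g := fun L : E →L[ℝ] ℝ => L h) (by simp)
  have hcs2 : HasCompactSupport fun x => fderiv ℝ (fderiv ℝ χ) x h h :=
    ((hcs.fderiv (𝕜 := ℝ)).fderiv (𝕜 := ℝ)).comp_left
      (g := fun L : E →L[ℝ] E →L[ℝ] ℝ => L h h) (by simp)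
  have cs0 : HasCompactSupport u0 := hcs.comp_homeomorph (Homeomorph.smulOfNeZero c hc.ne')
  have cs1 : HasCompactSupport u1 :=
    (hcs1.comp_homeomorph (Homeomorph.smulOfNeZero c hc.ne')).mul_left (f := fun _ => c)
  have cs2 : HasCompactSupport u2 :=
    (hcs2.comp_homeomorph (Homeomorph.smulOfNeZero c hc.ne')).mul_left (f := fun _ => c ^ 2)
  have int_of : ∀ u v : E → ℝ, Continuous u → Continuous v → HasCompactSupport u →
      Integrable (fun x => u x * v x) μ := fun u v hu hv hc =>
    (hu.mul hv).integrable_of_hasCompactSupport hc.mul_right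
  have i0 := int_of u0 _ c0 hf3 cs0
  have i1 := int_of u1 _ c1 hf2 cs1
  have i2 := int_of u2 f c2 hf1 cs2
  have p1 := integral_bilinear_hasLineDerivAt_right_eq_neg_left_of_integrable
    (B := ContinuousLinearMap.mul ℝ ℝ) i1 i0 (int_of u0 _ c0 hf2 cs0)
    (fun x _ => d0 x) (fun x _ => hf.hasLineDerivAt_fderiv x h h)
  have p2 := integral_bilinear_hasLineDerivAt_right_eq_neg_left_of_integrable
    (B := ContinuousLinearMap.mul ℝ ℝ) i2 i1 (int_of u1 f c1 hf1 cs1)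
    (fun x _ => d1 x) (fun x _ => hf.hasLineDerivAt x h)
  simp only [ContinuousLinearMap.mul_apply'] at p1 p2
  refine ⟨i0, ?_⟩
  rw [p1, p2, neg_neg, ← integral_const_mul]
  refine integral_mono i2 (hfi.const_mul _) fun x => ?_
  refine mul_le_mul_of_nonneg_right ?_ (h0 x)
  refine mul_le_mul_of_nonneg_left ?_ (sq_nonneg c)
  refine (le_abs_self _).trans ?_
  have h1 : ‖fderiv ℝ (fderiv ℝ χ) (c • x) h h‖ ≤ ‖fderiv ℝ (fderiv ℝ χ) (c • x)‖ * ‖h‖ * ‖h‖ :=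
    ContinuousLinearMap.le_opNorm₂ _ h h
  rw [Real.norm_eq_abs] at h1
  refine h1.trans ?_
  have := hC (c • x)
  gcongr

/-- The Fisher information in the direction `h` is at most the integral of minus the second
derivative of `log f` against `f`. -/
theorem lintegral_sq_fderiv_div_le {f q : E → ℝ} (hf : ContDiff ℝ 2 f)
    (h0 : ∀ x, 0 ≤ f x) (hfi : Integrable f μ) (hq0 : ∀ x, 0 ≤ q x) (hqi : Integrable q μ) (h : E)
    (hq : ∀ᵐ x ∂μ, fderiv ℝ f x h ^ 2 / f x = fderiv ℝ (fderiv ℝ f) x h h + q x) :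
    ∫⁻ x, ENNReal.ofReal (fderiv ℝ f x h ^ 2 / f x) ∂μ ≤ ENNReal.ofReal (∫ x, q x ∂μ) := by
  obtain ⟨χ, hχ, hcs, hχ0, hχnn, hχle⟩ := exists_contDiff_cutoff E
  have hχ1 := hχ.continuous
  obtain ⟨C, hC⟩ := hχ.exists_norm_fderiv_fderiv_le hcs
  -- Against the cutoff, the Fisher integrand is `∂²f + q`; moving both derivatives onto the cutoff
  -- makes the first term `O(c²)`.
  have step : ∀ c : ℝ, 0 < c →
      ∫⁻ x, ENNReal.ofReal (χ (c • x) * (fderiv ℝ f x h ^ 2 / f x)) ∂μ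
        ≤ ENNReal.ofReal (c ^ 2 * (C * ‖h‖ * ‖h‖) * (∫ x, f x ∂μ) + ∫ x, q x ∂μ) := by
    intro c hc
    obtain ⟨i0, p3⟩ := integral_bump_mul_fderiv_fderiv_le hf h0 hfi hχ hcs hC h hc
    have i3 : Integrable (fun x => χ (c • x) * q x) μ := by
      refine hqi.bdd_mul (c := 1) ?_ ?_
      · exact (hχ1.comp (continuous_const_smul c)).aestronglyMeasurable
      · refine Filter.Eventually.of_forall fun x => ?_
        rw [Real.norm_eq_abs, abs_of_nonneg (hχnn _)]; exact hχle _
    have e : (fun x => χ (c • x) * (fderiv ℝ f x h ^ 2 / f x)) =ᵐ[μ]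
        fun x => χ (c • x) * fderiv ℝ (fderiv ℝ f) x h h + χ (c • x) * q x := by
      filter_upwards [hq] with x hx
      rw [hx]; ring
    rw [← ofReal_integral_eq_lintegral_ofReal ((i0.add i3).congr e.symm)]
    · refine ENNReal.ofReal_le_ofReal ?_
      rw [integral_congr_ae e, integral_add i0 i3]
      exact add_le_add p3 (integral_mono i3 hqi fun x => mul_le_of_le_one_left (hq0 x) (hχle _))
    · exact Filter.Eventually.of_forall fun x =>
        mul_nonneg (hχnn _) (div_nonneg (sq_nonneg _) (h0 x))
  have hc0 : Filter.Tendsto (fun m : ℕ => 1 / ((m : ℝ) + 1)) Filter.atTop (nhds 0) :=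
    tendsto_one_div_add_atTop_nhds_zero_nat
  have hpt : ∀ x, Filter.Tendsto (fun m : ℕ => ENNReal.ofReal
      (χ ((1 / ((m : ℝ) + 1)) • x) * (fderiv ℝ f x h ^ 2 / f x))) Filter.atTop
      (nhds (ENNReal.ofReal (fderiv ℝ f x h ^ 2 / f x))) := by
    intro x
    have h2 : Filter.Tendsto (fun m : ℕ => χ ((1 / ((m : ℝ) + 1)) • x)) Filter.atTop (nhds 1) := by
      have h1 : Filter.Tendsto χ (nhds 0) (nhds 1) := hχ0 ▸ hχ1.tendsto 0
      refine h1.comp ?_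
      simpa using hc0.smul_const x
    have h3 := ENNReal.tendsto_ofReal (h2.mul_const (fderiv ℝ f x h ^ 2 / f x))
    rwa [one_mul] at h3
  have hmeas : Measurable fun x => fderiv ℝ f x h ^ 2 / f x := by
    have h1 := hf.continuous_fderiv_two
    have : Continuous fun x => fderiv ℝ f x h := by fun_prop
    exact (this.measurable.pow_const 2).div hf.continuous.measurable
  -- Fatou's lemma along `c = 1/(m+1)`, since `χ (c • x)` tends to `χ 0 = 1`.
  calc ∫⁻ x, ENNReal.ofReal (fderiv ℝ f x h ^ 2 / f x) ∂μ
      = ∫⁻ x, Filter.liminf (fun m : ℕ => ENNReal.ofReal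
          (χ ((1 / ((m : ℝ) + 1)) • x) * (fderiv ℝ f x h ^ 2 / f x))) Filter.atTop ∂μ :=
        lintegral_congr fun x => (hpt x).liminf_eq.symm
    _ ≤ Filter.liminf (fun m : ℕ => ∫⁻ x, ENNReal.ofReal
          (χ ((1 / ((m : ℝ) + 1)) • x) * (fderiv ℝ f x h ^ 2 / f x)) ∂μ) Filter.atTop :=
        lintegral_liminf_le fun m =>
          ((hχ1.comp (continuous_const_smul _)).measurable.mul hmeas).ennreal_ofReal
    _ ≤ Filter.liminf (fun m : ℕ => ENNReal.ofReal ((1 / ((m : ℝ) + 1)) ^ 2 *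
          (C * ‖h‖ * ‖h‖) * (∫ x, f x ∂μ) + ∫ x, q x ∂μ)) Filter.atTop :=
        Filter.liminf_le_liminf (Filter.Eventually.of_forall fun m => step (1 / ((m : ℝ) + 1)) (by positivity))
    _ = ENNReal.ofReal (∫ x, q x ∂μ) := by
        refine Filter.Tendsto.liminf_eq ?_
        have := ENNReal.tendsto_ofReal ((((hc0.pow 2).mul_const (C * ‖h‖ * ‖h‖)).mul_const
          (∫ x, f x ∂μ)).add_const (∫ x, q x ∂μ))
        simpa using this

end

/-! ### Integrability of the derivatives of a regular density -/

section

variable {n : ℕ} {f : EuclideanSpace ℝ (Fin n) → ℝ}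

theorem fderiv_fderiv_apply (hf : ContDiff ℝ 2 f) (x h h' : EuclideanSpace ℝ (Fin n)) :
    fderiv ℝ (fun y => fderiv ℝ f y h') x h = fderiv ℝ (fderiv ℝ f) x h h' := by
  have h1 : HasFDerivAt (fderiv ℝ f) (fderiv ℝ (fderiv ℝ f) x) x :=
    (hf.contDiff_fderiv_two.differentiable (by norm_num) x).hasFDerivAt
  have h2 := (ContinuousLinearMap.apply ℝ ℝ h').hasFDerivAt.comp x h1
  have h3 : fderiv ℝ (fun y => fderiv ℝ f y h') x
      = (ContinuousLinearMap.apply ℝ ℝ h').comp (fderiv ℝ (fderiv ℝ f) x) := h2.fderiv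
  rw [h3]; rfl

theorem partialDeriv_partialDeriv (hf : ContDiff ℝ 2 f) (i j : Fin n)
    (x : EuclideanSpace ℝ (Fin n)) :
    partialDeriv i (partialDeriv j f) x = fderiv ℝ (fderiv ℝ f) x
      (EuclideanSpace.single i 1) (EuclideanSpace.single j 1) :=
  fderiv_fderiv_apply hf x _ _

theorem measurable_hessLog (hf : ContDiff ℝ 2 f) (h h' : EuclideanSpace ℝ (Fin n)) :
    Measurable fun x => hessLog f x h h' := by
  have h1 := hf.continuous
  have h2 := hf.continuous_fderiv_two
  have h3 := hf.continuous_fderiv_fderiv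
  have h4 : Continuous fun x => fderiv ℝ (fderiv ℝ f) x h h' := by fun_prop
  have h5 : ∀ v, Continuous fun x => fderiv ℝ f x v := fun v => by fun_prop
  exact (h4.measurable.div h1.measurable).sub
    (((h5 h).measurable.mul (h5 h').measurable).div (h1.measurable.pow_const 2))

theorem fisherProduction_eq (hf : ContDiff ℝ 2 f) (h0 : ∀ x, 0 ≤ f x) :
    fisherProduction f = ∑ i : Fin n, ∑ j : Fin n, ∫⁻ x, ENNReal.ofReal
      (hessLog f x (EuclideanSpace.single i 1) (EuclideanSpace.single j 1) ^ 2 * f x) := by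
  unfold fisherProduction
  refine Finset.sum_congr rfl fun i _ => Finset.sum_congr rfl fun j _ => ?_
  have hm : MeasurableSet {x | 0 < f x} := measurableSet_lt measurable_const hf.continuous.measurable
  rw [← lintegral_indicator hm]
  refine lintegral_congr fun x => ?_
  by_cases hx : 0 < f x
  · rw [Set.indicator_of_mem (s := {x | 0 < f x}) hx, partialDeriv_partialDeriv hf]
    rfl
  · rw [Set.indicator_of_notMem (s := {x | 0 < f x}) hx]
    have : f x = 0 := le_antisymm (not_lt.1 hx) (h0 x)
    simp [this]

/-- `hessLog` as a continuous bilinear map. -/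
noncomputable def hessLogCLM (f : EuclideanSpace ℝ (Fin n) → ℝ) (x : EuclideanSpace ℝ (Fin n)) :
    EuclideanSpace ℝ (Fin n) →L[ℝ] EuclideanSpace ℝ (Fin n) →L[ℝ] ℝ :=
  (f x)⁻¹ • fderiv ℝ (fderiv ℝ f) x
    - (f x ^ 2)⁻¹ • (fderiv ℝ f x).smulRight (fderiv ℝ f x)

theorem hessLogCLM_apply (x h h' : EuclideanSpace ℝ (Fin n)) :
    hessLogCLM f x h h' = hessLog f x h h' := by
  simp [hessLogCLM, hessLog, div_eq_inv_mul]

theorem EuclideanSpace.sum_smul_single (h : EuclideanSpace ℝ (Fin n)) :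
    ∑ i, h i • EuclideanSpace.single i (1 : ℝ) = h := by
  ext j
  simp [Pi.single_apply]

theorem ContinuousLinearMap.apply_apply_eq_sum
    (B : EuclideanSpace ℝ (Fin n) →L[ℝ] EuclideanSpace ℝ (Fin n) →L[ℝ] ℝ)
    (h h' : EuclideanSpace ℝ (Fin n)) :
    B h h' = ∑ i, ∑ j, h i * h' j *
      B (EuclideanSpace.single i 1) (EuclideanSpace.single j 1) := by
  conv_lhs => rw [← EuclideanSpace.sum_smul_single h, ← EuclideanSpace.sum_smul_single h']
  simp only [map_sum, sum_apply, map_smul, smul_apply, smul_eq_mul, Finset.mul_sum]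
  rw [Finset.sum_comm]
  refine Finset.sum_congr rfl fun i _ => Finset.sum_congr rfl fun j _ => ?_
  ring

theorem hessLog_eq_sum (x h h' : EuclideanSpace ℝ (Fin n)) :
    hessLog f x h h' = ∑ i, ∑ j, h i * h' j *
      hessLog f x (EuclideanSpace.single i 1) (EuclideanSpace.single j 1) := by
  simp only [← hessLogCLM_apply]
  exact (hessLogCLM f x).apply_apply_eq_sum h h'

theorem ContinuousLinearMap.norm_le_sum_single {G : Type*} [NormedAddCommGroup G] [NormedSpace ℝ G]
    (L : EuclideanSpace ℝ (Fin n) →L[ℝ] G) :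
    ‖L‖ ≤ ∑ i, ‖L (EuclideanSpace.single i 1)‖ := by
  refine L.opNorm_le_bound (Finset.sum_nonneg fun i _ => norm_nonneg _) fun h => ?_
  conv_lhs => rw [← EuclideanSpace.sum_smul_single h]
  rw [map_sum, Finset.sum_mul]
  refine (norm_sum_le _ _).trans (Finset.sum_le_sum fun i _ => ?_)
  rw [map_smul, norm_smul, mul_comm]
  exact mul_le_mul_of_nonneg_left (PiLp.norm_apply_le h i) (norm_nonneg _)

theorem fderiv_mul_fderiv_div_le (h0 : ∀ x, 0 ≤ f x) (x h h' : EuclideanSpace ℝ (Fin n)) :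
    |fderiv ℝ f x h * fderiv ℝ f x h' / f x|
      ≤ fderiv ℝ f x h ^ 2 / f x + fderiv ℝ f x h' ^ 2 / f x := by
  rw [abs_div, abs_of_nonneg (h0 x), ← add_div]
  refine div_le_div_of_nonneg_right ?_ (h0 x)
  rw [abs_le]
  constructor <;> nlinarith [sq_nonneg (fderiv ℝ f x h + fderiv ℝ f x h'),
    sq_nonneg (fderiv ℝ f x h - fderiv ℝ f x h'), sq_nonneg (fderiv ℝ f x h),
    sq_nonneg (fderiv ℝ f x h')]

/-- A majorant of the gradient that is integrable once the Fisher information is finite; at a zero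
of `f`, which is a minimum, the gradient vanishes too. -/
theorem abs_fderiv_le (h0 : ∀ x, 0 ≤ f x) (x h : EuclideanSpace ℝ (Fin n)) :
    |fderiv ℝ f x h| ≤ fderiv ℝ f x h ^ 2 / f x + f x := by
  rcases (h0 x).eq_or_lt with hx | hx
  · rw [fderiv_eq_zero_of_nonneg_of_eq_zero h0 hx.symm]; simp [← hx]
  · rw [← sub_nonneg]
    have : fderiv ℝ f x h ^ 2 / f x + f x - |fderiv ℝ f x h|
        = (|fderiv ℝ f x h| ^ 2 + f x ^ 2 - |fderiv ℝ f x h| * f x) / f x := by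
      rw [sq_abs]; field_simp
    rw [this]
    refine div_nonneg ?_ hx.le
    nlinarith [sq_nonneg (|fderiv ℝ f x h| - f x), abs_nonneg (fderiv ℝ f x h)]

namespace IsRegularDensity

theorem nonneg (hf : IsRegularDensity f) (x : EuclideanSpace ℝ (Fin n)) : 0 ≤ f x :=
  hf.logConcave.nonneg x

theorem integrable_sq_hessLog_mul_single (hf : IsRegularDensity f) (i j : Fin n) :
    Integrable fun x =>
      hessLog f x (EuclideanSpace.single i 1) (EuclideanSpace.single j 1) ^ 2 * f x := by
  have hm := measurable_hessLog hf.contDiff (EuclideanSpace.single i 1) (EuclideanSpace.single j 1)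
  have h1 := hf.fisherProduction_lt_top
  rw [fisherProduction_eq hf.contDiff hf.nonneg, ENNReal.sum_lt_top] at h1
  have h2 := ENNReal.sum_lt_top.1 (h1 i (Finset.mem_univ _)) j (Finset.mem_univ _)
  refine (lintegral_ofReal_ne_top_iff_integrable ?_ ?_).1 h2.ne
  · exact ((hm.pow_const 2).mul hf.contDiff.continuous.measurable).aestronglyMeasurable
  · exact Filter.Eventually.of_forall fun x => mul_nonneg (sq_nonneg _) (hf.nonneg x)

theorem fisherProduction_eq_ofReal (hf : IsRegularDensity f) :
    fisherProduction f = ENNReal.ofReal (∑ i : Fin n, ∑ j : Fin n,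
      ∫ x, hessLog f x (EuclideanSpace.single i 1) (EuclideanSpace.single j 1) ^ 2 * f x) := by
  have h0 : ∀ i j : Fin n, 0 ≤ ∫ x,
      hessLog f x (EuclideanSpace.single i 1) (EuclideanSpace.single j 1) ^ 2 * f x :=
    fun i j => integral_nonneg fun x => mul_nonneg (sq_nonneg _) (hf.nonneg x)
  rw [fisherProduction_eq hf.contDiff hf.nonneg,
    ENNReal.ofReal_sum_of_nonneg fun i _ => Finset.sum_nonneg fun j _ => h0 i j]
  refine Finset.sum_congr rfl fun i _ => ?_
  rw [ENNReal.ofReal_sum_of_nonneg fun j _ => h0 i j]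
  refine Finset.sum_congr rfl fun j _ => ?_
  rw [ofReal_integral_eq_lintegral_ofReal (hf.integrable_sq_hessLog_mul_single i j)]
  exact Filter.Eventually.of_forall fun x => mul_nonneg (sq_nonneg _) (hf.nonneg x)

/-- Finite `J` controls the square of each entry, and `|a| ≤ a² + 1` with the weight `f` of mass one
controls the entry itself. -/
theorem integrable_hessLog_mul (hf : IsRegularDensity f) (h h' : EuclideanSpace ℝ (Fin n)) :
    Integrable fun x => hessLog f x h h' * f x := by
  have key : ∀ i j : Fin n, Integrable fun x =>
      hessLog f x (EuclideanSpace.single i 1) (EuclideanSpace.single j 1) * f x := by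
    intro i j
    have hm := measurable_hessLog hf.contDiff (EuclideanSpace.single i 1)
      (EuclideanSpace.single j 1)
    refine ((hf.integrable_sq_hessLog_mul_single i j).add hf.integrable).mono'
      (hm.mul hf.contDiff.continuous.measurable).aestronglyMeasurable
      (Filter.Eventually.of_forall fun x => ?_)
    have h0 := hf.nonneg x
    set a := hessLog f x (EuclideanSpace.single i 1) (EuclideanSpace.single j 1)
    have : |a| ≤ a ^ 2 + 1 := by rw [abs_le]; constructor <;> nlinarith [sq_nonneg (a + 1), sq_nonneg (a - 1)]
    rw [Real.norm_eq_abs, abs_mul, abs_of_nonneg h0]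
    simp only [Pi.add_apply]
    nlinarith
  simp_rw [hessLog_eq_sum _ h h', Finset.sum_mul, mul_assoc _ _ (f _)]
  exact integrable_finsetSum _ fun i _ => integrable_finsetSum _ fun j _ => (key i j).const_mul _

/-- Here `q = -D² log f · f`, nonnegative by log-concavity and integrable because `J` is finite. -/
theorem lintegral_sq_fderiv_div_le (hf : IsRegularDensity f) (h : EuclideanSpace ℝ (Fin n)) :
    ∫⁻ x, ENNReal.ofReal (fderiv ℝ f x h ^ 2 / f x)
      ≤ ENNReal.ofReal (∫ x, -hessLog f x h h * f x) := by
  refine _root_.lintegral_sq_fderiv_div_le hf.contDiff hf.nonneg hf.integrable (fun x => ?_) ?_ h ?_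
  · exact mul_nonneg (neg_nonneg.2 (hf.logConcave.hessLog_nonpos hf.contDiff x h)) (hf.nonneg x)
  · simpa using (hf.integrable_hessLog_mul h h).neg
  · filter_upwards [hf.logConcave.ae_fderiv_fderiv_eq] with x hx
    rw [hx h h]; ring

theorem integrable_sq_fderiv_div (hf : IsRegularDensity f) (h : EuclideanSpace ℝ (Fin n)) :
    Integrable fun x => fderiv ℝ f x h ^ 2 / f x := by
  have hf2 := hf.contDiff.continuous_fderiv_two
  have hmeas : Measurable fun x => fderiv ℝ f x h ^ 2 / f x := by
    have : Continuous fun x => fderiv ℝ f x h := by fun_prop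
    exact (this.measurable.pow_const 2).div hf.contDiff.continuous.measurable
  refine (lintegral_ofReal_ne_top_iff_integrable hmeas.aestronglyMeasurable ?_).1
    ((hf.lintegral_sq_fderiv_div_le h).trans_lt ENNReal.ofReal_lt_top).ne
  exact Filter.Eventually.of_forall fun x => div_nonneg (sq_nonneg _) (hf.nonneg x)

theorem integrable_fderiv_mul_fderiv_div (hf : IsRegularDensity f)
    (h h' : EuclideanSpace ℝ (Fin n)) :
    Integrable fun x => fderiv ℝ f x h * fderiv ℝ f x h' / f x := by
  have hf2 := hf.contDiff.continuous_fderiv_two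
  have hc : ∀ v, Continuous fun x => fderiv ℝ f x v := fun v => by fun_prop
  refine ((hf.integrable_sq_fderiv_div h).add (hf.integrable_sq_fderiv_div h')).mono' ?_ ?_
  · exact (((hc h).measurable.mul (hc h').measurable).div
      hf.contDiff.continuous.measurable).aestronglyMeasurable
  · exact Filter.Eventually.of_forall fun x => fderiv_mul_fderiv_div_le hf.nonneg x h h'

theorem integrable_fderiv_apply (hf : IsRegularDensity f) (h : EuclideanSpace ℝ (Fin n)) :
    Integrable fun x => fderiv ℝ f x h := by
  have hf2 := hf.contDiff.continuous_fderiv_two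
  refine ((hf.integrable_sq_fderiv_div h).add hf.integrable).mono' ?_ ?_
  · exact Continuous.aestronglyMeasurable (by fun_prop)
  · exact Filter.Eventually.of_forall fun x => abs_fderiv_le hf.nonneg x h

/-- Almost everywhere the second derivative is the sum of the Hessian term and the Fisher term, both
integrable. -/
theorem integrable_fderiv_fderiv_apply (hf : IsRegularDensity f)
    (h h' : EuclideanSpace ℝ (Fin n)) :
    Integrable fun x => fderiv ℝ (fderiv ℝ f) x h h' := by
  refine ((hf.integrable_hessLog_mul h h').add (hf.integrable_fderiv_mul_fderiv_div h h')).congr ?_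
  filter_upwards [hf.logConcave.ae_fderiv_fderiv_eq] with x hx
  rw [hx h h']; rfl

theorem integrable_fderiv (hf : IsRegularDensity f) : Integrable (fderiv ℝ f) :=
  (integrable_finsetSum _ fun i _ =>
    (hf.integrable_fderiv_apply (EuclideanSpace.single i 1)).norm).mono'
    hf.contDiff.continuous_fderiv_two.aestronglyMeasurable
    (Filter.Eventually.of_forall fun _ => ContinuousLinearMap.norm_le_sum_single _)

set_option maxSynthPendingDepth 4 in
theorem integrable_fderiv_fderiv (hf : IsRegularDensity f) :
    Integrable (fderiv ℝ (fderiv ℝ f)) :=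
  (integrable_finsetSum Finset.univ fun i _ => integrable_finsetSum Finset.univ fun j _ =>
    (hf.integrable_fderiv_fderiv_apply (EuclideanSpace.single i 1)
      (EuclideanSpace.single j 1)).norm).mono'
    hf.contDiff.continuous_fderiv_fderiv.aestronglyMeasurable
    (Filter.Eventually.of_forall fun _ =>
      (ContinuousLinearMap.norm_le_sum_single _).trans
        (Finset.sum_le_sum fun _ _ => ContinuousLinearMap.norm_le_sum_single _))

end IsRegularDensity

end

/-! ### Differentiation of convolutions -/

section

variable {E G : Type*} [NormedAddCommGroup E] [NormedSpace ℝ E] [FiniteDimensional ℝ E]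
  [MeasurableSpace E] [BorelSpace E] {μ : Measure E} [μ.IsAddHaarMeasure]
  [NormedAddCommGroup G] [NormedSpace ℝ G] {φ : E → G} {g : E → ℝ} {C : ℝ}

theorem integrable_smul_comp_sub (hg : Continuous g) (hgC : ∀ x, ‖g x‖ ≤ C) (hi : Integrable φ μ)
    (z : E) : Integrable (fun y => g y • φ (z - y)) μ :=
  (hi.comp_sub_left z).bdd_smul C hg.aestronglyMeasurable (Filter.Eventually.of_forall hgC)

/-- Substituting `z - y` for `y` moves `z` into the bounded continuous factor `g`, and `C ‖φ‖`
dominates. -/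
theorem continuous_integral_smul_comp_sub (hg : Continuous g) (hgC : ∀ x, ‖g x‖ ≤ C)
    (hi : Integrable φ μ) : Continuous fun z => ∫ y, g y • φ (z - y) ∂μ := by
  have e : (fun z => ∫ y, g y • φ (z - y) ∂μ) = fun z => ∫ x, g (z - x) • φ x ∂μ := by
    ext z
    rw [← integral_sub_left_eq_self (fun x => g (z - x) • φ x) μ z]
    simp
  rw [e]
  refine continuous_of_dominated (bound := fun x => C * ‖φ x‖) (fun z => ?_) (fun z => ?_)
    (hi.norm.const_mul C) ?_
  · exact (hg.comp (by fun_prop)).aestronglyMeasurable.smul hi.1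
  · refine Filter.Eventually.of_forall fun x => ?_
    rw [norm_smul]
    exact mul_le_mul_of_nonneg_right (hgC _) (norm_nonneg _)
  · exact Filter.Eventually.of_forall fun x =>
      (hg.comp (continuous_id.sub continuous_const)).smul continuous_const

variable [CompleteSpace G]

/-- Integrability of `fderiv ℝ φ` alone gives no majorant that is locally uniform in `z`, so
differentiation under the integral is replaced by the fundamental theorem of calculus on a segment
followed by Fubini. -/
theorem integral_smul_comp_sub_add (hφ : ContDiff ℝ 1 φ) (hi : Integrable φ μ)
    (hdi : Integrable (fderiv ℝ φ) μ) (hg : Continuous g) (hgC : ∀ x, ‖g x‖ ≤ C) (z h : E) :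
    (∫ y, g y • φ (z + h - y) ∂μ) - ∫ y, g y • φ (z - y) ∂μ
      = ∫ s in (0 : ℝ)..1, (∫ y, g y • fderiv ℝ φ (z + s • h - y) ∂μ) h := by
  have hdc : Continuous (fderiv ℝ φ) := hφ.continuous_fderiv (by norm_num)
  rw [← integral_sub (integrable_smul_comp_sub hg hgC hi _)
    (integrable_smul_comp_sub hg hgC hi _)]
  have ftc : ∀ y, g y • φ (z + h - y) - g y • φ (z - y)
      = ∫ s in (0 : ℝ)..1, g y • fderiv ℝ φ (z + s • h - y) h := by
    intro y
    rw [intervalIntegral.integral_smul, ← smul_sub]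
    congr 1
    have hd : ∀ s ∈ Set.uIcc (0 : ℝ) 1,
        HasDerivAt (fun s : ℝ => φ (z + s • h - y)) (fderiv ℝ φ (z + s • h - y) h) s := by
      intro s _
      have h1 : HasDerivAt (fun s : ℝ => z + s • h - y) h s := by
        have := (((hasDerivAt_id s).smul_const h).const_add z).sub_const y
        rw [one_smul] at this
        exact this
      exact (hφ.differentiable (by norm_num) _).hasFDerivAt.comp_hasDerivAt s h1
    rw [intervalIntegral.integral_eq_sub_of_hasDerivAt hd
      (Continuous.intervalIntegrable (by fun_prop) _ _)]
    simp
  simp_rw [ftc]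
  have hint : Integrable (Function.uncurry fun (y : E) (s : ℝ) =>
      g y • fderiv ℝ φ (z + s • h - y) h) (μ.prod (volume.restrict (Set.uIoc (0 : ℝ) 1))) := by
    have hcont : Continuous (Function.uncurry fun (y : E) (s : ℝ) =>
        g y • fderiv ℝ φ (z + s • h - y) h) := by
      unfold Function.uncurry
      fun_prop
    rw [integrable_prod_iff' hcont.aestronglyMeasurable]
    have hsec : ∀ s : ℝ, Integrable (fun y => g y • fderiv ℝ φ (z + s • h - y) h) μ := fun s =>
      integrable_smul_comp_sub (φ := fun x => fderiv ℝ φ x h) hg hgC (hdi.apply_continuousLinearMap h) _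
    refine ⟨Filter.Eventually.of_forall hsec, ?_⟩
    have : IsFiniteMeasure (volume.restrict (Set.uIoc (0 : ℝ) 1)) := by
      rw [Set.uIoc_of_le zero_le_one]; infer_instance
    refine Integrable.of_bound (C := C * (‖h‖ * ∫ x, ‖fderiv ℝ φ x‖ ∂μ)) ?_ ?_
    · exact (hcont.norm.stronglyMeasurable.integral_prod_left' (μ := μ)).aestronglyMeasurable
    · refine Filter.Eventually.of_forall fun s => ?_
      rw [Real.norm_eq_abs, abs_of_nonneg (integral_nonneg fun _ => norm_nonneg _)]
      have e1 : ∫ x, ‖fderiv ℝ φ x‖ ∂μ = ∫ y, ‖fderiv ℝ φ (z + s • h - y)‖ ∂μ :=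
        (integral_sub_left_eq_self (fun x => ‖fderiv ℝ φ x‖) μ _).symm
      rw [e1, ← integral_const_mul, ← integral_const_mul]
      refine integral_mono (hsec s).norm
        (((hdi.comp_sub_left _).norm.const_mul _).const_mul _) fun y => ?_
      simp only [Function.uncurry]
      rw [norm_smul, mul_comm ‖h‖]
      exact mul_le_mul (hgC y) (ContinuousLinearMap.le_opNorm _ _) (norm_nonneg _)
        ((norm_nonneg _).trans (hgC y))
  have swap := integral_integral_swap hint
  simp_rw [intervalIntegral.integral_of_le zero_le_one, ← Set.uIoc_of_le (zero_le_one' ℝ)]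
  rw [swap]
  refine integral_congr_ae (Filter.Eventually.of_forall fun s => ?_)
  simp only
  rw [ContinuousLinearMap.integral_apply (integrable_smul_comp_sub hg hgC hdi _)]
  rfl

/-- The increment is the average over the segment of the candidate derivative `D`, and `D` is
continuous. -/
theorem hasFDerivAt_integral_smul_comp_sub (hφ : ContDiff ℝ 1 φ) (hi : Integrable φ μ)
    (hdi : Integrable (fderiv ℝ φ) μ) (hg : Continuous g) (hgC : ∀ x, ‖g x‖ ≤ C) (z : E) :
    HasFDerivAt (fun z => ∫ y, g y • φ (z - y) ∂μ) (∫ y, g y • fderiv ℝ φ (z - y) ∂μ) z := by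
  have hDc : Continuous fun z => ∫ y, g y • fderiv ℝ φ (z - y) ∂μ :=
    continuous_integral_smul_comp_sub hg hgC hdi
  set D := fun z => ∫ y, g y • fderiv ℝ φ (z - y) ∂μ with hD
  change HasFDerivAt _ (D z) z
  rw [hasFDerivAt_iff_isLittleO_nhds_zero, Asymptotics.isLittleO_iff]
  intro c hc
  obtain ⟨δ, hδ, hball⟩ := Metric.continuousAt_iff.1 hDc.continuousAt c hc
  filter_upwards [Metric.ball_mem_nhds (0 : E) hδ] with h hh
  have hh : ‖h‖ < δ := by simpa using hh
  rw [integral_smul_comp_sub_add hφ hi hdi hg hgC]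
  change ‖(∫ s in (0 : ℝ)..1, D (z + s • h) h) - D z h‖ ≤ _
  have e : D z h = ∫ s in (0 : ℝ)..1, D z h := by simp
  rw [e, ← intervalIntegral.integral_sub
    (Continuous.intervalIntegrable (by fun_prop) _ _)
    (Continuous.intervalIntegrable (by fun_prop) _ _)]
  refine (intervalIntegral.norm_integral_le_of_norm_le_const (C := c * ‖h‖) fun s hs => ?_).trans
    (by simp)
  rw [Set.uIoc_of_le zero_le_one] at hs
  rw [← sub_apply]
  refine (ContinuousLinearMap.le_opNorm _ _).trans ?_
  refine mul_le_mul_of_nonneg_right ?_ (norm_nonneg _)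
  rw [← dist_eq_norm]
  refine (hball ?_).le
  rw [dist_eq_norm, add_sub_cancel_left, norm_smul, Real.norm_eq_abs, abs_of_pos hs.1]
  nlinarith [norm_nonneg h, hs.1, hs.2]

theorem contDiff_one_integral_smul_comp_sub (hφ : ContDiff ℝ 1 φ) (hi : Integrable φ μ)
    (hdi : Integrable (fderiv ℝ φ) μ) (hg : Continuous g) (hgC : ∀ x, ‖g x‖ ≤ C) :
    ContDiff ℝ 1 fun z => ∫ y, g y • φ (z - y) ∂μ := by
  have h1 := hasFDerivAt_integral_smul_comp_sub hφ hi hdi hg hgC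
  rw [contDiff_one_iff_fderiv]
  refine ⟨fun z => (h1 z).differentiableAt, ?_⟩
  rw [funext fun z => (h1 z).fderiv]
  exact continuous_integral_smul_comp_sub hg hgC hdi

end

section

variable {E : Type*} [NormedAddCommGroup E] [NormedSpace ℝ E] [FiniteDimensional ℝ E]
  [MeasurableSpace E] [BorelSpace E] {μ : Measure E} [μ.IsAddHaarMeasure]
  {f g : E → ℝ} {C : ℝ}

theorem fderiv_integral_smul_comp_sub (hf : ContDiff ℝ 2 f) (hi : Integrable f μ)
    (hdi : Integrable (fderiv ℝ f) μ) (hg : Continuous g) (hgC : ∀ x, ‖g x‖ ≤ C) (z : E) :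
    fderiv ℝ (fun z => ∫ y, g y • f (z - y) ∂μ) z = ∫ y, g y • fderiv ℝ f (z - y) ∂μ :=
  (hasFDerivAt_integral_smul_comp_sub (hf.of_le (by norm_num)) hi hdi hg hgC z).fderiv

set_option maxSynthPendingDepth 4 in
theorem contDiff_two_integral_smul_comp_sub (hf : ContDiff ℝ 2 f) (hi : Integrable f μ)
    (hdi : Integrable (fderiv ℝ f) μ) (hddi : Integrable (fderiv ℝ (fderiv ℝ f)) μ)
    (hg : Continuous g) (hgC : ∀ x, ‖g x‖ ≤ C) :
    ContDiff ℝ 2 fun z => ∫ y, g y • f (z - y) ∂μ := by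
  have h1 := fun z => hasFDerivAt_integral_smul_comp_sub (hf.of_le (by norm_num)) hi hdi hg hgC z
  rw [show (2 : WithTop ℕ∞) = 1 + 1 by norm_num, contDiff_succ_iff_fderiv]
  refine ⟨fun z => (h1 z).differentiableAt, by simp, ?_⟩
  rw [funext fun z => (h1 z).fderiv]
  exact contDiff_one_integral_smul_comp_sub hf.contDiff_fderiv_two hdi hddi hg hgC

set_option maxSynthPendingDepth 4 in
theorem fderiv_fderiv_integral_smul_comp_sub (hf : ContDiff ℝ 2 f) (hi : Integrable f μ)
    (hdi : Integrable (fderiv ℝ f) μ) (hddi : Integrable (fderiv ℝ (fderiv ℝ f)) μ)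
    (hg : Continuous g) (hgC : ∀ x, ‖g x‖ ≤ C) (z h h' : E) :
    fderiv ℝ (fderiv ℝ fun z => ∫ y, g y • f (z - y) ∂μ) z h h'
      = ∫ y, g y * fderiv ℝ (fderiv ℝ f) (z - y) h h' ∂μ := by
  rw [funext fun z => fderiv_integral_smul_comp_sub hf hi hdi hg hgC z,
    (hasFDerivAt_integral_smul_comp_sub hf.contDiff_fderiv_two hdi hddi hg hgC z).fderiv,
    ContinuousLinearMap.integral_apply (integrable_smul_comp_sub hg hgC hddi _),
    ContinuousLinearMap.integral_apply]
  · rfl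
  · exact integrable_smul_comp_sub (φ := fun x => fderiv ℝ (fderiv ℝ f) x h) hg hgC
      (hddi.apply_continuousLinearMap h) _

end

/-! ### Cauchy–Schwarz and a trace inequality -/

/-- The convolution of two densities. -/
noncomputable def densityConv {n : ℕ} (f g : EuclideanSpace ℝ (Fin n) → ℝ) :
    EuclideanSpace ℝ (Fin n) → ℝ :=
  fun z => ∫ y, g y • f (z - y)

/-- Integrate `2 t w ≤ r + t² ρ` with the optimal `t = ∫ w / ∫ ρ`. It serves both for the
nonnegativity of a conditional variance and for conditional Jensen. -/
theorem sq_integral_le_of_sq_le {α : Type*} [MeasurableSpace α] {μ : Measure α} {w r ρ : α → ℝ}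
    (hw : Integrable w μ) (hr : Integrable r μ) (hρ : Integrable ρ μ) (hr0 : ∀ x, 0 ≤ r x)
    (hρ0 : ∀ x, 0 ≤ ρ x) (h : ∀ x, w x ^ 2 ≤ r x * ρ x) (hpos : 0 < ∫ x, ρ x ∂μ) :
    (∫ x, w x ∂μ) ^ 2 / (∫ x, ρ x ∂μ) ≤ ∫ x, r x ∂μ := by
  set I := ∫ x, ρ x ∂μ with hI
  set t := (∫ x, w x ∂μ) / I with ht
  have h1 : ∀ x, 2 * t * w x ≤ r x + t ^ 2 * ρ x := by
    intro x
    rcases (hρ0 x).eq_or_lt with h0 | h0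
    · have : w x = 0 := by
        have := h x
        rw [← h0, mul_zero] at this
        exact pow_eq_zero_iff (two_ne_zero) |>.1 (le_antisymm this (sq_nonneg _))
      rw [this, ← h0]
      simpa using hr0 x
    · have h2 : w x ^ 2 / ρ x ≤ r x := by rw [div_le_iff₀ h0]; exact h x
      have h3 : w x ^ 2 / ρ x + t ^ 2 * ρ x - 2 * t * w x = (w x - t * ρ x) ^ 2 / ρ x := by
        field_simp
        ring
      have h4 : 0 ≤ (w x - t * ρ x) ^ 2 / ρ x := by positivity
      linarith
  have h2 := integral_mono (hw.const_mul (2 * t)) (hr.add (hρ.const_mul (t ^ 2))) h1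
  rw [integral_const_mul, integral_add' hr (hρ.const_mul _), integral_const_mul, ← hI] at h2
  have h3 : (∫ x, w x ∂μ) = t * I := by rw [ht]; field_simp
  rw [h3] at h2 ⊢
  have h4 : (t * I) ^ 2 / I = t ^ 2 * I := by field_simp
  rw [h4]
  linarith

open scoped MatrixOrder in
theorem Matrix.PosSemidef.exists_eq_conjTranspose_mul_self {ι : Type*} [Fintype ι]
    {A : Matrix ι ι ℝ} (hA : A.PosSemidef) : ∃ S : Matrix ι ι ℝ, A = S.conjTranspose * S := by
  classical
  exact CStarAlgebra.nonneg_iff_eq_star_mul_self.mp hA.nonneg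

/-- With `A = Sᴴ S`, cyclicity turns the trace into that of `S B Sᴴ`, which is positive
semidefinite. -/
theorem Matrix.PosSemidef.trace_mul_nonneg {ι : Type*} [Fintype ι] {A B : Matrix ι ι ℝ}
    (hA : A.PosSemidef) (hB : B.PosSemidef) : 0 ≤ (A * B).trace := by
  obtain ⟨S, rfl⟩ := hA.exists_eq_conjTranspose_mul_self
  rw [Matrix.mul_assoc, Matrix.trace_mul_comm]
  exact (hB.mul_mul_conjTranspose_same S).trace_nonneg

/-- The difference of the two sides is `tr ((N - M)(N + M))`, a trace of a product of positive
semidefinite matrices. Without `0 ≤ M` the order would not survive squaring. -/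
theorem sum_sq_le_sum_sq_of_quadratic_le {ι : Type*} [Fintype ι] {M N : Matrix ι ι ℝ}
    (hM : ∀ i j, M i j = M j i) (hN : ∀ i j, N i j = N j i)
    (h0 : ∀ x : ι → ℝ, 0 ≤ ∑ i, ∑ j, x i * x j * M i j)
    (h1 : ∀ x : ι → ℝ, ∑ i, ∑ j, x i * x j * M i j ≤ ∑ i, ∑ j, x i * x j * N i j) :
    ∑ i, ∑ j, M i j ^ 2 ≤ ∑ i, ∑ j, N i j ^ 2 := by
  have psd : ∀ A : Matrix ι ι ℝ, (∀ i j, A i j = A j i) →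
      (∀ x : ι → ℝ, 0 ≤ ∑ i, ∑ j, x i * x j * A i j) → A.PosSemidef := by
    intro A hA hx
    refine Matrix.PosSemidef.of_dotProduct_mulVec_nonneg ?_ fun x => ?_
    · ext i j
      simp [hA j i]
    · have := hx x
      simp only [dotProduct, Matrix.mulVec, star_trivial, Finset.mul_sum]
      refine this.trans_eq (Finset.sum_congr rfl fun i _ => Finset.sum_congr rfl fun j _ => ?_)
      ring
  have p1 : (N - M).PosSemidef := by
    refine psd _ (fun i j => by simp [hM i j, hN i j]) fun x => ?_
    have := h1 x
    simp only [Matrix.sub_apply, mul_sub, Finset.sum_sub_distrib]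
    linarith
  have p2 : (N + M).PosSemidef := by
    refine psd _ (fun i j => by simp [hM i j, hN i j]) fun x => ?_
    have := h1 x
    have := h0 x
    simp only [Matrix.add_apply, mul_add, Finset.sum_add_distrib]
    linarith
  have h2 := p1.trace_mul_nonneg p2
  have h3 : ((N - M) * (N + M)).trace
      = ∑ i, ∑ j, N i j ^ 2 - ∑ i, ∑ j, M i j ^ 2 := by
    have e1 : ((N - M) * (N + M)).trace = (N * N).trace - (M * M).trace := by
      rw [Matrix.sub_mul, Matrix.mul_add, Matrix.mul_add, Matrix.trace_sub, Matrix.trace_add,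
        Matrix.trace_add, Matrix.trace_mul_comm N M]
      ring
    have e2 : ∀ A : Matrix ι ι ℝ, (∀ i j, A i j = A j i) →
        (A * A).trace = ∑ i, ∑ j, A i j ^ 2 := by
      intro A hA
      simp only [Matrix.trace, Matrix.diag, Matrix.mul_apply]
      exact Finset.sum_congr rfl fun i _ => Finset.sum_congr rfl fun j _ => by rw [hA j i, sq]
    rw [e1, e2 N hN, e2 M hM]
  linarith

/-! ### The Hessian of the logarithm of a convolution -/

section

variable {n : ℕ} {f g : EuclideanSpace ℝ (Fin n) → ℝ}

theorem hessLog_comm (hf : ContDiff ℝ 2 f) (x h h' : EuclideanSpace ℝ (Fin n)) :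
    hessLog f x h h' = hessLog f x h' h := by
  have h1 : IsSymmSndFDerivAt ℝ f x := hf.contDiffAt.isSymmSndFDerivAt (by simp)
  unfold hessLog
  rw [h1.eq h h', mul_comm (fderiv ℝ f x h)]

namespace IsRegularDensity

theorem exists_forall_norm_le (hf : IsRegularDensity f) : ∃ C, ∀ x, ‖f x‖ ≤ C := by
  obtain ⟨C, -, hC⟩ := hf.logConcave.exists_forall_le hf.contDiff.continuous hf.integrable
  exact ⟨C, fun x => by rw [Real.norm_eq_abs, abs_of_nonneg (hf.nonneg x)]; exact hC x⟩

theorem integrable_mul_comp_sub (hg : IsRegularDensity g) {u : EuclideanSpace ℝ (Fin n) → ℝ}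
    (hu : Integrable u) (z : EuclideanSpace ℝ (Fin n)) : Integrable fun y => g y * u (z - y) := by
  obtain ⟨C, hC⟩ := hg.exists_forall_norm_le
  exact integrable_smul_comp_sub hg.contDiff.continuous hC hu z

theorem integrable_comp_sub_mul (hf : IsRegularDensity f) {u : EuclideanSpace ℝ (Fin n) → ℝ}
    (hu : Integrable u) (z : EuclideanSpace ℝ (Fin n)) : Integrable fun y => u y * f (z - y) := by
  have := (hf.integrable_mul_comp_sub hu z).comp_sub_left z
  simpa [mul_comm] using this

theorem densityConv_comm : densityConv f g = densityConv g f := by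
  ext z
  unfold densityConv
  rw [← integral_sub_left_eq_self (fun y => f y • g (z - y)) volume z]
  simp [mul_comm]

theorem contDiff_densityConv (hf : IsRegularDensity f) (hg : IsRegularDensity g) :
    ContDiff ℝ 2 (densityConv f g) := by
  obtain ⟨C, hC⟩ := hg.exists_forall_norm_le
  exact contDiff_two_integral_smul_comp_sub hf.contDiff hf.integrable hf.integrable_fderiv
    hf.integrable_fderiv_fderiv hg.contDiff.continuous hC

theorem densityConv_nonneg (hf : IsRegularDensity f) (hg : IsRegularDensity g)
    (z : EuclideanSpace ℝ (Fin n)) : 0 ≤ densityConv f g z :=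
  integral_nonneg fun y => mul_nonneg (hg.nonneg y) (hf.nonneg _)

theorem ofReal_densityConv (hf : IsRegularDensity f) (hg : IsRegularDensity g)
    (z : EuclideanSpace ℝ (Fin n)) :
    ENNReal.ofReal (densityConv f g z) = ∫⁻ y, ENNReal.ofReal (g y * f (z - y)) :=
  ofReal_integral_eq_lintegral_ofReal (hg.integrable_mul_comp_sub hf.integrable z)
    (Filter.Eventually.of_forall fun y => mul_nonneg (hg.nonneg y) (hf.nonneg _))

/-- Prékopa's theorem: the convolution of log-concave densities is log-concave. -/
theorem isLogConcave_densityConv (hf : IsRegularDensity f) (hg : IsRegularDensity g) :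
    IsLogConcave (densityConv f g) := by
  have h0 := hf.densityConv_nonneg hg
  refine isLogConcave_of_rpow_mul_rpow_le h0 fun s t hs ht hst x y => ?_
  rw [← ENNReal.ofReal_le_ofReal_iff (h0 _), ENNReal.ofReal_mul (Real.rpow_nonneg (h0 _) _),
    ← ENNReal.ofReal_rpow_of_nonneg (h0 _) hs.le, ← ENNReal.ofReal_rpow_of_nonneg (h0 _) ht.le,
    hf.ofReal_densityConv hg, hf.ofReal_densityConv hg, hf.ofReal_densityConv hg]
  have hm : ∀ z, Measurable fun y => ENNReal.ofReal (g y * f (z - y)) := by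
    intro z
    have h1 := hf.contDiff.continuous
    have h2 := hg.contDiff.continuous
    exact (Continuous.measurable (by fun_prop)).ennreal_ofReal
  -- The function `(z, y) ↦ g y * f (z - y)` is jointly log-concave, and Prékopa–Leindler integrates
  -- out `y`.
  refine prekopaLeindler_euclideanSpace hs ht hst n _ _ _ (hm x) (hm y) (hm _) fun u v => ?_
  have hn : ∀ z y, 0 ≤ g y * f (z - y) := fun z y => mul_nonneg (hg.nonneg _) (hf.nonneg _)
  rw [ENNReal.ofReal_rpow_of_nonneg (hn _ _) hs.le, ENNReal.ofReal_rpow_of_nonneg (hn _ _) ht.le,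
    ← ENNReal.ofReal_mul (Real.rpow_nonneg (hn _ _) _)]
  refine ENNReal.ofReal_le_ofReal ?_
  rw [Real.mul_rpow (hg.nonneg _) (hf.nonneg _), Real.mul_rpow (hg.nonneg _) (hf.nonneg _),
    mul_mul_mul_comm]
  have e : s • x + t • y - (s • u + t • v) = s • (x - u) + t • (y - v) := by module
  rw [e]
  exact mul_le_mul (hg.logConcave.rpow_mul_rpow_le hs ht hst u v)
    (hf.logConcave.rpow_mul_rpow_le hs ht hst _ _)
    (mul_nonneg (Real.rpow_nonneg (hf.nonneg _) _) (Real.rpow_nonneg (hf.nonneg _) _))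
    (hg.nonneg _)

theorem fderiv_densityConv (hf : IsRegularDensity f) (hg : IsRegularDensity g)
    (z h : EuclideanSpace ℝ (Fin n)) :
    fderiv ℝ (densityConv f g) z h = ∫ y, g y * fderiv ℝ f (z - y) h := by
  obtain ⟨C, hC⟩ := hg.exists_forall_norm_le
  have h1 := fderiv_integral_smul_comp_sub hf.contDiff hf.integrable hf.integrable_fderiv
    hg.contDiff.continuous hC z
  unfold densityConv
  rw [h1, ContinuousLinearMap.integral_apply]
  · rfl
  · exact integrable_smul_comp_sub hg.contDiff.continuous hC hf.integrable_fderiv z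

/-- The derivative falls on the other factor; weighting this form by `b` and the previous one by `a`
produces the score `a u + b v`. -/
theorem fderiv_densityConv' (hf : IsRegularDensity f) (hg : IsRegularDensity g)
    (z h : EuclideanSpace ℝ (Fin n)) :
    fderiv ℝ (densityConv f g) z h = ∫ y, fderiv ℝ g y h * f (z - y) := by
  rw [densityConv_comm, hg.fderiv_densityConv hf,
    ← integral_sub_left_eq_self (fun y => fderiv ℝ g y h * f (z - y)) volume z]
  simp [mul_comm]

theorem fderiv_fderiv_densityConv (hf : IsRegularDensity f) (hg : IsRegularDensity g)
    (z h h' : EuclideanSpace ℝ (Fin n)) :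
    fderiv ℝ (fderiv ℝ (densityConv f g)) z h h'
      = ∫ y, g y * fderiv ℝ (fderiv ℝ f) (z - y) h h' := by
  obtain ⟨C, hC⟩ := hg.exists_forall_norm_le
  exact fderiv_fderiv_integral_smul_comp_sub hf.contDiff hf.integrable hf.integrable_fderiv
    hf.integrable_fderiv_fderiv hg.contDiff.continuous hC z h h'

theorem fderiv_fderiv_densityConv' (hf : IsRegularDensity f) (hg : IsRegularDensity g)
    (z h h' : EuclideanSpace ℝ (Fin n)) :
    fderiv ℝ (fderiv ℝ (densityConv f g)) z h h'
      = ∫ y, fderiv ℝ (fderiv ℝ g) y h h' * f (z - y) := by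
  rw [densityConv_comm, hg.fderiv_fderiv_densityConv hf,
    ← integral_sub_left_eq_self (fun y => fderiv ℝ (fderiv ℝ g) y h h' * f (z - y)) volume z]
  simp [mul_comm]

/-- The square is the Fisher integrand times the bounded function `f`. -/
theorem integrable_sq_fderiv (hf : IsRegularDensity f) (h : EuclideanSpace ℝ (Fin n)) :
    Integrable fun x => fderiv ℝ f x h ^ 2 := by
  obtain ⟨C, hC⟩ := hf.exists_forall_norm_le
  have := (hf.integrable_sq_fderiv_div h).bdd_mul (c := C)
    hf.contDiff.continuous.aestronglyMeasurable (Filter.Eventually.of_forall hC)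
  refine this.congr (Filter.Eventually.of_forall fun x => ?_)
  by_cases hx : f x = 0
  · simp [hx, fderiv_eq_zero_of_nonneg_of_eq_zero hf.nonneg hx]
  · simp only; field_simp

theorem integrable_fderiv_mul_fderiv_comp_sub (hf : IsRegularDensity f) (hg : IsRegularDensity g)
    (z h h' : EuclideanSpace ℝ (Fin n)) :
    Integrable fun y => fderiv ℝ f (z - y) h * fderiv ℝ g y h' := by
  have c1 := hf.contDiff.continuous_fderiv_two
  have c2 := hg.contDiff.continuous_fderiv_two
  refine (((hf.integrable_sq_fderiv h).comp_sub_left z).add (hg.integrable_sq_fderiv h')).mono'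
    (Continuous.aestronglyMeasurable (by fun_prop)) (Filter.Eventually.of_forall fun y => ?_)
  simp only [Pi.add_apply]
  set a := fderiv ℝ f (z - y) h
  set b := fderiv ℝ g y h'
  rw [Real.norm_eq_abs, abs_le]
  constructor <;> nlinarith [sq_nonneg (a + b), sq_nonneg (a - b), sq_nonneg a, sq_nonneg b]

/-- One derivative is moved from `f` to `g` by parts; this form supplies the cross term of weight
`2ab`. -/
theorem fderiv_fderiv_densityConv_eq_integral_fderiv (hf : IsRegularDensity f)
    (hg : IsRegularDensity g) (z h : EuclideanSpace ℝ (Fin n)) :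
    fderiv ℝ (fderiv ℝ (densityConv f g)) z h h
      = ∫ y, fderiv ℝ f (z - y) h * fderiv ℝ g y h := by
  have d1 : ∀ y, HasLineDerivAt ℝ (fun y => fderiv ℝ f (z - y) h)
      (-fderiv ℝ (fderiv ℝ f) (z - y) h h) y h := by
    intro y
    have h1 := hf.contDiff.hasLineDerivAt_fderiv (z - y) h h
    unfold HasLineDerivAt at h1 ⊢
    have h2 : HasDerivAt (fun t : ℝ => -t) (-1) 0 := hasDerivAt_neg 0
    have h3 : HasDerivAt (fun t : ℝ => fderiv ℝ f (z - y + t • h) h)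
        (fderiv ℝ (fderiv ℝ f) (z - y) h h) (-0) := by rwa [neg_zero]
    have h4 := h3.comp (0 : ℝ) h2
    rw [mul_neg_one] at h4
    refine h4.congr_of_eventuallyEq (Filter.Eventually.of_forall fun t => ?_)
    simp only [Function.comp_apply]
    congr 2
    module
  have i1 := hg.integrable_mul_comp_sub (hf.integrable_fderiv_fderiv_apply h h) z
  have i2 := hg.integrable_mul_comp_sub (hf.integrable_fderiv_apply h) z
  have p := integral_bilinear_hasLineDerivAt_right_eq_neg_left_of_integrable (v := h)
    (f := fun y => fderiv ℝ f (z - y) h) (f' := fun y => -fderiv ℝ (fderiv ℝ f) (z - y) h h)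
    (g := g) (g' := fun y => fderiv ℝ g y h) (μ := volume)
    (B := ContinuousLinearMap.mul ℝ ℝ)
    (by simpa [mul_comm] using i1)
    (by simpa using hf.integrable_fderiv_mul_fderiv_comp_sub hg z h h)
    (by simpa [mul_comm] using i2) (fun y _ => d1 y)
    (fun y _ => hg.contDiff.hasLineDerivAt y h)
  simp only [ContinuousLinearMap.mul_apply', neg_mul, integral_neg, neg_neg] at p
  rw [hf.fderiv_fderiv_densityConv hg, p]
  exact integral_congr_ae (Filter.Eventually.of_forall fun y => mul_comm _ _)

/-- The conditional mean of `a² D²(log f)(z - Y) + b² D²(log g)(Y)` at `z`, times the density. -/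
noncomputable def _root_.weightedHess (f g : EuclideanSpace ℝ (Fin n) → ℝ) (a b : ℝ)
    (z h h' : EuclideanSpace ℝ (Fin n)) : ℝ :=
  ∫ y, (a ^ 2 * hessLog f (z - y) h h' + b ^ 2 * hessLog g y h h') * (g y * f (z - y))

theorem integrable_weightedHess (hf : IsRegularDensity f) (hg : IsRegularDensity g) (a b : ℝ)
    (z h h' : EuclideanSpace ℝ (Fin n)) :
    Integrable fun y => (a ^ 2 * hessLog f (z - y) h h' + b ^ 2 * hessLog g y h h')
      * (g y * f (z - y)) := by
  refine (((hg.integrable_mul_comp_sub (hf.integrable_hessLog_mul h h') z).const_mul (a ^ 2)).add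
    ((hf.integrable_comp_sub_mul (hg.integrable_hessLog_mul h h') z).const_mul (b ^ 2))).congr
    (Filter.Eventually.of_forall fun y => ?_)
  simp only [Pi.add_apply]
  ring

/-- Lower bound for the Hessian of the logarithm of a convolution. -/
theorem weightedHess_div_le_hessLog (hf : IsRegularDensity f) (hg : IsRegularDensity g) {a b : ℝ}
    (hab : a + b = 1) {z : EuclideanSpace ℝ (Fin n)} (hz : 0 < densityConv f g z)
    (h : EuclideanSpace ℝ (Fin n)) :
    weightedHess f g a b z h h / densityConv f g z ≤ hessLog (densityConv f g) z h h := by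
  set k := densityConv f g with hk
  have iρ : Integrable fun y => g y * f (z - y) := hg.integrable_mul_comp_sub hf.integrable z
  have i1 := hg.integrable_mul_comp_sub (hf.integrable_fderiv_apply h) z
  have i2 := hf.integrable_comp_sub_mul (hg.integrable_fderiv_apply h) z
  have i3 := hg.integrable_mul_comp_sub (hf.integrable_fderiv_fderiv_apply h h) z
  have i4 := hf.integrable_comp_sub_mul (hg.integrable_fderiv_fderiv_apply h h) z
  have i5 := hf.integrable_fderiv_mul_fderiv_comp_sub hg z h h
  have i6 := hg.integrable_mul_comp_sub (hf.integrable_sq_fderiv_div h) z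
  have i7 := hf.integrable_comp_sub_mul (hg.integrable_sq_fderiv_div h) z
  -- With scores `u` of `f` and `v` of `g` and weight `ρ = g y * f (z - y)`, these are `w = (a u + b
  -- v) ρ` and `r = (a u + b v)² ρ`, written so as to make sense at zeros of `ρ`.
  set w : EuclideanSpace ℝ (Fin n) → ℝ := fun y =>
    a * (g y * fderiv ℝ f (z - y) h) + b * (fderiv ℝ g y h * f (z - y)) with hw
  set r : EuclideanSpace ℝ (Fin n) → ℝ := fun y =>
    a ^ 2 * (g y * (fderiv ℝ f (z - y) h ^ 2 / f (z - y)))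
      + 2 * a * b * (fderiv ℝ f (z - y) h * fderiv ℝ g y h)
      + b ^ 2 * (fderiv ℝ g y h ^ 2 / g y * f (z - y)) with hr
  have iw : Integrable w := (i1.const_mul a).add (i2.const_mul b)
  have ir : Integrable r :=
    ((i6.const_mul (a ^ 2)).add (i5.const_mul (2 * a * b))).add (i7.const_mul (b ^ 2))
  have hwr : ∀ y, w y ^ 2 = r y * (g y * f (z - y)) ∧ 0 ≤ r y := by
    intro y
    simp only [hw, hr]
    have hf0 : f (z - y) = 0 → fderiv ℝ f (z - y) h = 0 := fun h0 => by
      rw [fderiv_eq_zero_of_nonneg_of_eq_zero hf.nonneg h0]; rfl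
    have hg0 : g y = 0 → fderiv ℝ g y h = 0 := fun h0 => by
      rw [fderiv_eq_zero_of_nonneg_of_eq_zero hg.nonneg h0]; rfl
    have nf := hf.nonneg (z - y)
    have ng := hg.nonneg y
    generalize fderiv ℝ f (z - y) h = u at *
    generalize fderiv ℝ g y h = v at *
    generalize f (z - y) = p at *
    generalize g y = q at *
    rcases nf.eq_or_lt with hp | hp
    · rw [hf0 hp.symm, ← hp]; simp
    rcases ng.eq_or_lt with hq | hq
    · rw [hg0 hq.symm, ← hq]; simp
    have e : a ^ 2 * (q * (u ^ 2 / p)) + 2 * a * b * (u * v) + b ^ 2 * (v ^ 2 / q * p)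
        = (a * (q * u) + b * (v * p)) ^ 2 / (q * p) := by
      field_simp
      ring
    rw [e]
    constructor
    · field_simp
    · positivity
  have cs := sq_integral_le_of_sq_le iw ir iρ (fun y => (hwr y).2)
    (fun y => mul_nonneg (hg.nonneg y) (hf.nonneg _)) (fun y => (hwr y).1.le) hz
  have eD : fderiv ℝ k z h = ∫ y, w y := by
    rw [hw, integral_add (i1.const_mul a) (i2.const_mul b), integral_const_mul,
      integral_const_mul, ← hf.fderiv_densityConv hg, ← hf.fderiv_densityConv' hg, ← add_mul, hab,
      one_mul]
  -- Since `(a + b)² = 1`, the second derivative splits into three parts: both derivatives on `f`,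
  -- one on each factor, both on `g`.
  have eDD : fderiv ℝ (fderiv ℝ k) z h h = weightedHess f g a b z h h + ∫ y, r y := by
    have i35 : Integrable fun y => a ^ 2 * (g y * fderiv ℝ (fderiv ℝ f) (z - y) h h)
        + 2 * a * b * (fderiv ℝ f (z - y) h * fderiv ℝ g y h) :=
      (i3.const_mul _).add (i5.const_mul _)
    have e1 : fderiv ℝ (fderiv ℝ k) z h h
        = ∫ y, (a ^ 2 * (g y * fderiv ℝ (fderiv ℝ f) (z - y) h h)
          + 2 * a * b * (fderiv ℝ f (z - y) h * fderiv ℝ g y h))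
          + b ^ 2 * (fderiv ℝ (fderiv ℝ g) y h h * f (z - y)) := by
      rw [integral_add i35 (i4.const_mul _),
        integral_add (i3.const_mul _) (i5.const_mul _), integral_const_mul, integral_const_mul,
        integral_const_mul, ← hf.fderiv_fderiv_densityConv hg,
        ← hf.fderiv_fderiv_densityConv' hg,
        ← hf.fderiv_fderiv_densityConv_eq_integral_fderiv hg, ← hk]
      have : (a + b) ^ 2 = 1 := by rw [hab, one_pow]
      linear_combination (-fderiv ℝ (fderiv ℝ k) z h h) * this
    rw [e1, weightedHess, ← integral_add (hf.integrable_weightedHess hg a b z h h) ir]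
    refine integral_congr_ae ?_
    filter_upwards [(Measure.measurePreserving_sub_left volume z).quasiMeasurePreserving.ae
      hf.logConcave.ae_fderiv_fderiv_eq, hg.logConcave.ae_fderiv_fderiv_eq] with y h1 h2
    rw [h1 h h, h2 h h, hr]
    ring
  -- The inner bracket is `k z` times the conditional variance of `a u + b v`, nonnegative by `cs`.
  have e3 : hessLog k z h h = (weightedHess f g a b z h h
      + ((∫ y, r y) - (∫ y, w y) ^ 2 / k z)) / k z := by
    unfold hessLog
    rw [eDD, eD]
    field_simp
    ring
  rw [e3]
  refine div_le_div_of_nonneg_right ?_ hz.le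
  have : (∫ y, w y) ^ 2 / k z ≤ ∫ y, r y := cs
  linarith

theorem weightedHess_eq_sum (hf : IsRegularDensity f) (hg : IsRegularDensity g) (a b : ℝ)
    (z h h' : EuclideanSpace ℝ (Fin n)) :
    weightedHess f g a b z h h' = ∑ i, ∑ j, h i * h' j *
      weightedHess f g a b z (EuclideanSpace.single i 1) (EuclideanSpace.single j 1) := by
  unfold weightedHess
  simp_rw [← integral_const_mul]
  have hi := fun i j : Fin n => (hf.integrable_weightedHess hg a b z (EuclideanSpace.single i 1)
    (EuclideanSpace.single j 1)).const_mul (h i * h' j)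
  have e : ∀ i : Fin n, (∑ j : Fin n, ∫ y, h i * h' j *
      ((a ^ 2 * hessLog f (z - y) (EuclideanSpace.single i 1) (EuclideanSpace.single j 1)
        + b ^ 2 * hessLog g y (EuclideanSpace.single i 1) (EuclideanSpace.single j 1))
        * (g y * f (z - y)))) = ∫ y, ∑ j : Fin n, h i * h' j *
      ((a ^ 2 * hessLog f (z - y) (EuclideanSpace.single i 1) (EuclideanSpace.single j 1)
        + b ^ 2 * hessLog g y (EuclideanSpace.single i 1) (EuclideanSpace.single j 1))
        * (g y * f (z - y))) := fun i => (integral_finsetSum _ fun j _ => hi i j).symm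
  rw [Finset.sum_congr rfl fun i _ => e i,
    ← integral_finsetSum _ fun i _ => integrable_finsetSum _ fun j _ => hi i j]
  refine integral_congr_ae (Filter.Eventually.of_forall fun y => ?_)
  simp only
  rw [hessLog_eq_sum (z - y) h h', hessLog_eq_sum y h h']
  simp only [Finset.mul_sum, Finset.sum_mul, ← Finset.sum_add_distrib]
  refine Finset.sum_congr rfl fun i _ => Finset.sum_congr rfl fun j _ => ?_
  ring

theorem sum_sq_hessLog_densityConv_le (hf : IsRegularDensity f) (hg : IsRegularDensity g) {a b : ℝ}
    (hab : a + b = 1) {z : EuclideanSpace ℝ (Fin n)} (hz : 0 < densityConv f g z) :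
    ∑ i : Fin n, ∑ j : Fin n, hessLog (densityConv f g) z (EuclideanSpace.single i 1)
        (EuclideanSpace.single j 1) ^ 2
      ≤ ∑ i : Fin n, ∑ j : Fin n, (weightedHess f g a b z (EuclideanSpace.single i 1)
        (EuclideanSpace.single j 1) / densityConv f g z) ^ 2 := by
  set k := densityConv f g with hk
  have key := sum_sq_le_sum_sq_of_quadratic_le
    (M := Matrix.of fun i j => -hessLog k z (EuclideanSpace.single i 1) (EuclideanSpace.single j 1))
    (N := Matrix.of fun i j => -(weightedHess f g a b z (EuclideanSpace.single i 1)
        (EuclideanSpace.single j 1) / k z)) ?_ ?_ ?_ ?_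
  · simpa using key
  · intro i j
    simp only [Matrix.of_apply]
    rw [hessLog_comm (hf.contDiff_densityConv hg)]
  · intro i j
    simp only [Matrix.of_apply, weightedHess]
    simp_rw [hessLog_comm hf.contDiff _ (EuclideanSpace.single i 1),
      hessLog_comm hg.contDiff _ (EuclideanSpace.single i 1)]
  -- Prékopa's theorem enters here: it gives `0 ≤ M`.
  · intro x
    have h1 := (hf.isLogConcave_densityConv hg).hessLog_nonpos (hf.contDiff_densityConv hg) z
      (WithLp.toLp 2 x)
    rw [hessLog_eq_sum] at h1
    simp only [Matrix.of_apply, mul_neg, Finset.sum_neg_distrib]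
    simpa using h1
  · intro x
    have h1 := hf.weightedHess_div_le_hessLog hg hab hz (WithLp.toLp 2 x)
    rw [hessLog_eq_sum, hf.weightedHess_eq_sum hg] at h1
    simp only [Matrix.of_apply, mul_neg, Finset.sum_neg_distrib]
    simp only [Finset.sum_div, mul_div_assoc] at h1
    simpa using h1

end IsRegularDensity

end

/-! ### Positivity of `J` and the integrated bound -/

section

variable {n : ℕ} {f g : EuclideanSpace ℝ (Fin n) → ℝ}

/-- The entries of the Hessian matrix of `log f`. -/
noncomputable abbrev hessEntry (f : EuclideanSpace ℝ (Fin n) → ℝ) (i j : Fin n)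
    (x : EuclideanSpace ℝ (Fin n)) : ℝ :=
  hessLog f x (EuclideanSpace.single i 1) (EuclideanSpace.single j 1)

/-- The real number `J(f)`. -/
noncomputable def hessMass (f : EuclideanSpace ℝ (Fin n) → ℝ) : ℝ :=
  ∑ i : Fin n, ∑ j : Fin n, ∫ x, hessEntry f i j x ^ 2 * f x

/-- The mean of the Hessian of `log f` under the density `f`. -/
noncomputable def hessMean (f : EuclideanSpace ℝ (Fin n) → ℝ) (i j : Fin n) : ℝ :=
  ∫ x, hessEntry f i j x * f x

/-- Translation by `(c / ‖h‖²) h` carries one half-space onto the other and leaves `f` unchanged. -/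
theorem setIntegral_lt_inner_eq {h : EuclideanSpace ℝ (Fin n)} (hh : h ≠ 0)
    (hinv : ∀ (x : EuclideanSpace ℝ (Fin n)) (t : ℝ), f (x + t • h) = f x) (c : ℝ) :
    ∫ x in {x | c < inner ℝ h x}, f x = ∫ x in {x | 0 < inner ℝ h x}, f x := by
  have hm : ∀ c : ℝ, MeasurableSet {x : EuclideanSpace ℝ (Fin n) | c < inner ℝ h x} := fun c =>
    measurableSet_lt measurable_const (Continuous.measurable (by fun_prop))
  rw [← integral_indicator (hm c), ← integral_indicator (hm 0),
    ← integral_add_right_eq_self _ ((c / ‖h‖ ^ 2) • h)]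
  refine integral_congr_ae (Filter.Eventually.of_forall fun x => ?_)
  simp only [Set.indicator, hinv]
  have hn : ‖h‖ ^ 2 ≠ 0 := by simpa using hh
  have e : inner ℝ h (x + (c / ‖h‖ ^ 2) • h) = inner ℝ h x + c := by
    rw [inner_add_right, inner_smul_right, real_inner_self_eq_norm_sq]
    field_simp
  congr 1
  simp only [Set.mem_ofPred_eq, e, eq_iff_iff]
  constructor <;> intro h1 <;> linarith

/-- An integrable function which is invariant under the translations along a line has zero
integral. -/
theorem integral_eq_zero_of_forall_add_smul_eq (hf : Integrable f) {h : EuclideanSpace ℝ (Fin n)}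
    (hh : h ≠ 0) (hinv : ∀ (x : EuclideanSpace ℝ (Fin n)) (t : ℝ), f (x + t • h) = f x) :
    ∫ x, f x = 0 := by
  have hm : ∀ c : ℝ, MeasurableSet {x : EuclideanSpace ℝ (Fin n) | c < inner ℝ h x} := fun c =>
    measurableSet_lt measurable_const (Continuous.measurable (by fun_prop))
  -- These half-spaces shrink to the empty set and those in `l2` exhaust the space, yet `f` has the
  -- same integral over all of them.
  have l1 := tendsto_setIntegral_of_antitone (μ := volume) (f := f)
    (s := fun m : ℕ => {x : EuclideanSpace ℝ (Fin n) | (m : ℝ) < inner ℝ h x}) (fun m => hm m)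
    (fun m k hmk x (hx : (k : ℝ) < inner ℝ h x) =>
      show (m : ℝ) < inner ℝ h x from lt_of_le_of_lt (Nat.cast_le.2 hmk) hx) ⟨0, hf.integrableOn⟩
  have l2 := tendsto_setIntegral_of_monotone (μ := volume) (f := f)
    (s := fun m : ℕ => {x : EuclideanSpace ℝ (Fin n) | -(m : ℝ) < inner ℝ h x}) (fun m => hm _)
    (fun m k hmk x (hx : -(m : ℝ) < inner ℝ h x) =>
      show -(k : ℝ) < inner ℝ h x from lt_of_le_of_lt (neg_le_neg (Nat.cast_le.2 hmk)) hx) hf.integrableOn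
  have e1 : ⋂ m : ℕ, {x : EuclideanSpace ℝ (Fin n) | (m : ℝ) < inner ℝ h x} = ∅ := by
    refine Set.eq_empty_of_forall_notMem fun x hx => ?_
    obtain ⟨m, hm⟩ := exists_nat_gt (inner ℝ h x)
    have h2 : (m : ℝ) < inner ℝ h x := Set.mem_iInter.1 hx m
    exact lt_asymm hm h2
  have e2 : ⋃ m : ℕ, {x : EuclideanSpace ℝ (Fin n) | -(m : ℝ) < inner ℝ h x} = Set.univ := by
    refine Set.eq_univ_of_forall fun x => ?_
    obtain ⟨m, hm⟩ := exists_nat_gt (-inner ℝ h x)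
    refine Set.mem_iUnion.2 ⟨m, ?_⟩
    change -(m : ℝ) < inner ℝ h x
    linarith
  rw [e1, Measure.restrict_empty, integral_zero_measure] at l1
  rw [e2, Measure.restrict_univ] at l2
  simp only [setIntegral_lt_inner_eq hh hinv] at l1 l2
  exact tendsto_nhds_unique l2 l1

namespace IsRegularDensity

/-- The mean of `-D²(log f)` is positive definite. -/
theorem integral_neg_hessLog_mul_pos (hf : IsRegularDensity f) {h : EuclideanSpace ℝ (Fin n)}
    (hh : h ≠ 0) : 0 < ∫ x, -hessLog f x h h * f x := by
  by_contra hneg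
  -- A nonpositive mean makes the Fisher information along `h` vanish, so `f` is constant along `h`,
  -- which is incompatible with total mass one.
  have h1 := hf.lintegral_sq_fderiv_div_le h
  rw [ENNReal.ofReal_eq_zero.2 (not_lt.1 hneg), nonpos_iff_eq_zero,
    lintegral_eq_zero_iff' (hf.integrable_sq_fderiv_div h).1.aemeasurable.ennreal_ofReal] at h1
  have hc : Continuous fun x => fderiv ℝ f x h := by
    have := hf.contDiff.continuous_fderiv_two
    fun_prop
  have h2 : (fun x => fderiv ℝ f x h) =ᵐ[volume] fun _ => 0 := by
    filter_upwards [h1] with x hx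
    by_cases h0 : f x = 0
    · rw [fderiv_eq_zero_of_nonneg_of_eq_zero hf.nonneg h0]; rfl
    · have h0' : 0 < f x := (hf.nonneg x).lt_of_ne' h0
      have h3 : fderiv ℝ f x h ^ 2 / f x ≤ 0 := by simpa using hx
      have h4 : fderiv ℝ f x h ^ 2 ≤ 0 := by
        rwa [div_le_iff₀ h0', zero_mul] at h3
      exact pow_eq_zero_iff (two_ne_zero) |>.1 (le_antisymm h4 (sq_nonneg _))
  have h3 : ∀ x, fderiv ℝ f x h = 0 := fun x =>
    congrFun ((hc.ae_eq_iff_eq volume continuous_const).1 h2) x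
  have hinv : ∀ (x : EuclideanSpace ℝ (Fin n)) (t : ℝ), f (x + t • h) = f x := by
    intro x t
    have hd : ∀ t : ℝ, HasDerivAt (fun t : ℝ => f (x + t • h)) 0 t := by
      intro t
      have h4 : HasDerivAt (fun t : ℝ => x + t • h) h t := by
        have := ((hasDerivAt_id t).smul_const h).const_add x
        rw [one_smul] at this
        exact this
      have h5 := (hf.contDiff.differentiable (by norm_num) (x + t • h)).hasFDerivAt.comp_hasDerivAt
        t h4
      rw [h3] at h5
      exact h5
    have := is_const_of_deriv_eq_zero (fun t => (hd t).differentiableAt) (fun t => (hd t).deriv) t 0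
    simpa using this
  have := integral_eq_zero_of_forall_add_smul_eq hf.integrable hh hinv
  rw [hf.integral_eq_one] at this
  exact one_ne_zero this

theorem fisherProduction_eq_hessMass (hf : IsRegularDensity f) :
    fisherProduction f = ENNReal.ofReal (hessMass f) :=
  hf.fisherProduction_eq_ofReal

theorem hessMass_nonneg (hf : IsRegularDensity f) : 0 ≤ hessMass f :=
  Finset.sum_nonneg fun _ _ => Finset.sum_nonneg fun _ _ =>
    integral_nonneg fun x => mul_nonneg (sq_nonneg _) (hf.nonneg x)

theorem toReal_fisherProduction (hf : IsRegularDensity f) :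
    (fisherProduction f).toReal = hessMass f := by
  rw [hf.fisherProduction_eq_hessMass, ENNReal.toReal_ofReal hf.hessMass_nonneg]

/-- If `J` vanished, a diagonal entry of `D² log f` would be zero wherever `f > 0`, up to a null
set, contradicting the positive mean of its negative. -/
theorem hessMass_pos (hf : IsRegularDensity f) (hn : 1 ≤ n) : 0 < hessMass f := by
  refine lt_of_le_of_ne hf.hessMass_nonneg fun h0 => ?_
  have nn : ∀ i j : Fin n, 0 ≤ ∫ x, hessEntry f i j x ^ 2 * f x := fun i j =>
    integral_nonneg fun x => mul_nonneg (sq_nonneg _) (hf.nonneg x)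
  let i : Fin n := ⟨0, hn⟩
  have h1 := (Finset.sum_eq_zero_iff_of_nonneg
    (fun i _ => Finset.sum_nonneg fun j _ => nn i j)).1 h0.symm i (Finset.mem_univ _)
  have h2 := (Finset.sum_eq_zero_iff_of_nonneg (fun j _ => nn i j)).1 h1 i (Finset.mem_univ _)
  rw [integral_eq_zero_iff_of_nonneg (fun x => mul_nonneg (sq_nonneg _) (hf.nonneg x))
    (hf.integrable_sq_hessLog_mul_single i i)] at h2
  have h3 := hf.integral_neg_hessLog_mul_pos (h := EuclideanSpace.single i (1 : ℝ)) (by simp)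
  refine h3.ne' (integral_eq_zero_of_ae ?_)
  filter_upwards [h2] with x hx
  have : hessEntry f i i x ^ 2 * f x = 0 := hx
  rcases mul_eq_zero.1 this with h4 | h4
  · have : hessEntry f i i x = 0 := by simpa using h4
    simp only [hessEntry] at this
    simp [this]
  · simp [h4]

/-- Expand the square; under the product density the cross term factors into the two means. -/
theorem integrable_sq_add_mul (hf : IsRegularDensity f) (hg : IsRegularDensity g) (i j : Fin n)
    (s t : ℝ) :
    Integrable (fun p : EuclideanSpace ℝ (Fin n) × EuclideanSpace ℝ (Fin n) =>
      (s * hessEntry f i j p.1 + t * hessEntry g i j p.2) ^ 2 * (f p.1 * g p.2))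
      (volume.prod volume) ∧
    ∫ p : EuclideanSpace ℝ (Fin n) × EuclideanSpace ℝ (Fin n),
      (s * hessEntry f i j p.1 + t * hessEntry g i j p.2) ^ 2 * (f p.1 * g p.2)
        ∂(volume.prod volume)
      = s ^ 2 * (∫ x, hessEntry f i j x ^ 2 * f x) + 2 * s * t * (hessMean f i j * hessMean g i j)
        + t ^ 2 * ∫ x, hessEntry g i j x ^ 2 * g x := by
  have i1 := ((hf.integrable_sq_hessLog_mul_single i j).mul_prod hg.integrable).const_mul (s ^ 2)
  have i2 := ((hf.integrable_hessLog_mul (EuclideanSpace.single i 1)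
    (EuclideanSpace.single j 1)).mul_prod (hg.integrable_hessLog_mul (EuclideanSpace.single i 1)
    (EuclideanSpace.single j 1))).const_mul (2 * s * t)
  have i3 := (hf.integrable.mul_prod (hg.integrable_sq_hessLog_mul_single i j)).const_mul (t ^ 2)
  have e : (fun p : EuclideanSpace ℝ (Fin n) × EuclideanSpace ℝ (Fin n) =>
      (s * hessEntry f i j p.1 + t * hessEntry g i j p.2) ^ 2 * (f p.1 * g p.2))
      = fun p => s ^ 2 * ((hessEntry f i j p.1 ^ 2 * f p.1) * g p.2)
        + 2 * s * t * ((hessEntry f i j p.1 * f p.1) * (hessEntry g i j p.2 * g p.2))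
        + t ^ 2 * (f p.1 * (hessEntry g i j p.2 ^ 2 * g p.2)) := by
    ext p; ring
  rw [e]
  refine ⟨(i1.add i2).add i3, ?_⟩
  have i12 : Integrable (fun p : EuclideanSpace ℝ (Fin n) × EuclideanSpace ℝ (Fin n) =>
      s ^ 2 * ((hessEntry f i j p.1 ^ 2 * f p.1) * g p.2)
        + 2 * s * t * ((hessEntry f i j p.1 * f p.1) * (hessEntry g i j p.2 * g p.2)))
      (volume.prod volume) := i1.add i2
  rw [integral_add i12 i3, integral_add i1 i2, integral_const_mul, integral_const_mul, integral_const_mul]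
  have p1 := integral_prod_mul (μ := volume) (ν := volume) (fun x => hessEntry f i j x ^ 2 * f x) g
  have p2 := integral_prod_mul (μ := volume) (ν := volume) (fun x => hessEntry f i j x * f x)
    (fun x => hessEntry g i j x * g x)
  have p3 := integral_prod_mul (μ := volume) (ν := volume) f (fun x => hessEntry g i j x ^ 2 * g x)
  rw [p1, p2, p3, hf.integral_eq_one, hg.integral_eq_one, mul_one, one_mul]
  rfl

theorem integrable_sq_weightedHess (hf : IsRegularDensity f) (hg : IsRegularDensity g) (i j : Fin n)
    (s t : ℝ) (z : EuclideanSpace ℝ (Fin n)) :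
    Integrable fun y => (s * hessEntry f i j (z - y) + t * hessEntry g i j y) ^ 2
      * (g y * f (z - y)) := by
  have i1 : Integrable fun y => g y * (hessEntry f i j (z - y) ^ 2 * f (z - y)) :=
    hg.integrable_mul_comp_sub (hf.integrable_sq_hessLog_mul_single i j) z
  have i2 : Integrable fun y => hessEntry g i j y ^ 2 * g y * f (z - y) := hf.integrable_comp_sub_mul (hg.integrable_sq_hessLog_mul_single i j) z
  have m1 := measurable_hessLog hf.contDiff (EuclideanSpace.single i 1) (EuclideanSpace.single j 1)
  have m2 := measurable_hessLog hg.contDiff (EuclideanSpace.single i 1) (EuclideanSpace.single j 1)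
  have c1 := hf.contDiff.continuous.measurable
  have c2 := hg.contDiff.continuous.measurable
  refine ((i1.const_mul (2 * s ^ 2)).add (i2.const_mul (2 * t ^ 2))).mono' ?_ ?_
  · refine Measurable.aestronglyMeasurable ?_
    have : Measurable fun y : EuclideanSpace ℝ (Fin n) => z - y := by fun_prop
    exact (((m1.comp this).const_mul s).add (m2.const_mul t)).pow_const 2 |>.mul
      (c2.mul (c1.comp this))
  · refine Filter.Eventually.of_forall fun y => ?_
    have hn : 0 ≤ g y * f (z - y) := mul_nonneg (hg.nonneg y) (hf.nonneg _)
    rw [Real.norm_eq_abs, abs_of_nonneg (mul_nonneg (sq_nonneg _) hn)]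
    simp only [Pi.add_apply]
    set A := hessEntry f i j (z - y)
    set B := hessEntry g i j y
    have : (s * A + t * B) ^ 2 ≤ 2 * s ^ 2 * A ^ 2 + 2 * t ^ 2 * B ^ 2 := by
      nlinarith [sq_nonneg (s * A - t * B)]
    calc (s * A + t * B) ^ 2 * (g y * f (z - y))
        ≤ (2 * s ^ 2 * A ^ 2 + 2 * t ^ 2 * B ^ 2) * (g y * f (z - y)) :=
          mul_le_mul_of_nonneg_right this hn
      _ = _ := by ring

/-- Conditional Jensen, multiplied by the density of the sum: the squared conditional mean is at
most the conditional mean of the square. -/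
theorem ofReal_sq_hessLog_densityConv_le (hf : IsRegularDensity f) (hg : IsRegularDensity g)
    {a b : ℝ} (hab : a + b = 1) (z : EuclideanSpace ℝ (Fin n)) :
    ∑ i : Fin n, ∑ j : Fin n,
        ENNReal.ofReal (hessEntry (densityConv f g) i j z ^ 2 * densityConv f g z)
      ≤ ∑ i : Fin n, ∑ j : Fin n, ∫⁻ y, ENNReal.ofReal
        ((a ^ 2 * hessEntry f i j (z - y) + b ^ 2 * hessEntry g i j y) ^ 2
          * (f (z - y) * g y)) := by
  set k := densityConv f g with hk
  rcases (hf.densityConv_nonneg hg z).eq_or_lt with hz | hz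
  · simp [hk, ← hz]
  have hn : ∀ y, 0 ≤ g y * f (z - y) := fun y => mul_nonneg (hg.nonneg y) (hf.nonneg _)
  have e : ∀ i j : Fin n, ∫⁻ y, ENNReal.ofReal
        ((a ^ 2 * hessEntry f i j (z - y) + b ^ 2 * hessEntry g i j y) ^ 2 * (f (z - y) * g y))
      = ENNReal.ofReal (∫ y, (a ^ 2 * hessEntry f i j (z - y) + b ^ 2 * hessEntry g i j y) ^ 2
          * (g y * f (z - y))) := by
    intro i j
    rw [ofReal_integral_eq_lintegral_ofReal (hf.integrable_sq_weightedHess hg i j _ _ z)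
      (Filter.Eventually.of_forall fun y => mul_nonneg (sq_nonneg _) (hn y))]
    refine lintegral_congr fun y => ?_
    rw [mul_comm (f (z - y))]
  simp_rw [e]
  have s1 : ∀ c : Fin n → Fin n → ℝ, (∀ i j, 0 ≤ c i j) →
      ∑ i, ∑ j, ENNReal.ofReal (c i j) = ENNReal.ofReal (∑ i, ∑ j, c i j) := by
    intro c hc
    rw [ENNReal.ofReal_sum_of_nonneg fun i _ => Finset.sum_nonneg fun j _ => hc i j]
    refine Finset.sum_congr rfl fun i _ => ?_
    rw [ENNReal.ofReal_sum_of_nonneg fun j _ => hc i j]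
  rw [s1 _ fun i j => mul_nonneg (sq_nonneg _) hz.le,
    s1 _ fun i j => integral_nonneg fun y => mul_nonneg (sq_nonneg _) (hn y)]
  refine ENNReal.ofReal_le_ofReal ?_
  have h1 := mul_le_mul_of_nonneg_right (hf.sum_sq_hessLog_densityConv_le hg hab hz) hz.le
  simp only [Finset.sum_mul] at h1
  refine h1.trans (Finset.sum_le_sum fun i _ => Finset.sum_le_sum fun j _ => ?_)
  have cs := sq_integral_le_of_sq_le (hf.integrable_weightedHess hg a b z
    (EuclideanSpace.single i 1) (EuclideanSpace.single j 1))
    (hf.integrable_sq_weightedHess hg i j (a ^ 2) (b ^ 2) z)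
    (hg.integrable_mul_comp_sub hf.integrable z)
    (fun y => mul_nonneg (sq_nonneg _) (hn y)) hn (fun y => le_of_eq (by ring)) hz
  refine le_trans (le_of_eq ?_) cs
  change _ = weightedHess f g a b z (EuclideanSpace.single i 1) (EuclideanSpace.single j 1) ^ 2
    / densityConv f g z
  have := hz.ne'
  field_simp

/-- Integrating in `z` and substituting `(z - y, y)` turns the conditional means into integrals
against the product density. -/
theorem fisherProduction_densityConv_le (hf : IsRegularDensity f) (hg : IsRegularDensity g)
    {a b : ℝ} (hab : a + b = 1) :
    fisherProduction (densityConv f g) ≤ ENNReal.ofReal (a ^ 4 * hessMass f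
      + 2 * a ^ 2 * b ^ 2 * (∑ i, ∑ j, hessMean f i j * hessMean g i j) + b ^ 4 * hessMass g) := by
  have hk := hf.contDiff_densityConv hg
  rw [fisherProduction_eq hk (hf.densityConv_nonneg hg)]
  have m1 := fun i j : Fin n => measurable_hessLog hf.contDiff (EuclideanSpace.single i 1)
    (EuclideanSpace.single j 1)
  have m2 := fun i j : Fin n => measurable_hessLog hg.contDiff (EuclideanSpace.single i 1)
    (EuclideanSpace.single j 1)
  have m3 := fun i j : Fin n => measurable_hessLog hk (EuclideanSpace.single i 1)
    (EuclideanSpace.single j 1)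
  have c1 := hf.contDiff.continuous.measurable
  have c2 := hg.contDiff.continuous.measurable
  set Q : Fin n → Fin n → EuclideanSpace ℝ (Fin n) × EuclideanSpace ℝ (Fin n) → ℝ := fun i j p =>
    (a ^ 2 * hessEntry f i j p.1 + b ^ 2 * hessEntry g i j p.2) ^ 2 * (f p.1 * g p.2) with hQ
  have mQ : ∀ i j, Measurable (Q i j) := fun i j =>
    ((((m1 i j).comp measurable_fst).const_mul _).add
      (((m2 i j).comp measurable_snd).const_mul _)).pow_const 2 |>.mul
      ((c1.comp measurable_fst).mul (c2.comp measurable_snd))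
  have Q0 : ∀ i j p, 0 ≤ Q i j p := fun i j p =>
    mul_nonneg (sq_nonneg _) (mul_nonneg (hf.nonneg _) (hg.nonneg _))
  have mQ' : ∀ i j, Measurable fun p : EuclideanSpace ℝ (Fin n) × EuclideanSpace ℝ (Fin n) =>
      ENNReal.ofReal (Q i j (p.1 - p.2, p.2)) := fun i j =>
    ((mQ i j).comp (by fun_prop)).ennreal_ofReal
  have step : ∀ i j, ∫⁻ z, ∫⁻ y, ENNReal.ofReal (Q i j (z - y, y))
      = ENNReal.ofReal (∫ p, Q i j p ∂(volume.prod volume)) := by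
    intro i j
    rw [lintegral_lintegral_swap (mQ' i j).aemeasurable,
      ofReal_integral_eq_lintegral_ofReal (hf.integrable_sq_add_mul hg i j _ _).1
        (Filter.Eventually.of_forall (Q0 i j)),
      lintegral_prod_symm _ (mQ i j).ennreal_ofReal.aemeasurable]
    refine lintegral_congr fun y => ?_
    exact lintegral_sub_right_eq_self (fun x => ENNReal.ofReal (Q i j (x, y))) y
  have mk : ∀ i j : Fin n, Measurable fun z => ENNReal.ofReal
      (hessEntry (densityConv f g) i j z ^ 2 * densityConv f g z) := fun i j =>
    (((m3 i j).pow_const 2).mul hk.continuous.measurable).ennreal_ofReal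
  have mL : ∀ i j : Fin n, Measurable fun z => ∫⁻ y, ENNReal.ofReal (Q i j (z - y, y)) :=
    fun i j => (mQ' i j).lintegral_prod_right'
  calc ∑ i : Fin n, ∑ j : Fin n, ∫⁻ z, ENNReal.ofReal
        (hessEntry (densityConv f g) i j z ^ 2 * densityConv f g z)
      = ∫⁻ z, ∑ i : Fin n, ∑ j : Fin n, ENNReal.ofReal
        (hessEntry (densityConv f g) i j z ^ 2 * densityConv f g z) := by
        rw [lintegral_finsetSum _ fun i _ => Finset.measurable_sum _ fun j _ => mk i j]
        exact Finset.sum_congr rfl fun i _ => (lintegral_finsetSum _ fun j _ => mk i j).symm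
    _ ≤ ∫⁻ z, ∑ i : Fin n, ∑ j : Fin n, ∫⁻ y, ENNReal.ofReal (Q i j (z - y, y)) :=
        lintegral_mono fun z => hf.ofReal_sq_hessLog_densityConv_le hg hab z
    _ = ∑ i : Fin n, ∑ j : Fin n, ∫⁻ z, ∫⁻ y, ENNReal.ofReal (Q i j (z - y, y)) := by
        rw [lintegral_finsetSum _ fun i _ => Finset.measurable_sum _ fun j _ => mL i j]
        exact Finset.sum_congr rfl fun i _ => lintegral_finsetSum _ fun j _ => mL i j
    _ = ENNReal.ofReal (∑ i : Fin n, ∑ j : Fin n, ∫ p, Q i j p ∂(volume.prod volume)) := by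
        rw [ENNReal.ofReal_sum_of_nonneg fun i _ => Finset.sum_nonneg fun j _ =>
          integral_nonneg (Q0 i j)]
        refine Finset.sum_congr rfl fun i _ => ?_
        rw [ENNReal.ofReal_sum_of_nonneg fun j _ => integral_nonneg (Q0 i j)]
        exact Finset.sum_congr rfl fun j _ => step i j
    _ = _ := by
        congr 1
        simp only [hQ, (hf.integrable_sq_add_mul hg _ _ _ _).2, Finset.sum_add_distrib,
          ← Finset.mul_sum]
        unfold hessMass
        ring

theorem integral_densityConv (hf : IsRegularDensity f) (hg : IsRegularDensity g) :
    Integrable (densityConv f g) ∧ ∫ z, densityConv f g z = 1 := by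
  have h1 : densityConv f g = convolution g f (ContinuousLinearMap.mul ℝ ℝ) volume := rfl
  rw [h1]
  refine ⟨hg.integrable.integrable_convolution _ hf.integrable, ?_⟩
  rw [integral_convolution _ hg.integrable hf.integrable, hf.integral_eq_one, hg.integral_eq_one]
  simp

/-- The convolution of regular densities is a regular density. -/
theorem conv (hf : IsRegularDensity f) (hg : IsRegularDensity g) :
    IsRegularDensity (densityConv f g) where
  contDiff := hf.contDiff_densityConv hg
  logConcave := hf.isLogConcave_densityConv hg
  integrable := (hf.integral_densityConv hg).1
  integral_eq_one := (hf.integral_densityConv hg).2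
  fisherProduction_lt_top :=
    -- For finiteness the crude choice, which bounds `J` of the sum by `J(f)`, is enough.
    (hf.fisherProduction_densityConv_le hg (a := 1) (b := 0) (by norm_num)).trans_lt
      ENNReal.ofReal_lt_top

theorem hessMass_densityConv_le (hf : IsRegularDensity f) (hg : IsRegularDensity g)
    {a b : ℝ} (hab : a + b = 1) :
    hessMass (densityConv f g) ≤ a ^ 4 * hessMass f
      + 2 * a ^ 2 * b ^ 2 * (∑ i, ∑ j, hessMean f i j * hessMean g i j) + b ^ 4 * hessMass g := by
  have h1 := hf.fisherProduction_densityConv_le hg hab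
  rw [(hf.conv hg).fisherProduction_eq_hessMass] at h1
  by_contra hlt
  have := (ENNReal.ofReal_le_ofReal_iff' (p := hessMass (densityConv f g))).1 h1
  rcases this with h2 | h2
  · exact hlt h2
  -- `ENNReal.ofReal` would conceal a negative right-hand side; as a sum of integrals of squares it
  -- is nonnegative.
  · have h0 : ∀ i j : Fin n, 0 ≤ ∫ p : EuclideanSpace ℝ (Fin n) × EuclideanSpace ℝ (Fin n),
        (a ^ 2 * hessEntry f i j p.1 + b ^ 2 * hessEntry g i j p.2) ^ 2 * (f p.1 * g p.2)
        ∂(volume.prod volume) := fun i j =>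
      integral_nonneg fun _ => mul_nonneg (sq_nonneg _) (mul_nonneg (hf.nonneg _) (hg.nonneg _))
    have h3 := Finset.sum_nonneg fun i (_ : i ∈ Finset.univ) =>
      Finset.sum_nonneg fun j (_ : j ∈ Finset.univ) => h0 i j
    simp only [(hf.integrable_sq_add_mul hg _ _ _ _).2, Finset.sum_add_distrib,
      ← Finset.mul_sum] at h3
    refine hlt (h2.trans ?_)
    unfold hessMass
    linarith

/-- The deviation in the Cauchy–Schwarz inequality for the Hessians, as a double integral. -/
theorem sum_integral_sq_sub (hf : IsRegularDensity f) (hg : IsRegularDensity g) (s t : ℝ) :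
    ∑ i : Fin n, ∑ j : Fin n, ∫ p : EuclideanSpace ℝ (Fin n) × EuclideanSpace ℝ (Fin n),
        (s * hessEntry f i j p.1 + t * hessEntry g i j p.2) ^ 2 * (f p.1 * g p.2)
        ∂(volume.prod volume)
      = s ^ 2 * hessMass f + 2 * s * t * (∑ i, ∑ j, hessMean f i j * hessMean g i j)
        + t ^ 2 * hessMass g := by
  simp only [(hf.integrable_sq_add_mul hg _ _ _ _).2, Finset.sum_add_distrib, ← Finset.mul_sum]
  rfl

theorem sum_integral_sq_nonneg (hf : IsRegularDensity f) (hg : IsRegularDensity g) (s t : ℝ)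
    (i j : Fin n) : 0 ≤ ∫ p : EuclideanSpace ℝ (Fin n) × EuclideanSpace ℝ (Fin n),
        (s * hessEntry f i j p.1 + t * hessEntry g i j p.2) ^ 2 * (f p.1 * g p.2)
        ∂(volume.prod volume) :=
  integral_nonneg fun _ => mul_nonneg (sq_nonneg _) (mul_nonneg (hf.nonneg _) (hg.nonneg _))

end IsRegularDensity

end

/-! ### The inequality and its equality case -/

section

variable {n : ℕ} {f g : EuclideanSpace ℝ (Fin n) → ℝ}

theorem isOpen_setOf_pos_of_continuous (hf : Continuous f) : IsOpen {x | 0 < f x} :=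
  isOpen_lt continuous_const hf

theorem continuousOn_hessLog (hf : ContDiff ℝ 2 f) (h h' : EuclideanSpace ℝ (Fin n)) :
    ContinuousOn (fun x => hessLog f x h h') {x | 0 < f x} := by
  have h1 := hf.continuous
  have h2 := hf.continuous_fderiv_two
  have h3 := hf.continuous_fderiv_fderiv
  have h4 : Continuous fun x => fderiv ℝ (fderiv ℝ f) x h h' := by fun_prop
  have h5 : ∀ v, Continuous fun x => fderiv ℝ f x v := fun v => by fun_prop
  refine (h4.continuousOn.div h1.continuousOn fun x hx => ne_of_gt hx).sub
    (((h5 h).mul (h5 h')).continuousOn.div (h1.pow 2).continuousOn fun x hx => ?_)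
  exact pow_ne_zero 2 (ne_of_gt hx)

namespace IsRegularDensity

theorem exists_pos (hf : IsRegularDensity f) : ∃ x, 0 < f x := by
  by_contra! h
  have : ∀ x, f x = 0 := fun x => le_antisymm (h x) (hf.nonneg x)
  have h1 := hf.integral_eq_one
  simp [this] at h1

/-- The nonnegative deviation `∑ ∬ (D²ᵢⱼ log f / p - D²ᵢⱼ log g / q)² f g` equals `2 - 2 S / (p q)`.
-/
theorem sum_hessMean_mul_le (hf : IsRegularDensity f) (hg : IsRegularDensity g) (hn : 1 ≤ n) :
    ∑ i, ∑ j, hessMean f i j * hessMean g i j ≤ √(hessMass f) * √(hessMass g) := by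
  have hp : 0 < √(hessMass f) := Real.sqrt_pos.2 (hf.hessMass_pos hn)
  have hq : 0 < √(hessMass g) := Real.sqrt_pos.2 (hg.hessMass_pos hn)
  have h1 := hf.sum_integral_sq_sub hg (√(hessMass f))⁻¹ (-(√(hessMass g))⁻¹)
  have h2 := Finset.sum_nonneg fun i (_ : i ∈ Finset.univ) =>
    Finset.sum_nonneg fun j (_ : j ∈ Finset.univ) =>
      hf.sum_integral_sq_nonneg hg (√(hessMass f))⁻¹ (-(√(hessMass g))⁻¹) i j
  rw [h1] at h2
  have e1 : (√(hessMass f))⁻¹ ^ 2 * hessMass f = 1 := by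
    rw [inv_pow, Real.sq_sqrt hf.hessMass_nonneg, inv_mul_cancel₀ (hf.hessMass_pos hn).ne']
  have e2 : (-(√(hessMass g))⁻¹) ^ 2 * hessMass g = 1 := by
    rw [neg_sq, inv_pow, Real.sq_sqrt hg.hessMass_nonneg,
      inv_mul_cancel₀ (hg.hessMass_pos hn).ne']
  rw [e1, e2] at h2
  set S := ∑ i, ∑ j, hessMean f i j * hessMean g i j
  have h3 : (√(hessMass f))⁻¹ * (√(hessMass g))⁻¹ * S ≤ 1 := by linarith
  rw [← mul_inv, inv_mul_le_iff₀ (by positivity), mul_one] at h3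
  exact h3

/-- The weights `a = q/(p+q)`, `b = p/(p+q)` minimise `a² p + b² q` under `a + b = 1`. The mean
product is kept unestimated for the equality case. -/
theorem sqrt_hessMass_densityConv_sq_le (hf : IsRegularDensity f) (hg : IsRegularDensity g)
    (hn : 1 ≤ n) :
    √(hessMass (densityConv f g)) ^ 2 * (√(hessMass f) + √(hessMass g)) ^ 4 ≤
      √(hessMass f) ^ 2 * √(hessMass g) ^ 2 * (√(hessMass f) ^ 2 + √(hessMass g) ^ 2
        + 2 * ∑ i, ∑ j, hessMean f i j * hessMean g i j) := by
  have hp : 0 < √(hessMass f) := Real.sqrt_pos.2 (hf.hessMass_pos hn)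
  have hq : 0 < √(hessMass g) := Real.sqrt_pos.2 (hg.hessMass_pos hn)
  have h1 := hf.hessMass_densityConv_le hg
    (a := √(hessMass g) / (√(hessMass f) + √(hessMass g)))
    (b := √(hessMass f) / (√(hessMass f) + √(hessMass g))) (by field_simp; ring)
  rw [← Real.sq_sqrt (hf.conv hg).hessMass_nonneg, ← Real.sq_sqrt hf.hessMass_nonneg,
    ← Real.sq_sqrt hg.hessMass_nonneg] at h1
  simp only [Real.sqrt_sq hp.le, Real.sqrt_sq hq.le] at h1
  set p := √(hessMass f)
  set q := √(hessMass g)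
  set S := ∑ i, ∑ j, hessMean f i j * hessMean g i j
  refine (mul_le_mul_of_nonneg_right h1 (by positivity)).trans_eq ?_
  field_simp
  ring

theorem one_div_sqrt_add_le (hf : IsRegularDensity f) (hg : IsRegularDensity g) (hn : 1 ≤ n) :
    1 / √(hessMass f) + 1 / √(hessMass g) ≤ 1 / √(hessMass (densityConv f g)) := by
  have hp : 0 < √(hessMass f) := Real.sqrt_pos.2 (hf.hessMass_pos hn)
  have hq : 0 < √(hessMass g) := Real.sqrt_pos.2 (hg.hessMass_pos hn)
  have hr : 0 < √(hessMass (densityConv f g)) := Real.sqrt_pos.2 ((hf.conv hg).hessMass_pos hn)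
  have h1 := hf.sqrt_hessMass_densityConv_sq_le hg hn
  have h2 := hf.sum_hessMean_mul_le hg hn
  set p := √(hessMass f)
  set q := √(hessMass g)
  set r := √(hessMass (densityConv f g))
  set S := ∑ i, ∑ j, hessMean f i j * hessMean g i j
  have h3 : (r * (p + q) ^ 2) ^ 2 ≤ (p * q * (p + q)) ^ 2 := by
    calc (r * (p + q) ^ 2) ^ 2 = r ^ 2 * (p + q) ^ 4 := by ring
      _ ≤ p ^ 2 * q ^ 2 * (p ^ 2 + q ^ 2 + 2 * S) := h1
      _ ≤ p ^ 2 * q ^ 2 * (p ^ 2 + q ^ 2 + 2 * (p * q)) := by gcongr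
      _ = (p * q * (p + q)) ^ 2 := by ring
  have h4 := le_of_sq_le_sq h3 (by positivity)
  have h5 : r * (p + q) ≤ p * q := by
    refine le_of_mul_le_mul_right ?_ (show 0 < p + q by positivity)
    linarith
  rw [div_add_div _ _ hp.ne' hq.ne', div_le_div_iff₀ (by positivity) hr]
  linarith

theorem hessEntry_div_eq_of_eq (hf : IsRegularDensity f) (hg : IsRegularDensity g) (hn : 1 ≤ n)
    (heq : 1 / √(hessMass (densityConv f g)) = 1 / √(hessMass f) + 1 / √(hessMass g))
    {x y : EuclideanSpace ℝ (Fin n)} (hx : 0 < f x) (hy : 0 < g y) (i j : Fin n) :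
    hessEntry f i j x / √(hessMass f) = hessEntry g i j y / √(hessMass g) := by
  have hp : 0 < √(hessMass f) := Real.sqrt_pos.2 (hf.hessMass_pos hn)
  have hq : 0 < √(hessMass g) := Real.sqrt_pos.2 (hg.hessMass_pos hn)
  have hr : 0 < √(hessMass (densityConv f g)) := Real.sqrt_pos.2 ((hf.conv hg).hessMass_pos hn)
  have h1 := hf.sqrt_hessMass_densityConv_sq_le hg hn
  have h3 := hf.sum_integral_sq_sub hg (√(hessMass f))⁻¹ (-(√(hessMass g))⁻¹)
  have e1 : (√(hessMass f))⁻¹ ^ 2 * hessMass f = 1 := by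
    rw [inv_pow, Real.sq_sqrt hf.hessMass_nonneg, inv_mul_cancel₀ (hf.hessMass_pos hn).ne']
  have e2 : (-(√(hessMass g))⁻¹) ^ 2 * hessMass g = 1 := by
    rw [neg_sq, inv_pow, Real.sq_sqrt hg.hessMass_nonneg,
      inv_mul_cancel₀ (hg.hessMass_pos hn).ne']
  rw [e1, e2] at h3
  have h0 := hf.sum_integral_sq_nonneg hg (√(hessMass f))⁻¹ (-(√(hessMass g))⁻¹)
  set p := √(hessMass f)
  set q := √(hessMass g)
  set r := √(hessMass (densityConv f g))
  set S := ∑ i, ∑ j, hessMean f i j * hessMean g i j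
  have hr2 : r = p * q / (p + q) := by
    field_simp at heq ⊢
    linarith
  -- Equality turns the previous bound into the reverse Cauchy–Schwarz inequality, so the deviation
  -- integral must vanish.
  have hS : p * q ≤ S := by
    rw [hr2] at h1
    have e : (p * q / (p + q)) ^ 2 * (p + q) ^ 4 = p ^ 2 * q ^ 2 * (p + q) ^ 2 := by
      field_simp
    rw [e] at h1
    have := le_of_mul_le_mul_left h1 (by positivity)
    nlinarith
  have hS' : 1 ≤ p⁻¹ * q⁻¹ * S := by
    rw [← mul_inv, ← div_eq_inv_mul, le_div_iff₀ (by positivity), one_mul]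
    exact hS
  have hsum : ∑ i : Fin n, ∑ j : Fin n,
      ∫ z : EuclideanSpace ℝ (Fin n) × EuclideanSpace ℝ (Fin n),
        (p⁻¹ * hessEntry f i j z.1 + -q⁻¹ * hessEntry g i j z.2) ^ 2 * (f z.1 * g z.2)
        ∂(volume.prod volume) = 0 := by
    refine le_antisymm ?_ (Finset.sum_nonneg fun i _ => Finset.sum_nonneg fun j _ => h0 i j)
    rw [h3]
    linarith
  have hi := (Finset.sum_eq_zero_iff_of_nonneg
    (fun i _ => Finset.sum_nonneg fun j _ => h0 i j)).1 hsum i (Finset.mem_univ _)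
  have hij := (Finset.sum_eq_zero_iff_of_nonneg (fun j _ => h0 i j)).1 hi j (Finset.mem_univ _)
  rw [integral_eq_zero_iff_of_nonneg (fun z => mul_nonneg (sq_nonneg _)
    (mul_nonneg (hf.nonneg _) (hg.nonneg _))) (hf.integrable_sq_add_mul hg i j _ _).1] at hij
  have hU : IsOpen ({x | 0 < f x} ×ˢ {y | 0 < g y}) :=
    (isOpen_lt continuous_const hf.contDiff.continuous).prod
      (isOpen_lt continuous_const hg.contDiff.continuous)
  have c1 : ContinuousOn (fun z : EuclideanSpace ℝ (Fin n) × EuclideanSpace ℝ (Fin n) =>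
      hessEntry f i j z.1 / p) ({x | 0 < f x} ×ˢ {y | 0 < g y}) :=
    ((continuousOn_hessLog hf.contDiff _ _).comp continuousOn_fst fun z hz => hz.1).div_const _
  have c2 : ContinuousOn (fun z : EuclideanSpace ℝ (Fin n) × EuclideanSpace ℝ (Fin n) =>
      hessEntry g i j z.2 / q) ({x | 0 < f x} ×ˢ {y | 0 < g y}) :=
    ((continuousOn_hessLog hg.contDiff _ _).comp continuousOn_snd fun z hz => hz.2).div_const _
  -- The vanishing integral gives the identity almost everywhere on an open product set; continuity
  -- there gives it everywhere.
  have hae : (fun z : EuclideanSpace ℝ (Fin n) × EuclideanSpace ℝ (Fin n) => hessEntry f i j z.1 / p)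
      =ᵐ[(volume.prod volume).restrict ({x | 0 < f x} ×ˢ {y | 0 < g y})]
      fun z => hessEntry g i j z.2 / q := by
    refine (ae_restrict_iff' hU.measurableSet).2 ?_
    filter_upwards [hij] with z hz hzU
    have hz' : (p⁻¹ * hessEntry f i j z.1 + -q⁻¹ * hessEntry g i j z.2) ^ 2
        * (f z.1 * g z.2) = 0 := hz
    have hfg : f z.1 * g z.2 ≠ 0 := (mul_pos hzU.1 hzU.2).ne'
    have h5 : p⁻¹ * hessEntry f i j z.1 + -q⁻¹ * hessEntry g i j z.2 = 0 := by
      simpa [hfg] using hz'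
    rw [div_eq_inv_mul, div_eq_inv_mul]
    linarith
  exact Measure.eqOn_open_of_ae_eq hae hU c1 c2 (show (x, y) ∈ _ from ⟨hx, hy⟩)

end IsRegularDensity

/-- Factor `M = Sᴴ S`; strict positivity makes `S` injective, hence invertible. -/
theorem Matrix.PosSemidef.exists_norm_sq_eq {M : Matrix (Fin n) (Fin n) ℝ} (hM : M.PosSemidef)
    (hpos : ∀ h : EuclideanSpace ℝ (Fin n), h ≠ 0 → 0 < ∑ i, ∑ j, h i * h j * M i j) :
    ∃ T : EuclideanSpace ℝ (Fin n) ≃L[ℝ] EuclideanSpace ℝ (Fin n),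
      ∀ h, ‖T h‖ ^ 2 = ∑ i, ∑ j, h i * h j * M i j := by
  obtain ⟨S, rfl⟩ := hM.exists_eq_conjTranspose_mul_self
  have key : ∀ h : EuclideanSpace ℝ (Fin n), ‖Matrix.toEuclideanLin S h‖ ^ 2
      = ∑ i, ∑ j, h i * h j * (S.conjTranspose * S) i j := by
    intro h
    rw [EuclideanSpace.norm_sq_eq]
    have e : ∀ i, Matrix.toEuclideanLin S h i = ∑ j, S i j * h j := fun i => rfl
    have e2 : ∀ k, ‖Matrix.toEuclideanLin S h k‖ ^ 2
        = ∑ i, ∑ j, (S k i * h i) * (S k j * h j) := fun k => by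
      rw [e, Real.norm_eq_abs, sq_abs, sq, Finset.sum_mul_sum]
    rw [Finset.sum_congr rfl fun k _ => e2 k, Finset.sum_comm]
    refine Finset.sum_congr rfl fun i _ => ?_
    rw [Finset.sum_comm]
    refine Finset.sum_congr rfl fun j _ => ?_
    rw [Matrix.mul_apply, Finset.mul_sum]
    refine Finset.sum_congr rfl fun k _ => ?_
    rw [Matrix.conjTranspose_apply, star_trivial]
    ring
  have hinj : Function.Injective (Matrix.toEuclideanLin S) := by
    rw [injective_iff_map_eq_zero]
    intro h hh
    by_contra hne
    have h1 := key h
    rw [hh, norm_zero, zero_pow two_ne_zero] at h1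
    exact (hpos h hne).ne h1
  refine ⟨(LinearEquiv.ofInjectiveEndo _ hinj).toContinuousLinearEquiv, fun h => ?_⟩
  rw [← key h]
  rfl

namespace IsRegularDensity

/-- If equality holds, then the Hessians of the logarithms of both densities are constant multiples
of one and the same negative definite quadratic form. -/
theorem exists_hessLog_eq_of_eq (hf : IsRegularDensity f) (hg : IsRegularDensity g) (hn : 1 ≤ n)
    (heq : 1 / √(hessMass (densityConv f g)) = 1 / √(hessMass f) + 1 / √(hessMass g)) :
    ∃ T : EuclideanSpace ℝ (Fin n) ≃L[ℝ] EuclideanSpace ℝ (Fin n), ∃ p q : ℝ, 0 < p ∧ 0 < q ∧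
      (∀ x h, 0 < f x → hessLog f x h h = -(p * ‖T h‖) ^ 2) ∧
      ∀ x h, 0 < g x → hessLog g x h h = -(q * ‖T h‖) ^ 2 := by
  have hp : 0 < √(hessMass f) := Real.sqrt_pos.2 (hf.hessMass_pos hn)
  have hq : 0 < √(hessMass g) := Real.sqrt_pos.2 (hg.hessMass_pos hn)
  have key := fun {x y : EuclideanSpace ℝ (Fin n)} (hx : 0 < f x) (hy : 0 < g y) (i j : Fin n) =>
    hf.hessEntry_div_eq_of_eq hg hn heq hx hy i j
  obtain ⟨x0, hx0⟩ := hf.exists_pos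
  obtain ⟨y0, hy0⟩ := hg.exists_pos
  set p := √(hessMass f)
  set q := √(hessMass g)
  -- By `key` this is also the normalised Hessian of `-log g` at every point where `g > 0`, so
  -- neither Hessian varies.
  set M : Matrix (Fin n) (Fin n) ℝ := Matrix.of fun i j => -(hessEntry f i j x0 / p) with hM
  have e1 : ∀ x h, 0 < f x → hessLog f x h h = -(p * ∑ i, ∑ j, h i * h j * M i j) := by
    intro x h hx
    rw [hessLog_eq_sum]
    simp only [Finset.mul_sum, ← Finset.sum_neg_distrib]
    refine Finset.sum_congr rfl fun i _ => Finset.sum_congr rfl fun j _ => ?_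
    have h1 := (key hx hy0 i j).trans (key hx0 hy0 i j).symm
    rw [hM, Matrix.of_apply, ← h1]
    simp only [hessEntry]
    field_simp
  have e2 : ∀ y h, 0 < g y → hessLog g y h h = -(q * ∑ i, ∑ j, h i * h j * M i j) := by
    intro y h hy
    rw [hessLog_eq_sum]
    simp only [Finset.mul_sum, ← Finset.sum_neg_distrib]
    refine Finset.sum_congr rfl fun i _ => Finset.sum_congr rfl fun j _ => ?_
    have h1 := key hx0 hy i j
    rw [hM, Matrix.of_apply, h1]
    simp only [hessEntry]
    field_simp
  have hpos : ∀ h : EuclideanSpace ℝ (Fin n), h ≠ 0 → 0 < ∑ i, ∑ j, h i * h j * M i j := by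
    intro h hh
    have h1 := hf.integral_neg_hessLog_mul_pos hh
    have h2 : ∀ x, -hessLog f x h h * f x = (p * ∑ i, ∑ j, h i * h j * M i j) * f x := by
      intro x
      rcases (hf.nonneg x).eq_or_lt with h0 | h0
      · rw [← h0]; simp
      · rw [e1 x h h0, neg_neg]
    simp only [h2] at h1
    rw [integral_const_mul, hf.integral_eq_one, mul_one] at h1
    exact pos_of_mul_pos_right h1 hp.le
  have hMp : M.PosSemidef := by
    refine Matrix.PosSemidef.of_dotProduct_mulVec_nonneg ?_ fun x => ?_
    · ext i j
      simp only [hM, Matrix.conjTranspose_apply, Matrix.of_apply, star_trivial, hessEntry]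
      rw [hessLog_comm hf.contDiff]
    · have h1 : 0 ≤ ∑ i, ∑ j, x i * x j * M i j := by
        by_cases hx : WithLp.toLp 2 x = 0
        · have : x = 0 := by simpa using hx
          simp [this]
        · exact (hpos _ hx).le
      simp only [dotProduct, Matrix.mulVec, star_trivial, Finset.mul_sum]
      refine h1.trans_eq (Finset.sum_congr rfl fun i _ => Finset.sum_congr rfl fun j _ => ?_)
      ring
  obtain ⟨T, hT⟩ := hMp.exists_norm_sq_eq hpos
  -- Square roots because the scalars enter the conclusion squared.
  refine ⟨T, √p, √q, Real.sqrt_pos.2 hp, Real.sqrt_pos.2 hq, fun x h hx => ?_, fun x h hx => ?_⟩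
  · rw [e1 x h hx, mul_pow, Real.sq_sqrt hp.le, hT]
  · rw [e2 x h hx, mul_pow, Real.sq_sqrt hq.le, hT]

end IsRegularDensity

end

/-! ### Log-concave functions with constant logarithmic Hessian -/

section Quadratic

variable {n : ℕ} {f : EuclideanSpace ℝ (Fin n) → ℝ}

/-- Second-order Taylor expansion without remainder: first the derivative corrected by `t a`, then
`log f` corrected by its quadratic, has zero derivative on the segment. -/
theorem log_eq_of_hessLog_segment (hf : ContDiff ℝ 2 f) {x v : EuclideanSpace ℝ (Fin n)} {a : ℝ}
    (hpos : ∀ t ∈ Set.Icc (0 : ℝ) 1, 0 < f (x + t • v))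
    (hess : ∀ t ∈ Set.Icc (0 : ℝ) 1, hessLog f (x + t • v) v v = -a) :
    Real.log (f (x + v)) = Real.log (f x) + fderiv ℝ f x v / f x - a / 2 := by
  have hl (t : ℝ) : HasDerivAt (fun t : ℝ => x + t • v) v t := by
    have := ((hasDerivAt_id t).smul_const v).const_add x
    rw [one_smul] at this
    exact this
  have hd (t : ℝ) (ht : t ∈ Set.Icc (0 : ℝ) 1) :
      HasDerivAt (fun t : ℝ => fderiv ℝ f (x + t • v) v / f (x + t • v) + t * a) 0 t := by
    have h := (hasFDerivAt_fderiv_log hf (hpos t ht).ne' v).comp_hasDerivAt t (hl t)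
    rw [fderiv_fderiv_log_apply (hpos t ht).ne', hess t ht] at h
    have h2 := h.add ((hasDerivAt_id t).mul_const a)
    rw [one_mul, neg_add_cancel] at h2
    exact h2
  have h1 : ∀ t ∈ Set.Icc (0 : ℝ) 1,
      fderiv ℝ f (x + t • v) v / f (x + t • v) + t * a = fderiv ℝ f x v / f x := by
    intro t ht
    have := constant_of_has_deriv_right_zero (a := 0) (b := 1)
      (fun t ht => (hd t ht).continuousAt.continuousWithinAt)
      (fun t ht => (hd t (Set.Ico_subset_Icc_self ht)).hasDerivWithinAt) t ht
    simpa using! this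
  have hd2 (t : ℝ) (ht : t ∈ Set.Icc (0 : ℝ) 1) :
      HasDerivAt (fun t : ℝ => Real.log (f (x + t • v)) - t * (fderiv ℝ f x v / f x)
        + t ^ 2 * (a / 2)) 0 t := by
    have h := (((hf.differentiable (by norm_num)) _).hasFDerivAt.comp_hasDerivAt t (hl t)).log
      (hpos t ht).ne'
    have h2 := (h.sub ((hasDerivAt_id t).mul_const (fderiv ℝ f x v / f x))).add
      ((hasDerivAt_pow 2 t).mul_const (a / 2))
    refine h2.congr_deriv ?_
    have := h1 t ht
    simp only [Function.comp_apply] at this ⊢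
    rw [← this]
    push_cast
    ring
  have := constant_of_has_deriv_right_zero (a := 0) (b := 1)
      (fun t ht => (hd2 t ht).continuousAt.continuousWithinAt)
      (fun t ht => (hd2 t (Set.Ico_subset_Icc_self ht)).hasDerivWithinAt) 1 (by simp)
  simp at this
  linarith

theorem IsLogConcave.exists_eq_exp_of_hessLog (hlc : IsLogConcave f) (hf : ContDiff ℝ 2 f)
    (hpos : ∃ x, 0 < f x)
    (T : EuclideanSpace ℝ (Fin n) ≃L[ℝ] EuclideanSpace ℝ (Fin n))
    (hess : ∀ x h, 0 < f x → hessLog f x h h = -‖T h‖ ^ 2) :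
    ∃ m c, 0 < c ∧ ∀ x, f x = c * Real.exp (-(1 / 2) * ‖T (x - m)‖ ^ 2) := by
  obtain ⟨x₀, hx₀⟩ := hpos
  set l : EuclideanSpace ℝ (Fin n) →L[ℝ] ℝ := (f x₀)⁻¹ • fderiv ℝ f x₀ with hl
  have hU (x) (hx : 0 < f x) :
      f x = Real.exp (Real.log (f x₀) + l (x - x₀) - ‖T (x - x₀)‖ ^ 2 / 2) := by
    have hp (t : ℝ) (ht : t ∈ Set.Icc (0 : ℝ) 1) : 0 < f (x₀ + t • (x - x₀)) :=
      hlc.concaveOn_log.1.add_smul_sub_mem (x := x₀) (y := x) hx₀ hx ht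
    have := log_eq_of_hessLog_segment hf hp (a := ‖T (x - x₀)‖ ^ 2)
      (fun t ht => hess _ _ (hp t ht))
    rw [add_sub_cancel] at this
    rw [hl, smul_apply, smul_eq_mul, inv_mul_eq_div, ← this, Real.exp_log hx]
  -- The exponential formula extends by continuity to the closure of `{f > 0}` and is positive
  -- there, so this open set is also closed.
  have huniv : {x | 0 < f x} = Set.univ := by
    refine IsClopen.eq_univ ⟨?_, isOpen_setOf_pos_of_continuous hf.continuous⟩ ⟨x₀, hx₀⟩
    refine isClosed_of_closure_subset fun x hx => ?_
    have hcl : IsClosed {x | f x =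
        Real.exp (Real.log (f x₀) + l (x - x₀) - ‖T (x - x₀)‖ ^ 2 / 2)} :=
      isClosed_eq hf.continuous (by fun_prop)
    have : f x = _ := closure_minimal (fun y hy => hU y hy) hcl hx
    show 0 < f x
    rw [this]
    positivity
  -- Completing the square: `w` represents the linear term in the coordinates given by `T`.
  obtain ⟨w, hw⟩ : ∃ w : EuclideanSpace ℝ (Fin n), ∀ y, inner ℝ w (T y) = l y := by
    refine ⟨(InnerProductSpace.toDual ℝ _).symm (l.comp (T.symm : _ →L[ℝ] _)), fun y => ?_⟩
    simp
  refine ⟨x₀ + T.symm w, Real.exp (Real.log (f x₀) + ‖w‖ ^ 2 / 2), by positivity, fun x => ?_⟩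
  have hx : 0 < f x := by
    have : x ∈ {x | 0 < f x} := huniv ▸ Set.mem_univ x
    exact this
  have h1 : T (x - (x₀ + T.symm w)) = T (x - x₀) - w := by
    rw [← sub_sub, map_sub, T.apply_symm_apply]
  rw [hU x hx, ← Real.exp_add, h1, norm_sub_sq_real, real_inner_comm, hw]
  congr 1
  ring

end Quadratic

/-! ### Gaussian laws and their covariances -/

section GaussianLaw

variable {E : Type*} [NormedAddCommGroup E] [InnerProductSpace ℝ E] [FiniteDimensional ℝ E]
  [MeasurableSpace E] [BorelSpace E]

/-- The characteristic function is a constant times `exp (-‖t‖²/2)`. The constant, which hides `c`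
and the Jacobian of `T`, is read off at `t = 0`. -/
theorem map_withDensity_exp_neg_norm_sq_eq_stdGaussian (T : E ≃L[ℝ] E) (m : E) {c : ℝ} (hc : 0 ≤ c)
    {μ : Measure E} [IsProbabilityMeasure μ]
    (hμ : μ = volume.withDensity
      (fun x => ENNReal.ofReal (c * Real.exp (-(1 / 2) * ‖T (x - m)‖ ^ 2)))) :
    μ.map (fun x => T (x - m)) = stdGaussian E := by
  have hmeas : Measurable fun x => T (x - m) := by fun_prop
  have : IsProbabilityMeasure (μ.map (fun x => T (x - m))) :=
    Measure.isProbabilityMeasure_map hmeas.aemeasurable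
  have hT : (volume.map T : Measure E).IsAddHaarMeasure := T.isAddHaarMeasure_map volume
  obtain ⟨C, hC⟩ : ∃ C : ℝ, ∀ G : E → ℂ, Continuous G → ∫ x, G (T x) = C * ∫ y, G y := by
    refine ⟨(Measure.addHaarScalarFactor (volume.map T) (volume : Measure E) : ℝ), fun G hG => ?_⟩
    have h := integral_map (μ := (volume : Measure E)) T.continuous.measurable.aemeasurable
      (f := G) hG.aestronglyMeasurable
    rw [← h]
    conv_lhs => rw [Measure.isAddLeftInvariant_eq_smul (volume.map T) (volume : Measure E)]
    rw [integral_smul_nnreal_measure, NNReal.smul_def, Complex.real_smul]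
  have key (t : E) : charFun (μ.map (fun x => T (x - m))) t
      = (C * c * (2 * Real.pi) ^ (Module.finrank ℝ E / 2 : ℂ)) * Complex.exp (-‖t‖ ^ 2 / 2) := by
    rw [charFun_apply, integral_map hmeas.aemeasurable (by fun_prop), hμ,
      integral_withDensity_eq_integral_toReal_smul (by fun_prop) (by simp)]
    set G : E → ℂ := fun y => c * Complex.exp (-(1 / 2 : ℂ) * ‖y‖ ^ 2 + Complex.I * inner ℝ t y)
      with hG
    have h1 : ∀ x, (ENNReal.ofReal (c * Real.exp (-(1 / 2) * ‖T (x - m)‖ ^ 2))).toReal •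
        Complex.exp (inner ℝ (T (x - m)) t * Complex.I) = G (T (x - m)) := by
      intro x
      simp only [hG]
      rw [ENNReal.toReal_ofReal (by positivity), Complex.real_smul, Complex.exp_add,
        real_inner_comm, mul_comm Complex.I]
      push_cast
      ring
    simp_rw [h1]
    rw [integral_sub_right_eq_self (fun x => G (T x)), hC G (by fun_prop), hG, integral_const_mul,
      GaussianFourier.integral_cexp_neg_mul_sq_norm_add (by norm_num)]
    rw [Complex.I_sq]
    have : (Real.pi / (1 / 2) : ℂ) = 2 * Real.pi := by ring
    rw [this]
    ring_nf
  have h0 := key 0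
  rw [charFun_zero, probReal_univ, norm_zero] at h0
  simp only [Complex.ofReal_one, Complex.ofReal_zero, ne_eq, OfNat.ofNat_ne_zero, not_false_eq_true,
    zero_pow, neg_zero, zero_div, Complex.exp_zero, mul_one] at h0
  refine Measure.ext_of_charFun ?_
  ext t
  rw [key t, charFun_stdGaussian, ← h0, one_mul]

end GaussianLaw

section Covariance

variable {n : ℕ} {Ω : Type*} [MeasurableSpace Ω] {P : Measure Ω} [IsProbabilityMeasure P]
  {X : Ω → EuclideanSpace ℝ (Fin n)} {f : EuclideanSpace ℝ (Fin n) → ℝ}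

/-- A regular log-concave density whose logarithm has the constant Hessian `-p² ⟪T h, T h⟫` is
Gaussian, with covariance matrix `p⁻² (Tᵀ T)⁻¹`. -/
theorem HasDensity.hasGaussianLaw_of_hessLog (hX : HasDensity X f P) (hlc : IsLogConcave f)
    (hf : ContDiff ℝ 2 f) (hpos : ∃ x, 0 < f x)
    (T : EuclideanSpace ℝ (Fin n) ≃L[ℝ] EuclideanSpace ℝ (Fin n)) {p : ℝ} (hp : 0 < p)
    (hess : ∀ x h, 0 < f x → hessLog f x h h = -(p * ‖T h‖) ^ 2) :
    HasGaussianLaw X P ∧ ∀ i j : Fin n, cov[fun ω => X ω i, fun ω => X ω j; P]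
      = (p ^ 2)⁻¹ * cov[fun z => T.symm z i, fun z => T.symm z j;
          stdGaussian (EuclideanSpace ℝ (Fin n))] := by
  set S : EuclideanSpace ℝ (Fin n) ≃L[ℝ] EuclideanSpace ℝ (Fin n) :=
    T.trans (ContinuousLinearEquiv.smulLeft (Units.mk0 p hp.ne')) with hS
  have hSapp (x) : S x = p • T x := rfl
  obtain ⟨m, c, hc, hfc⟩ := hlc.exists_eq_exp_of_hessLog hf hpos S (fun x h hx => by
    rw [hess x h hx, hSapp, norm_smul, Real.norm_of_nonneg hp.le])
  have : IsProbabilityMeasure (P.map X) := Measure.isProbabilityMeasure_map hX.aemeasurable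
  have hlaw := map_withDensity_exp_neg_norm_sq_eq_stdGaussian S m hc.le (μ := P.map X)
    (by rw [hX.map_eq]; simp_rw [hfc])
  have hlaw' : P.map X = ((stdGaussian (EuclideanSpace ℝ (Fin n))).map S.symm).map (fun x => m + x) := by
    rw [← hlaw, Measure.map_map (by fun_prop) (by fun_prop),
      Measure.map_map (by fun_prop) (by fun_prop)]
    convert Measure.map_id.symm
    ext x
    simp
  refine ⟨⟨hlaw' ▸ inferInstance⟩, fun i j => ?_⟩
  have hSsymm (z) : S.symm z = p⁻¹ • T.symm z := by
    apply S.injective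
    rw [S.apply_symm_apply, hSapp, map_smul, T.apply_symm_apply, smul_smul,
      mul_inv_cancel₀ hp.ne', one_smul]
  have hcoord (i : Fin n) : Integrable (fun z : EuclideanSpace ℝ (Fin n) => p⁻¹ * T.symm z i) (stdGaussian (EuclideanSpace ℝ (Fin n))) := by
    refine Integrable.const_mul ?_ _
    exact IsGaussian.integrable_dual (stdGaussian (EuclideanSpace ℝ (Fin n)))
      ((EuclideanSpace.proj i).comp (T.symm : _ →L[ℝ] _))
  rw [← covariance_map_fun (X := fun x : EuclideanSpace ℝ (Fin n) => x i) (Y := fun x : EuclideanSpace ℝ (Fin n) => x j) (by fun_prop)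
    (by fun_prop) hX.aemeasurable, hlaw', Measure.map_map (by fun_prop) (by fun_prop),
    covariance_map_fun (by fun_prop) (by fun_prop) (by fun_prop)]
  simp only [Function.comp_apply, hSsymm, PiLp.add_apply, PiLp.smul_apply, smul_eq_mul]
  rw [covariance_const_add_left (hcoord i), covariance_const_add_right (hcoord j),
    covariance_const_mul_left, covariance_const_mul_right]
  field_simp

end Covariance

/-! ### Dilations and the Gaussian equality case -/

section Scaling

theorem fderiv_smul_comp_inv_smul_sub {E F : Type*} [NormedAddCommGroup E] [NormedSpace ℝ E]
    [NormedAddCommGroup F] [NormedSpace ℝ F] {u : E → F} (hu : Differentiable ℝ u) (b s : ℝ)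
    (t : E) :
    fderiv ℝ (fun y => b • u (s⁻¹ • (y - t))) =
      fun y => (b * s⁻¹) • fderiv ℝ u (s⁻¹ • (y - t)) := by
  ext1 y
  have h1 : HasFDerivAt (fun y : E => s⁻¹ • (y - t)) (s⁻¹ • ContinuousLinearMap.id ℝ E) y :=
    ((hasFDerivAt_id y).sub_const t).const_smul s⁻¹
  have h2 := ((hu (s⁻¹ • (y - t))).hasFDerivAt.comp y h1).const_smul b
  rw [ContinuousLinearMap.comp_smul, ContinuousLinearMap.comp_id, smul_smul] at h2
  exact h2.fderiv

variable {n : ℕ} {f : EuclideanSpace ℝ (Fin n) → ℝ}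

theorem hessLog_smul_comp_inv_smul_sub (hf : ContDiff ℝ 2 f) {a : ℝ} (ha : a ≠ 0) (s : ℝ)
    (t y h h' : EuclideanSpace ℝ (Fin n)) :
    hessLog (fun y => a • f (s⁻¹ • (y - t))) y h h' =
      (s⁻¹) ^ 2 * hessLog f (s⁻¹ • (y - t)) h h' := by
  have h2 : Differentiable ℝ (fderiv ℝ f) := hf.contDiff_fderiv_two.differentiable (by norm_num)
  unfold hessLog
  rw [fderiv_smul_comp_inv_smul_sub (hf.differentiable (by norm_num)),
    fderiv_smul_comp_inv_smul_sub h2]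
  simp only [smul_apply, smul_eq_mul]
  by_cases h0 : f (s⁻¹ • (y - t)) = 0
  · simp [h0]
  · field_simp

/-- The Hessian of the logarithm scales by `s⁻²` and enters squared; the factor `s⁻ⁿ` is absorbed by
the change of variables. -/
theorem hessMass_smul_comp_inv_smul_sub (hf : ContDiff ℝ 2 f) {s : ℝ} (hs : 0 < s)
    (t : EuclideanSpace ℝ (Fin n)) :
    hessMass (fun y => (s ^ n)⁻¹ • f (s⁻¹ • (y - t))) = (s ^ 4)⁻¹ * hessMass f := by
  have ha : (s ^ n)⁻¹ ≠ 0 := by positivity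
  unfold hessMass
  rw [Finset.mul_sum]
  refine Finset.sum_congr rfl fun i _ => ?_
  rw [Finset.mul_sum]
  refine Finset.sum_congr rfl fun j _ => ?_
  unfold hessEntry
  simp_rw [hessLog_smul_comp_inv_smul_sub hf ha]
  set G : EuclideanSpace ℝ (Fin n) → ℝ := fun x =>
    hessLog f x (EuclideanSpace.single i 1) (EuclideanSpace.single j 1) ^ 2 * f x with hG
  have h1 : ∀ y, (s⁻¹ ^ 2 * hessLog f (s⁻¹ • (y - t)) (EuclideanSpace.single i 1)
      (EuclideanSpace.single j 1)) ^ 2 * (s ^ n)⁻¹ • f (s⁻¹ • (y - t))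
      = (s ^ 4)⁻¹ * (s ^ n)⁻¹ * G (s⁻¹ • (y - t)) := by
    intro y
    rw [hG, smul_eq_mul]
    field_simp
  simp_rw [h1]
  rw [integral_const_mul, integral_sub_right_eq_self (fun y => G (s⁻¹ • y)),
    Measure.integral_comp_inv_smul, finrank_euclideanSpace_fin, abs_of_pos (by positivity),
    smul_eq_mul]
  field_simp

variable {Ω : Type*} [MeasurableSpace Ω] {P : Measure Ω} [IsProbabilityMeasure P]
  {X Y : Ω → EuclideanSpace ℝ (Fin n)} {g : EuclideanSpace ℝ (Fin n) → ℝ}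

/-- Laws determine densities almost everywhere, and continuity removes the exceptional set. -/
theorem HasDensity.eq_of_map_eq (hX : HasDensity X f P) (hY : HasDensity Y g P)
    (hf : Continuous f) (hg : Continuous g) {s : ℝ} (hs : 0 < s) {t : EuclideanSpace ℝ (Fin n)}
    (h : P.map Y = (P.map X).map (fun x => t + s • x)) :
    g = fun y => (s ^ n)⁻¹ • f (s⁻¹ • (y - t)) := by
  have hY1 : IsProbabilityMeasure (P.map Y) := Measure.isProbabilityMeasure_map hY.aemeasurable
  have hm : Measurable fun x : EuclideanSpace ℝ (Fin n) => t + s • x := by fun_prop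
  have hfm := hf.measurable
  have h1 : P.map Y = volume.withDensity
      (fun y => ENNReal.ofReal ((s ^ n)⁻¹ • f (s⁻¹ • (y - t)))) := by
    ext B hB
    rw [h, Measure.map_apply hm hB, hX.map_eq, withDensity_apply _ (hm hB),
      withDensity_apply _ hB, ← lintegral_indicator (hm hB), ← lintegral_indicator hB]
    set H : EuclideanSpace ℝ (Fin n) → ℝ≥0∞ :=
      B.indicator fun y => ENNReal.ofReal (f (s⁻¹ • (y - t))) with hH
    have hHm : Measurable H := by
      refine Measurable.indicator ?_ hB
      fun_prop
    have e1 : ∀ x, ((fun x => t + s • x) ⁻¹' B).indicator (fun x => ENNReal.ofReal (f x)) x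
        = H (t + s • x) := by
      intro x
      simp only [hH, Set.indicator, add_sub_cancel_left, inv_smul_smul₀ hs.ne']
      rfl
    have e2 : ∀ y, B.indicator (fun y => ENNReal.ofReal ((s ^ n)⁻¹ • f (s⁻¹ • (y - t)))) y
        = ENNReal.ofReal ((s ^ n)⁻¹) * H y := by
      intro y
      by_cases hy : y ∈ B
      · simp only [hH, Set.indicator_of_mem hy, smul_eq_mul]
        rw [ENNReal.ofReal_mul (by positivity)]
      · simp [hH, hy]
    simp_rw [e1, e2]
    rw [lintegral_const_mul _ hHm, ← lintegral_map (f := fun x => H (t + x)) (by fun_prop)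
      (measurable_const_smul s), Measure.map_addHaar_smul _ hs.ne', lintegral_smul_measure,
      lintegral_add_left_eq_self, finrank_euclideanSpace_fin, abs_of_pos (by positivity),
      smul_eq_mul]
  rw [hY.map_eq] at h1
  have hg1 : ∫⁻ y, ENNReal.ofReal (g y) ≠ ⊤ := by
    rw [← setLIntegral_univ, ← withDensity_apply _ .univ, ← hY.map_eq]
    exact measure_ne_top _ _
  have h2 := (withDensity_eq_iff (by fun_prop) (by fun_prop) hg1).1 h1
  refine (Continuous.ae_eq_iff_eq volume hg (by fun_prop)).1 ?_
  filter_upwards [h2] with y hy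
  exact (ENNReal.ofReal_eq_ofReal_iff (hY.nonneg y)
    (smul_nonneg (by positivity) (hX.nonneg _))).1 hy

/-- A Gaussian law is determined by mean and covariance; the translation `t` matches the means. -/
theorem ProbabilityTheory.HasGaussianLaw.exists_map_eq_of_covariance_eq (hX : HasGaussianLaw X P)
    (hY : HasGaussianLaw Y P) {s : ℝ}
    (hcov : ∀ i j, cov[fun ω => Y ω i, fun ω => Y ω j; P]
      = s ^ 2 * cov[fun ω => X ω i, fun ω => X ω j; P]) :
    ∃ t, P.map Y = (P.map X).map (fun x => t + s • x) := by
  set t := P[Y] - s • P[X] with ht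
  refine ⟨t, ?_⟩
  have hXm := hX.aemeasurable
  have hYm := hY.aemeasurable
  have := hX.isGaussian_map
  have := hY.isGaussian_map
  have hmap : (P.map X).map (fun x => t + s • x) = P.map (fun ω => t + s • X ω) := by
    rw [AEMeasurable.map_map_of_aemeasurable (by fun_prop) hXm]
    rfl
  have hG : IsGaussian (P.map (fun ω => t + s • X ω)) := by
    have h1 := (hX.fun_smul s).isGaussian_map
    have h2 : P.map (fun ω => t + s • X ω) = (P.map (fun ω => s • X ω)).map (fun x => t + x) := by
      rw [AEMeasurable.map_map_of_aemeasurable (by fun_prop) (by fun_prop)]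
      rfl
    rw [h2]
    infer_instance
  rw [hmap]
  have hXL (i : Fin n) : MemLp (fun ω => X ω i) 2 P :=
    (hX.map_fun (EuclideanSpace.proj i)).memLp_two
  have hYL (i : Fin n) : MemLp (fun ω => Y ω i) 2 P :=
    (hY.map_fun (EuclideanSpace.proj i)).memLp_two
  have hsL (i : Fin n) : MemLp (fun ω => s * X ω i) 2 P := (hXL i).const_mul s
  refine IsGaussian.ext ?_ ?_
  · rw [integral_map hYm (by fun_prop), integral_map (by fun_prop) (by fun_prop)]
    simp only [id_eq]
    rw [integral_add (g := fun ω => s • X ω) (integrable_const _) (hX.integrable.smul s), integral_const, integral_smul,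
      probReal_univ, one_smul, ht, sub_add_cancel]
  · ext x y
    have e1 := covarianceBilin_apply_pi (X := fun i ω => Y ω i) hYL x y
    have e2 := covarianceBilin_apply_pi (X := fun i ω => t i + s * X ω i)
      (fun i => (memLp_const (t i)).add (hsL i)) x y
    refine e1.trans (Eq.trans ?_ e2.symm)
    refine Finset.sum_congr rfl fun i _ => Finset.sum_congr rfl fun j _ => ?_
    rw [covariance_const_add_left ((hsL i).integrable (by norm_num)),
      covariance_const_add_right ((hsL j).integrable (by norm_num)), covariance_const_mul_left,
      covariance_const_mul_right, hcov]
    ring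

theorem HasDensity.hessMass_eq_of_covariance_eq (hX : HasDensity X f P) (hY : HasDensity Y g P)
    (hf : ContDiff ℝ 2 f) (hg : Continuous g) (hXG : HasGaussianLaw X P)
    (hYG : HasGaussianLaw Y P) {c : ℝ} (hc : 0 < c)
    (hcov : ∀ i j, cov[fun ω => Y ω i, fun ω => Y ω j; P]
      = c * cov[fun ω => X ω i, fun ω => X ω j; P]) :
    hessMass g = (c ^ 2)⁻¹ * hessMass f := by
  have hs : 0 < √c := Real.sqrt_pos.2 hc
  have hs2 : √c ^ 2 = c := Real.sq_sqrt hc.le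
  obtain ⟨t, ht⟩ := hXG.exists_map_eq_of_covariance_eq hYG (s := √c) (by rwa [hs2])
  rw [hX.eq_of_map_eq hY hf.continuous hg hs ht, hessMass_smul_comp_inv_smul_sub hf hs,
    show √c ^ 4 = (√c ^ 2) ^ 2 by ring, hs2]

theorem ProbabilityTheory.HasGaussianLaw.covariance_add_of_indepFun (hX : HasGaussianLaw X P)
    (hY : HasGaussianLaw Y P) (hXY : IndepFun X Y P) (i j : Fin n) :
    cov[fun ω => (X ω + Y ω) i, fun ω => (X ω + Y ω) j; P] =
      cov[fun ω => X ω i, fun ω => X ω j; P] + cov[fun ω => Y ω i, fun ω => Y ω j; P] := by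
  have hXL (i : Fin n) : MemLp (fun ω => X ω i) 2 P :=
    (hX.map_fun (EuclideanSpace.proj i)).memLp_two
  have hYL (i : Fin n) : MemLp (fun ω => Y ω i) 2 P :=
    (hY.map_fun (EuclideanSpace.proj i)).memLp_two
  have hind (i j : Fin n) : IndepFun (fun ω => X ω i) (fun ω => Y ω j) P :=
    hXY.comp (φ := fun x : EuclideanSpace ℝ (Fin n) => x i)
      (ψ := fun x : EuclideanSpace ℝ (Fin n) => x j) (by fun_prop) (by fun_prop)
  have h0 (i j : Fin n) : cov[fun ω => X ω i, fun ω => Y ω j; P] = 0 :=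
    (hind i j).covariance_eq_zero (hXL i) (hYL j)
  have e (i : Fin n) : (fun ω => (X ω + Y ω) i) = (fun ω => X ω i) + fun ω => Y ω i := rfl
  rw [e, e, covariance_add_left (hXL i) (hYL i) ((hXL j).add (hYL j)),
    covariance_add_right (hXL i) (hXL j) (hYL j), covariance_add_right (hYL i) (hXL j) (hYL j),
    h0, covariance_comm (fun ω => Y ω i), h0]
  ring

end Scaling

/-! ### Densities of the vectors and of their sum, and the main theorem -/

section

variable {n : ℕ} {Ω : Type*} [MeasurableSpace Ω] {P : Measure Ω} [IsProbabilityMeasure P]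
  {X Y : Ω → EuclideanSpace ℝ (Fin n)} {f g : EuclideanSpace ℝ (Fin n) → ℝ}

theorem HasDensity.isRegularDensity (hX : HasDensity X f P) (hf : IsLogConcave f)
    (hf2 : ContDiff ℝ 2 f) (hJ : fisherProduction f < ⊤) : IsRegularDensity f := by
  have : IsProbabilityMeasure (P.map X) := Measure.isProbabilityMeasure_map hX.aemeasurable
  have h1 : ∫⁻ x, ENNReal.ofReal (f x) = 1 := by
    rw [← setLIntegral_univ, ← withDensity_apply _ .univ, ← hX.map_eq, measure_univ]
  have h0 : 0 ≤ᵐ[volume] f := .of_forall hX.nonneg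
  have hm := hf2.continuous.aestronglyMeasurable (μ := volume)
  refine ⟨hf2, hf, ?_, ?_, hJ⟩
  · refine ⟨hm, ?_⟩
    rw [hasFiniteIntegral_iff_ofReal h0, h1]
    exact ENNReal.one_lt_top
  · rw [integral_eq_lintegral_of_nonneg_ae h0 hm, h1, ENNReal.toReal_one]

theorem HasDensity.add_of_indepFun (hX : HasDensity X f P) (hY : HasDensity Y g P)
    (hf : IsRegularDensity f) (hg : IsRegularDensity g) (hXY : IndepFun X Y P) :
    HasDensity (fun ω => X ω + Y ω) (densityConv f g) P := by
  refine ⟨hX.aemeasurable.add hY.aemeasurable, hf.densityConv_nonneg hg, ?_⟩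
  have h1 : P.map (X + Y) = _ := hXY.symm.map_add_eq_map_conv_map₀ hY.aemeasurable hX.aemeasurable
    |> fun h => (add_comm X Y ▸ h)
  have hfm := hf.contDiff.continuous.measurable
  have hgm := hg.contDiff.continuous.measurable
  refine h1.trans ?_
  rw [hX.map_eq, hY.map_eq, conv_withDensity_eq_lconvolution (by fun_prop) (by fun_prop)]
  congr 1
  ext1 z
  rw [hf.ofReal_densityConv hg, lconvolution_def]
  refine lintegral_congr fun y => ?_
  rw [ENNReal.ofReal_mul (hg.nonneg y), neg_add_eq_sub]

end

theorem corollary2 {Ω : Type*} [MeasurableSpace Ω] (P : Measure Ω) [IsProbabilityMeasure P]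
    (n : ℕ) (hn : 1 ≤ n)
    (X Y : Ω → EuclideanSpace ℝ (Fin n)) (hXY : IndepFun X Y P)
    (f g : EuclideanSpace ℝ (Fin n) → ℝ)
    (hX : HasDensity X f P) (hY : HasDensity Y g P)
    (hf : IsLogConcave f) (hg : IsLogConcave g)
    (hf_smooth : ContDiff ℝ 2 f) (hg_smooth : ContDiff ℝ 2 g)
    (hJf : fisherProduction f < ⊤) (hJg : fisherProduction g < ⊤) :
    ∃ k : EuclideanSpace ℝ (Fin n) → ℝ,
      HasDensity (fun ω => X ω + Y ω) k P ∧ IsLogConcave k ∧ ContDiff ℝ 2 k ∧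
      0 < fisherProduction f ∧ 0 < fisherProduction g ∧
      0 < fisherProduction k ∧ fisherProduction k < ⊤ ∧
      1 / √(fisherProduction f).toReal + 1 / √(fisherProduction g).toReal
        ≤ 1 / √(fisherProduction k).toReal ∧
      (1 / √(fisherProduction k).toReal
          = 1 / √(fisherProduction f).toReal + 1 / √(fisherProduction g).toReal ↔
        HasGaussianLaw X P ∧ HasGaussianLaw Y P ∧
          ∃ c : ℝ, 0 < c ∧ ∀ i j : Fin n,
            cov[fun ω => Y ω i, fun ω => Y ω j; P]
              = c * cov[fun ω => X ω i, fun ω => X ω j; P]) := by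
  have rf := hX.isRegularDensity hf hf_smooth hJf
  have rg := hY.isRegularDensity hg hg_smooth hJg
  have rk := rf.conv rg
  have hk := hX.add_of_indepFun hY rf rg hXY
  have hpos {u : EuclideanSpace ℝ (Fin n) → ℝ} (hu : IsRegularDensity u) :
      0 < fisherProduction u := by
    rw [hu.fisherProduction_eq_hessMass]
    exact ENNReal.ofReal_pos.2 (hu.hessMass_pos hn)
  refine ⟨densityConv f g, hk, rk.logConcave, rk.contDiff, hpos rf, hpos rg, hpos rk,
    rk.fisherProduction_lt_top, ?_, ?_⟩
  · rw [rf.toReal_fisherProduction, rg.toReal_fisherProduction, rk.toReal_fisherProduction]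
    exact rf.one_div_sqrt_add_le rg hn
  rw [rf.toReal_fisherProduction, rg.toReal_fisherProduction, rk.toReal_fisherProduction]
  constructor
  · intro heq
    obtain ⟨T, p, q, hp, hq, hT, hT'⟩ := rf.exists_hessLog_eq_of_eq rg hn heq
    obtain ⟨hXG, hXc⟩ := hX.hasGaussianLaw_of_hessLog hf hf_smooth rf.exists_pos T hp hT
    obtain ⟨hYG, hYc⟩ := hY.hasGaussianLaw_of_hessLog hg hg_smooth rg.exists_pos T hq hT'
    refine ⟨hXG, hYG, p ^ 2 / q ^ 2, by positivity, fun i j => ?_⟩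
    rw [hXc, hYc]
    field_simp
  · rintro ⟨hXG, hYG, c, hc, hcov⟩
    have hZG : HasGaussianLaw (fun ω => X ω + Y ω) P := (hXY.hasGaussianLaw hXG hYG).fun_add
    -- Relative to `X`, the covariances of `Y` and `X + Y` carry the factors `c` and `1 + c`, and
    -- `1/√J` scales by the same factors.
    have e1 := hX.hessMass_eq_of_covariance_eq hY hf_smooth hg_smooth.continuous hXG hYG hc hcov
    have e2 := hX.hessMass_eq_of_covariance_eq hk hf_smooth rk.contDiff.continuous hXG hZG
      (c := 1 + c) (by positivity) fun i j => by
        rw [hXG.covariance_add_of_indepFun hYG hXY, hcov]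
        ring
    have hs : 0 < √(hessMass f) := Real.sqrt_pos.2 (rf.hessMass_pos hn)
    rw [e1, e2, Real.sqrt_mul (by positivity), Real.sqrt_mul (by positivity), Real.sqrt_inv,
      Real.sqrt_inv, Real.sqrt_sq hc.le, Real.sqrt_sq (by positivity)]
    field_simp
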